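/- **Setting.** Let $\alpha>0$, $\beta=\frac1{\alpha+1}$, and let $\Theta\in C([0,2\pi);\mathbb R)$ satisfy $0<c_1\le\Theta\le c_2<\infty$. With polar coordinates $(|x|,\vartheta)$ in $\mathbb R^2$, let $H=-\Delta+|x|^{2\alpha}\Theta(\vartheta)^2$ on $L^2(\mathbb R^2)$ (the closure from $C_c^\infty(\mathbb R^2)$), and let $\lambda$ be a non-degenerate eigenvalue of $H$ with spectral projection $P_\lambda$. Let $\mathfrak a\in L^\infty_{\rm loc}(\mathbb R^2;\mathbb R)$ satisfy, for some constant $K$, $|\mathfrak a(x)|\le K|x|^\gamma$ for $|x|<1$ and $|\mathfrak a(x)|\le K|x|^\delta$ for $|x|\ge1$, where $3+\alpha\le\gamma\le\delta<\infty$. For $p\in\mathbb R$, $\varepsilon>0$ and $\eta=\varepsilon^\beta$ put $$\widehat V(x)=\varepsilon^\beta p+2|x|^\alpha\Theta(\vartheta),$$ $$\widehat W(x)=\varepsilon^{\beta(\alpha-\gamma+2)}\big(2\varepsilon^{-2+\beta\alpha}|x|^\alpha\Theta(\vartheta)\,\mathfrak a(\varepsilon^\beta x)+2p\,\varepsilon^{-1}\mathfrak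 a(\varepsilon^\beta x)+\varepsilon^{-2}\mathfrak a(\varepsilon^\beta x)^2\big),$$ $$V=p\widehat V+\eta^{\gamma-\alpha-1}\widehat W,\qquad \mathcal H^\varepsilon_{\mathfrak a}=H+\eta V$$ (the closure from $C_c^\infty(\mathbb R^2)$; equivalently $\mathcal H^\varepsilon_{\mathfrak a}=-\Delta+(\varepsilon^\beta p+|x|^\alpha\Theta(\vartheta)+\varepsilon^{\beta-1}\mathfrak a(\varepsilon^\beta x))^2$). Let $\Gamma$ be the circle around $\lambda$ of radius $\frac12\,{\rm dist}(\lambda,\sigma(H)\setminus\{\lambda\})$, let $S=\frac i{2\pi}\oint_\Gamma(H-\zeta)^{-1}(\lambda-\zeta)^{-1}d\zeta$ be the reduced resolvent, and set $S^0:=-P_\lambda$. For $j\ge0$ let $Q_j$ be the bounded extension from $C_c^\infty(\mathbb R^2)$ to $L^2(\mathbb R^2)$ of $$(-1)^{j+1}\sum_{\nu_1+\dots+\nu_{j+1}=j,\ \nu_l\ge0}S^{\nu_1}VS^{\nu_2}V\cdots VS^{\nu_{j+1}}.$$ For $N\in\mathbb N_0$ let $T_N=\sum_{j=0}^N\eta^jQ_j$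 and $P_N=P_N(\varepsilon^\beta)=\frac i{2\pi}\oint_{|z-1|=1/2}(T_N-z)^{-1}dz$. **Proposition 3.5.** Let $N\in\mathbb N_0$ and $p_0<\infty$. There are constants $C,\varepsilon_0>0$, independent of $\varepsilon$, $t$ and $p$, such that for all $0<\varepsilon<\varepsilon_0$ and all $|p|\le p_0$ the following holds. The operator $P_N$ is an orthogonal projection of rank one, and $P_N\mathcal H^\varepsilon_{\mathfrak a}P_N$ is defined on its range and acts there as multiplication by a real number. For all $t\in(0,\infty)$, $$\big\|(1-P_N)\,e^{-it\varepsilon^{-2\beta}\mathcal H^\varepsilon_{\mathfrak a}}\,P_N\big\|\le C\,|t|\,\varepsilon^{\beta(N-1)}.$$ Moreover, if $\widetilde\chi_N$ in the range of $P_N$ is normalized and $P_N\mathcal H^\varepsilon_{\mathfrak a}P_N\widetilde\chi_N=\widetilde\lambda_N\widetilde\chi_N$ with $\widetilde\lambda_N\in\mathbb R$, then for all $t\in(0,\infty)$ $$\big\|e^{-it\varepsilon^{-2\beta}\mathcal H^\varepsilon_{\mathfrak a}}\widetilde\chi_N-e^{-it\varepsilon^{-2\beta}\widetilde\lambda_N}\widetilde\chi_N\big\|_{L^2(\mathbb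 R^2)}\le C\,|t|\,\varepsilon^{\beta(N-1)}.$$ -/

import Mathlib

open MeasureTheory Filter Topology Set
open scoped Laplacian ContDiff

noncomputable section

namespace AlmostInvariant

/-- The plane `ℝ²` with its Euclidean norm. -/
abbrev Plane : Type := EuclideanSpace ℝ (Fin 2)

/-- The complex Hilbert space `L²(ℝ²)`. -/
abbrev L2 : Type := Lp ℂ 2 (volume : Measure Plane)

/-! ### Unbounded operators on `L²(ℝ²)`

They are Mathlib's partially defined linear maps. -/

/-- The composition `B A` of partially defined operators on its maximal domain
`{f ∈ D(A) | A f ∈ D(B)}`. -/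
def pcomp (B A : L2 →ₗ.[ℂ] L2) : L2 →ₗ.[ℂ] L2 :=
  B.comp (A.domRestrict ((B.domain.comap A.toFun).map A.domain.subtype)) (by
    rintro ⟨x, ⟨y, hy, hyx⟩, hx⟩
    have hy' : A y ∈ B.domain := hy
    have hxy : A.domRestrict ((B.domain.comap A.toFun).map A.domain.subtype)
        ⟨x, ⟨y, hy, hyx⟩, hx⟩ = A y := LinearPMap.domRestrict_apply (by exact hyx.symm)
    rw [hxy]
    exact hy')

/-- An everywhere defined bounded operator, seen as a partially defined one. -/
def ofBounded (T : L2 →L[ℂ] L2) : L2 →ₗ.[ℂ] L2 :=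
  (T : L2 →ₗ[ℂ] L2).toPMap ⊤

/-- The eigenspace `{f ∈ D(A) | A f = μ f}`. -/
def eigenspace (A : L2 →ₗ.[ℂ] L2) (μ : ℂ) : Submodule ℂ L2 :=
  A.graph.comap (LinearMap.prod LinearMap.id (μ • LinearMap.id))

/-- `R` is the bounded two-sided inverse of `A - z`. -/
def IsResolventAt (A : L2 →ₗ.[ℂ] L2) (z : ℂ) (R : L2 →L[ℂ] L2) : Prop :=
  (∀ f : L2, (R f, f + z • R f) ∈ A.graph) ∧ ∀ f g : L2, (f, g) ∈ A.graph → R (g - z • f) = f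

/-- The spectrum of `A`: all `z` for which `A - z` has no bounded inverse. -/
def pspectrum (A : L2 →ₗ.[ℂ] L2) : Set ℂ :=
  {z | ¬ ∃ R, IsResolventAt A z R}

/-- The resolvent `(A - z)⁻¹` (meaningful for `z` outside the spectrum). -/
def presolvent (A : L2 →ₗ.[ℂ] L2) (z : ℂ) : L2 →L[ℂ] L2 :=
  Classical.epsilon (IsResolventAt A z)

/-- `U` is a strongly continuous one-parameter unitary group whose generator is exactly `-iA`. -/
structure IsUnitaryGroupOf (A : L2 →ₗ.[ℂ] L2) (U : ℝ → L2 →L[ℂ] L2) : Prop where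
  map_zero : U 0 = 1
  map_add : ∀ s t, U (s + t) = U s * U t
  mem_unitary : ∀ t, U t ∈ unitary (L2 →L[ℂ] L2)
  continuous : ∀ f, Continuous fun t => U t f
  generator : ∀ f g, (f, g) ∈ A.graph ↔ HasDerivAt (fun t => U t f) (-(Complex.I • g)) 0

/-- The unitary group `e^{-itA}` of a self-adjoint operator `A`: the unique unitary group with
generator `-iA`. -/
def expGroup (A : L2 →ₗ.[ℂ] L2) : ℝ → L2 →L[ℂ] L2 :=
  Classical.epsilon (IsUnitaryGroupOf A)

/-! ### Schrödinger operators -/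

theorem two_le_infty : (2 : WithTop ℕ∞) ≤ ∞ :=
  WithTop.coe_le_coe.2 (le_top : (2 : ℕ∞) ≤ ⊤)

/-- The set of pairs `(φ, -Δφ + Wφ)` with `φ ∈ C_c^∞(ℝ²)` (as classes in `L²`). -/
def coreGraph (W : Plane → ℝ) : Submodule ℂ (L2 × L2) where
  carrier := {q | ∃ φ : Plane → ℂ, ContDiff ℝ ∞ φ ∧ HasCompactSupport φ ∧
    q.1 =ᵐ[volume] φ ∧ q.2 =ᵐ[volume] fun x => -(Δ φ) x + (W x : ℂ) * φ x}
  zero_mem' := by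
    refine ⟨0, contDiff_const, HasCompactSupport.zero, Lp.coeFn_zero _ _ _, ?_⟩
    have h : (Δ (0 : Plane → ℂ)) = 0 := by
      have := InnerProductSpace.laplacian_const (E := Plane) (F := ℂ) (c := 0)
      exact this
    filter_upwards [Lp.coeFn_zero ℂ 2 (volume : Measure Plane)] with x _
    simp [h]
  add_mem' := by
    rintro ⟨f, g⟩ ⟨f', g'⟩ ⟨φ, h1, h2, h3, h4⟩ ⟨φ', h1', h2', h3', h4'⟩
    refine ⟨φ + φ', h1.add h1', h2.add h2', ?_, ?_⟩
    · filter_upwards [Lp.coeFn_add f f', h3, h3'] with x hx ha hb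
      have ha' : f x = φ x := ha
      have hb' : f' x = φ' x := hb
      have hx' : (f + f') x = f x + f' x := hx
      change (f + f') x = φ x + φ' x
      rw [hx', ha', hb']
    · filter_upwards [Lp.coeFn_add g g', h4, h4'] with x hx ha hb
      have hx' : (g + g') x = g x + g' x := hx
      have ha' : g x = _ := ha
      have hb' : g' x = _ := hb
      have hΔ : (Δ (φ + φ')) x = (Δ φ) x + (Δ φ') x :=
        ((h1.of_le two_le_infty).contDiffAt).laplacian_add
          ((h1'.of_le two_le_infty).contDiffAt)
      change (g + g') x = _
      rw [hx', ha', hb', hΔ, Pi.add_apply]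
      ring
  smul_mem' := by
    rintro c ⟨f, g⟩ ⟨φ, h1, h2, h3, h4⟩
    refine ⟨c • φ, contDiff_const.smul h1, h2.smul_left (f := fun _ => c), ?_, ?_⟩
    · filter_upwards [Lp.coeFn_smul c f, h3] with x hx ha
      have hx' : (c • f) x = c • f x := hx
      have ha' : f x = φ x := ha
      change (c • f) x = c • φ x
      rw [hx', ha']
    · filter_upwards [Lp.coeFn_smul c g, h4] with x hx ha
      have hx' : (c • g) x = c • g x := hx
      have ha' : g x = _ := ha
      have hΔ : (Δ (c • φ)) x = c • (Δ φ) x :=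
        InnerProductSpace.laplacian_smul c ((h1.of_le two_le_infty).contDiffAt)
      change (c • g) x = _
      rw [hx', ha', hΔ, Pi.smul_apply]
      simp only [smul_eq_mul]
      ring

/-- The Schrödinger operator `-Δ + W` on `L²(ℝ²)`: the closure of `-Δ + W` on `C_c^∞(ℝ²)`, that is,
its self-adjoint realization when it is essentially self-adjoint there (for instance for
`0 ≤ W ∈ L^∞_loc`). -/
def schrodinger (W : Plane → ℝ) : L2 →ₗ.[ℂ] L2 :=
  (coreGraph W).toLinearPMap.closure

/-- Multiplication by the real function `V`, on its maximal domain `{f ∈ L² | V f ∈ L²}`. -/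
def mulOp (V : Plane → ℝ) : L2 →ₗ.[ℂ] L2 :=
  Submodule.toLinearPMap
    { carrier := {q : L2 × L2 | q.2 =ᵐ[volume] fun x => (V x : ℂ) * q.1 x}
      zero_mem' := by
        filter_upwards [Lp.coeFn_zero ℂ 2 (volume : Measure Plane)] with x _
        simp
      add_mem' := by
        rintro ⟨f, g⟩ ⟨f', g'⟩ h h'
        change (g + g' : L2) =ᵐ[volume] fun x => (V x : ℂ) * (f + f' : L2) x
        filter_upwards [Lp.coeFn_add f f', Lp.coeFn_add g g', h, h'] with x hf hg hx hx'
        have h1 : (f + f') x = f x + f' x := hf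
        have h2 : (g + g') x = g x + g' x := hg
        have h3 : g x = V x * f x := hx
        have h4 : g' x = V x * f' x := hx'
        rw [h1, h2, h3, h4]
        ring
      smul_mem' := by
        rintro c ⟨f, g⟩ h
        change (c • g : L2) =ᵐ[volume] fun x => (V x : ℂ) * (c • f : L2) x
        filter_upwards [Lp.coeFn_smul c f, Lp.coeFn_smul c g, h] with x hf hg hx
        have h1 : (c • f) x = c • f x := hf
        have h2 : (c • g) x = c • g x := hg
        have h3 : g x = V x * f x := hx
        rw [h1, h2, h3]
        simp only [smul_eq_mul]
        ring }

/-! ### Perturbation theory at an isolated eigenvalue -/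

/-- The orthogonal projection `P_λ` onto the eigenspace of `H` at `λ` (a closed subspace if `H` is a
closed operator). -/
def eigenProj (H : L2 →ₗ.[ℂ] L2) (lam : ℝ) : L2 →L[ℂ] L2 :=
  (eigenspace H lam).topologicalClosure.starProjection

/-- The distance of `λ` to the rest of the spectrum of `H`. -/
def gap (H : L2 →ₗ.[ℂ] L2) (lam : ℝ) : ℝ :=
  Metric.infDist (lam : ℂ) (pspectrum H \ {(lam : ℂ)})

/-- The reduced resolvent `S = (i/2π) ∮_Γ (H - ζ)⁻¹ (λ - ζ)⁻¹ dζ`, where `Γ` is the circle around `λ`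
whose radius is half the distance of `λ` to the rest of the spectrum. -/
def reducedResolvent (H : L2 →ₗ.[ℂ] L2) (lam : ℝ) : L2 →L[ℂ] L2 :=
  (Complex.I / (2 * Real.pi)) •
    ∮ ζ in C((lam : ℂ), gap H lam / 2), ((lam : ℂ) - ζ)⁻¹ • presolvent H ζ

/-- The powers `S^ν` with the convention `S^0 = -P_λ`. -/
def redPow (H : L2 →ₗ.[ℂ] L2) (lam : ℝ) : ℕ → L2 →L[ℂ] L2
  | 0 => -eigenProj H lam
  | n + 1 => reducedResolvent H lam ^ (n + 1)

/-- The operator `S^{ν_0} V S^{ν_1} V ⋯ V S^{ν_j}` on its maximal domain. -/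
def word (H : L2 →ₗ.[ℂ] L2) (lam : ℝ) (V : Plane → ℝ) : (j : ℕ) → (Fin (j + 1) → ℕ) → L2 →ₗ.[ℂ] L2
  | 0, ν => ofBounded (redPow H lam (ν 0))
  | j + 1, ν =>
      pcomp (ofBounded (redPow H lam (ν 0))) (pcomp (mulOp V) (word H lam V j (Fin.tail ν)))

/-- `(-1)^{j+1} ∑ S^{ν_0} V S^{ν_1} V ⋯ V S^{ν_j}`, the sum being over all `ν_0, …, ν_j ≥ 0` with
`ν_0 + ⋯ + ν_j = j`. -/
def preCoeff (H : L2 →ₗ.[ℂ] L2) (lam : ℝ) (V : Plane → ℝ) (j : ℕ) : L2 →ₗ.[ℂ] L2 :=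
  ((-1 : ℂ) ^ (j + 1)) • ∑ ν ∈ Finset.Nat.antidiagonalTuple (j + 1) j, word H lam V j ν

/-- `Q` is the extension by continuity of `A` from `C_c^∞(ℝ²)`: all test functions belong to the domain
of `A`, and the bounded operator `Q` agrees with `A` on them. -/
def IsContinuousExtension (A : L2 →ₗ.[ℂ] L2) (Q : L2 →L[ℂ] L2) : Prop :=
  ∀ (f : L2) (φ : Plane → ℂ), ContDiff ℝ ∞ φ → HasCompactSupport φ → f =ᵐ[volume] φ →
    (f, Q f) ∈ A.graph

/-- The coefficient `Q_j` of the formal perturbation series, a bounded operator. -/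
def coeff (H : L2 →ₗ.[ℂ] L2) (lam : ℝ) (V : Plane → ℝ) (j : ℕ) : L2 →L[ℂ] L2 :=
  Classical.epsilon (IsContinuousExtension (preCoeff H lam V j))

/-- The truncated series `T_N = ∑_{j=0}^N η^j Q_j`. -/
def truncSeries (H : L2 →ₗ.[ℂ] L2) (lam : ℝ) (V : Plane → ℝ) (η : ℝ) (N : ℕ) : L2 →L[ℂ] L2 :=
  ∑ j ∈ Finset.range (N + 1), ((η : ℂ) ^ j) • coeff H lam V j

/-- `P_N = (i/2π) ∮_{|z-1|=1/2} (T_N - z)⁻¹ dz`. -/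
def almostProj (H : L2 →ₗ.[ℂ] L2) (lam : ℝ) (V : Plane → ℝ) (η : ℝ) (N : ℕ) : L2 →L[ℂ] L2 :=
  (Complex.I / (2 * Real.pi)) •
    ∮ z in C((1 : ℂ), 1 / 2), Ring.inverse (truncSeries H lam V η N - z • (1 : L2 →L[ℂ] L2))

/-- The effective Hamiltonian `P A P` on its maximal domain. -/
def compress (P : L2 →L[ℂ] L2) (A : L2 →ₗ.[ℂ] L2) : L2 →ₗ.[ℂ] L2 :=
  pcomp (ofBounded P) (pcomp A (ofBounded P))

/-! ### The magnetic model -/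

/-- The polar angle in `[0, 2π)`. -/
def polarAngle (x : Plane) : ℝ :=
  toIcoMod Real.two_pi_pos 0 (Complex.arg ⟨x 0, x 1⟩)

/-- The homogeneous part `|x|^α Θ(ϑ)` of the vector potential. -/
def homPot (α : ℝ) (Θ : ℝ → ℝ) (x : Plane) : ℝ :=
  ‖x‖ ^ α * Θ (polarAngle x)

/-- The confining potential `|x|^{2α} Θ(ϑ)²`. -/
def confPot (α : ℝ) (Θ : ℝ → ℝ) (x : Plane) : ℝ :=
  ‖x‖ ^ (2 * α) * Θ (polarAngle x) ^ 2

/-- The unperturbed operator `H = -Δ + |x|^{2α} Θ(ϑ)²`. -/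
def H0 (α : ℝ) (Θ : ℝ → ℝ) : L2 →ₗ.[ℂ] L2 :=
  schrodinger (confPot α Θ)

/-- The exponent `β = 1 / (α + 1)`. -/
def beta (α : ℝ) : ℝ := 1 / (α + 1)

/-- `V̂^{ε,p}(x) = ε^β p + 2 |x|^α Θ(ϑ)`. -/
def Vhat (α : ℝ) (Θ : ℝ → ℝ) (ε p : ℝ) (x : Plane) : ℝ :=
  ε ^ beta α * p + 2 * homPot α Θ x

/-- `Ŵ_𝔞^{ε,p}(x) = ε^{β(α-γ+2)} (2 ε^{-2+βα} |x|^α Θ(ϑ) 𝔞(ε^β x) + 2 p ε⁻¹ 𝔞(ε^β x)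
+ ε⁻² 𝔞(ε^β x)²)`. -/
def What (α γ : ℝ) (Θ : ℝ → ℝ) (𝔞 : Plane → ℝ) (ε p : ℝ) (x : Plane) : ℝ :=
  ε ^ (beta α * (α - γ + 2)) *
    (2 * ε ^ (-2 + beta α * α) * homPot α Θ x * 𝔞 (ε ^ beta α • x)
      + 2 * p * ε ^ (-1 : ℝ) * 𝔞 (ε ^ beta α • x)
      + ε ^ (-2 : ℝ) * 𝔞 (ε ^ beta α • x) ^ 2)

/-- The full perturbation `V_𝔞^η = p V̂^{ε,p} + η^{γ-α-1} Ŵ_𝔞^{ε,p}`, where `η = ε^β`. -/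
def Va (α γ : ℝ) (Θ : ℝ → ℝ) (𝔞 : Plane → ℝ) (ε p : ℝ) (x : Plane) : ℝ :=
  p * Vhat α Θ ε p x + (ε ^ beta α) ^ (γ - α - 1) * What α γ Θ 𝔞 ε p x

/-- The perturbed fiber Hamiltonian `𝓗_𝔞^ε(p) = H + ε^β V_𝔞^η`. -/
def Ha (α γ : ℝ) (Θ : ℝ → ℝ) (𝔞 : Plane → ℝ) (ε p : ℝ) : L2 →ₗ.[ℂ] L2 :=
  schrodinger fun x => confPot α Θ x + ε ^ beta α * Va α γ Θ 𝔞 ε p x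

/-- The propagator `e^{-itε^{-2β} 𝓗_𝔞^ε(p)}` at time `t`. -/
def propagator (α γ : ℝ) (Θ : ℝ → ℝ) (𝔞 : Plane → ℝ) (ε p t : ℝ) : L2 →L[ℂ] L2 :=
  expGroup (Ha α γ Θ 𝔞 ε p) (t * ε ^ (-2 * beta α))

/-- The projection `P_N(ε^β)` built from `H`, its eigenvalue `λ` and the perturbation `V_𝔞^η`. -/
def PN (α γ : ℝ) (Θ : ℝ → ℝ) (𝔞 : Plane → ℝ) (lam : ℝ) (N : ℕ) (ε p : ℝ) : L2 →L[ℂ] L2 :=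
  almostProj (H0 α Θ) lam (Va α γ Θ 𝔞 ε p) (ε ^ beta α) N

/-- The effective Hamiltonian `𝓗_{𝔞,N}(ε^β) = P_N(ε^β) 𝓗_𝔞^ε P_N(ε^β)`. -/
def effHam (α γ : ℝ) (Θ : ℝ → ℝ) (𝔞 : Plane → ℝ) (lam : ℝ) (N : ℕ) (ε p : ℝ) : L2 →ₗ.[ℂ] L2 :=
  compress (PN α γ Θ 𝔞 lam N ε p) (Ha α γ Θ 𝔞 ε p)

end AlmostInvariant

end

open AlmostInvariant

/-! The range of $P_N$ is spanned by a unit vector $\psi$ that is almost an eigenvector of $A=H+\eta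
V$: its residual $A\psi-\langle\psi,A\psi\rangle\psi$ has norm at most $C\eta^{N+1}$.
Differentiating $e^{it\mu}e^{-itA}\psi$ with $\mu=\langle\psi,A\psi\rangle$ then bounds the
deviation from $e^{-it\mu}\psi$ by $|t|$ times the residual (`IsUnitaryGroupOf.norm_sub_le`,
`almost_invariant`). At the rescaled time $t\varepsilon^{-2\beta}$ the bound becomes
$\eta^{N+1}\varepsilon^{-2\beta}=\varepsilon^{\beta(N-1)}$.

The residual estimate rests on one algebraic fact. From $(H-\lambda)S^0=0$, $(H-\lambda)S=1+S^0$ and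
$(H-\lambda)S^{k+1}=S^k$ for $k\ge1$ one gets $[H,Q_0]=0$ and $[H,Q_{j+1}]=-[V,Q_j]$
(`coeffEnd_commutator`). The sum telescopes to $[H+\eta V,T_N]=\eta^{N+1}[V,Q_N]$
(`truncEnd_commutator`). Next, $T_N$ is compact, self-adjoint and within $1/16$ of the rank one
projection $P_\lambda$, so it has one eigenvalue $m$ near $1$ with unit eigenvector $\psi$ and norm
at most $7/16$ on $\psi^\perp$ (`exists_dominant_eigenvector`). The contour integral therefore picks
out the projection onto $\psi$ (`riesz_eq`). Applying the commutator to $\psi$ gives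
$(m-T_N)A\psi=\eta^{N+1}[V,Q_N]\psi$. On $\psi^\perp$ the operator $m-T_N$ is bounded below by
$15/16-7/16=1/2$, which controls the residual (`exists_almost_eigenvector`). Approximate idempotence
of $T_N$ is not needed.

The unbounded $V$ is handled on the space `rapid` of functions with all norms $\|(1+|x|^2)^nf\|$
finite. Multiplication by $V$ preserves it because $V$ is polynomially bounded, uniformly in
$\varepsilon$ and $p$ (`magnetic_family`). $S$ preserves it by a weighted energy estimate that uses
the growth of the potential (`wnorm_le_of_mem_graph`). A word in $Q_j$ has $j+1$ exponents of total
$j$, so some exponent is $0$ and a factor $-P_\lambda$ occurs. Hence $Q_j$ has finite rank and maps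
$L^2$ into `rapid` (`smoothing_wsum`).

The objects chosen by `Classical.epsilon` are meaningful only once existence is known. This requires
self-adjointness of $-\Delta+W$ for $W\ge0$ (`posSA_schrodinger`), Stone's theorem
(`PosSA.exists_unitaryGroup`), compactness of the resolvent (`isCompactOperator_resolvent`) and
isolation of $\lambda$ (`SimpleEigen.gap_pos`). -/

open MeasureTheory Filter Topology Set
open scoped Laplacian ContDiff
open AlmostInvariant

noncomputable section

namespace AlmostInvariant

/-! ### Calculus in the plane -/

section Calculus

variable {F : Type*} [NormedAddCommGroup F] [NormedSpace ℝ F]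

/-- The partial derivative in the direction of the `i`-th coordinate. -/
def pd (i : Fin 2) (f : Plane → F) (x : Plane) : F :=
  fderiv ℝ f x (EuclideanSpace.single i 1)

theorem contDiff_pd {n m : WithTop ℕ∞} {f : Plane → F} (hf : ContDiff ℝ n f) (h : m + 1 ≤ n)
    (i : Fin 2) : ContDiff ℝ m (pd i f) :=
  (hf.fderiv_right h).clm_apply contDiff_const

theorem hasCompactSupport_pd {f : Plane → F} (hf : HasCompactSupport f) (i : Fin 2) :
    HasCompactSupport (pd i f) :=
  hf.fderiv_apply ℝ _

theorem laplacian_eq_sum_pd {f : Plane → F} (hf : ContDiff ℝ 2 f) (x : Plane) :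
    (Δ f) x = ∑ i, pd i (pd i f) x := by
  rw [InnerProductSpace.laplacian_eq_iteratedFDeriv_orthonormalBasis f
    (EuclideanSpace.basisFun (Fin 2) ℝ)]
  refine Finset.sum_congr rfl fun i _ => ?_
  rw [iteratedFDeriv_two_apply]
  have h1 : DifferentiableAt ℝ (fderiv ℝ f) x :=
    ((hf.fderiv_right (m := 1) (by norm_num)).differentiable (by norm_num)).differentiableAt
  simp only [pd, Matrix.cons_val_zero, Matrix.cons_val_one, EuclideanSpace.basisFun_apply]
  have h2 : pd i f = fun y => (fderiv ℝ f y) ((fun _ => EuclideanSpace.single i 1) y) := rfl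
  rw [h2, fderiv_clm_apply h1 (differentiableAt_const _)]
  simp

theorem hasCompactSupport_laplacian {f : Plane → F} (hf : HasCompactSupport f) :
    HasCompactSupport (Δ f) := by
  rw [InnerProductSpace.laplacian_eq_iteratedFDeriv_orthonormalBasis f
    (EuclideanSpace.basisFun (Fin 2) ℝ)]
  have := hf.iteratedFDeriv (𝕜 := ℝ) 2
  refine this.mono fun x hx => ?_
  contrapose! hx
  simp only [Function.mem_support, not_not] at hx ⊢
  simp [hx]

theorem continuous_laplacian {f : Plane → F} (hf : ContDiff ℝ 2 f) : Continuous (Δ f) := by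
  have : Δ f = fun x => ∑ i, pd i (pd i f) x := funext (laplacian_eq_sum_pd hf)
  rw [this]
  exact continuous_finsetSum _ fun i _ =>
    (contDiff_pd (m := 0) (contDiff_pd (m := 1) hf (by norm_num) i) (by norm_num) i).continuous

/-- Integration by parts against a bilinear form, one factor having compact support. -/
theorem integral_bilin_pd {F G W : Type*} [NormedAddCommGroup F] [NormedSpace ℝ F]
    [NormedAddCommGroup G] [NormedSpace ℝ G] [NormedAddCommGroup W] [NormedSpace ℝ W]
    (B : F →L[ℝ] G →L[ℝ] W) {f : Plane → F} {g : Plane → G}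
    (hf : ContDiff ℝ 1 f) (hg : ContDiff ℝ 1 g) (hc : HasCompactSupport f) (i : Fin 2) :
    ∫ x, B (f x) (pd i g x) = - ∫ x, B (pd i f x) (g x) := by
  have cf' := (contDiff_pd (m := 0) hf (by norm_num) i).continuous
  have cg' := (contDiff_pd (m := 0) hg (by norm_num) i).continuous
  have hB : Continuous fun p : F × G => B p.1 p.2 := by fun_prop
  have key : ∀ (u : Plane → F) (v : Plane → G), Continuous u → Continuous v →
      HasCompactSupport u → Integrable fun x => B (u x) (v x) := by
    intro u v hu hv huc
    refine Continuous.integrable_of_hasCompactSupport (hB.comp (hu.prodMk hv)) ?_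
    refine huc.mono fun x hx => ?_
    contrapose! hx
    simp only [Function.mem_support, not_not] at hx ⊢
    simp [hx]
  exact integral_bilinear_fderiv_right_eq_neg_left_of_integrable
    (key _ _ cf' hg.continuous (hasCompactSupport_pd hc i)) (key _ _ hf.continuous cg' hc)
    (key _ _ hf.continuous hg.continuous hc)
    (fun x _ => (hf.differentiable (by norm_num)).differentiableAt)
    (fun x _ => (hg.differentiable (by norm_num)).differentiableAt)

end Calculus

theorem integral_mul_laplacian_comm {u v : Plane → ℂ} (hu : ContDiff ℝ 2 u) (hv : ContDiff ℝ 2 v)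
    (hc : HasCompactSupport u) : ∫ x, u x * (Δ v) x = ∫ x, (Δ u) x * v x := by
  simp_rw [laplacian_eq_sum_pd hu, laplacian_eq_sum_pd hv, Finset.mul_sum, Finset.sum_mul]
  have hu1 := fun i => contDiff_pd (m := 1) hu (by norm_num) i
  have hv1 := fun i => contDiff_pd (m := 1) hv (by norm_num) i
  have hu2 := fun i => (contDiff_pd (m := 0) (hu1 i) (by norm_num) i).continuous
  have hv2 := fun i => (contDiff_pd (m := 0) (hv1 i) (by norm_num) i).continuous
  have hc1 := fun i => hasCompactSupport_pd hc i
  rw [integral_finsetSum, integral_finsetSum]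
  · refine Finset.sum_congr rfl fun i _ => ?_
    have h1 := integral_bilin_pd (ContinuousLinearMap.mul ℝ ℂ) (hu.of_le (by norm_num))
      (hv1 i) hc i
    have h2 := integral_bilin_pd (ContinuousLinearMap.mul ℝ ℂ) (hu1 i)
      (hv.of_le (by norm_num)) (hc1 i) i
    simp only [ContinuousLinearMap.mul_apply'] at h1 h2
    rw [h1, h2, neg_neg]
  · exact fun i _ => Continuous.integrable_of_hasCompactSupport ((hu2 i).mul hv.continuous)
      (hasCompactSupport_pd (hc1 i) i).mul_right
  · exact fun i _ => Continuous.integrable_of_hasCompactSupport (hu.continuous.mul (hv2 i))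
      hc.mul_right

theorem integral_inner_laplacian {u v : Plane → ℂ} (hu : ContDiff ℝ 1 u) (hv : ContDiff ℝ 2 v)
    (hc : HasCompactSupport u) :
    ∫ x, inner ℝ (u x) (-(Δ v) x) = ∫ x, ∑ i, inner ℝ (pd i u x) (pd i v x) := by
  have hv1 := fun i => contDiff_pd (m := 1) hv (by norm_num) i
  have hu1 := fun i => (contDiff_pd (m := 0) hu (by norm_num) i).continuous
  have hv2 := fun i => (contDiff_pd (m := 0) (hv1 i) (by norm_num) i).continuous
  have hcomp : ∀ f g : Plane → ℂ, Continuous f → Continuous g → HasCompactSupport f →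
      Integrable fun x => inner ℝ (f x) (g x) := by
    intro f g hf hg hfc
    refine Continuous.integrable_of_hasCompactSupport (hf.inner hg) (hfc.mono fun x hx => ?_)
    contrapose! hx
    simp only [Function.mem_support, not_not] at hx ⊢
    simp [hx]
  simp_rw [laplacian_eq_sum_pd hv, inner_neg_right, inner_sum]
  rw [integral_neg, integral_finsetSum, integral_finsetSum, ← Finset.sum_neg_distrib]
  · refine Finset.sum_congr rfl fun i _ => ?_
    have : ∫ x, inner ℝ (u x) (pd i (pd i v) x) = - ∫ x, inner ℝ (pd i u x) (pd i v x) :=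
      integral_bilin_pd (innerSL ℝ (E := ℂ)) hu (hv1 i) hc i
    rw [this, neg_neg]
  · exact fun i _ => hcomp _ _ (hu1 i) (hv1 i).continuous (hasCompactSupport_pd hc i)
  · exact fun i _ => hcomp _ _ hu.continuous (hv2 i) hc

/-- Weighted positivity of `-Δ`: `-∫ |∇w|² |φ|² ≤ Re ∫ w² φ̄ (-Δφ)`. -/
theorem energy_ineq {w : Plane → ℝ} {φ : Plane → ℂ} (hw : ContDiff ℝ 1 w) (hφ : ContDiff ℝ 2 φ)
    (hc : HasCompactSupport w ∨ HasCompactSupport φ) :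
    - ∫ x, (∑ i, pd i w x ^ 2) * ‖φ x‖ ^ 2 ≤ ∫ x, w x ^ 2 * inner ℝ (φ x) (-(Δ φ) x) := by
  have hu : ContDiff ℝ 1 fun x => w x ^ 2 • φ x :=
    ContDiff.smul (hw.pow 2) (hφ.of_le (by norm_num))
  have hcu : HasCompactSupport fun x => w x ^ 2 • φ x := by
    rcases hc with h | h
    all_goals
      refine h.mono fun x hx => ?_
      contrapose! hx
      simp only [Function.mem_support, not_not] at hx ⊢
      simp [hx]
  have h1 := integral_inner_laplacian hu hφ hcu
  simp_rw [real_inner_smul_left] at h1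
  rw [h1, ← integral_neg]
  have hw1 := fun i => (contDiff_pd (m := 0) hw (by norm_num) i).continuous
  have hφ1 := fun i => (contDiff_pd (m := 1) hφ (by norm_num) i).continuous
  have hu1 := fun i => (contDiff_pd (m := 0) hu (by norm_num) i).continuous
  have hcφ := hφ.continuous
  refine integral_mono ?_ ?_ fun x => ?_
  · refine Continuous.integrable_of_hasCompactSupport (by fun_prop) ?_
    rcases hc with h | h
    · have : HasCompactSupport fun x => ∑ i, pd i w x ^ 2 := by
        refine HasCompactSupport.mono' (h.fderiv ℝ) fun x hx => ?_
        contrapose! hx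
        have : fderiv ℝ w x = 0 := image_eq_zero_of_notMem_tsupport hx
        simp [pd, this]
      exact this.mul_right.neg
    · have : HasCompactSupport fun x => ‖φ x‖ ^ 2 := by
        refine h.mono fun x hx => ?_
        contrapose! hx
        simp only [Function.mem_support, not_not] at hx ⊢
        simp [hx]
      exact this.mul_left.neg
  · refine Continuous.integrable_of_hasCompactSupport (by fun_prop) ?_
    refine HasCompactSupport.mono' (hcu.fderiv ℝ) fun x hx => ?_
    contrapose! hx
    have h0 : fderiv ℝ (fun x => w x ^ 2 • φ x) x = 0 := image_eq_zero_of_notMem_tsupport hx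
    have hz : ∀ i, pd i (fun x => w x ^ 2 • φ x) x = 0 := fun i => by
      unfold pd
      rw [h0]
      rfl
    simp only [Function.mem_support, hz, inner_zero_left, Finset.sum_const_zero, ne_eq,
      not_true_eq_false, not_false_eq_true]
  · simp only
    rw [Finset.sum_mul, ← Finset.sum_neg_distrib]
    refine Finset.sum_le_sum fun i _ => ?_
    have e : pd i (fun x => w x ^ 2 • φ x) x =
        (w x ^ 2) • pd i φ x + (2 * w x * pd i w x) • φ x := by
      have d1 : DifferentiableAt ℝ w x := (hw.differentiable (by norm_num)).differentiableAt
      have d2 : DifferentiableAt ℝ φ x := (hφ.differentiable (by norm_num)).differentiableAt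
      have := ((d1.hasFDerivAt.pow 2).smul d2.hasFDerivAt).fderiv
      refine (congrArg (fun L => L (EuclideanSpace.single i 1)) this).trans ?_
      simp only [pd, add_apply, smul_apply, ContinuousLinearMap.smulRight_apply, nsmul_eq_mul, Nat.cast_ofNat,
        smul_eq_mul, Nat.add_one_sub_one, pow_one]
    rw [e, inner_add_left, real_inner_smul_left, real_inner_smul_left,
      real_inner_self_eq_norm_sq]
    -- Completing the square:
    -- $\langle\partial(w^2\varphi),\partial\varphi\rangle=|\partial(w\varphi)|^2-|\partial
    -- w|^2|\varphi|^2$, and the first term on the right is dropped.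
    have h2 : 0 ≤ ‖w x • pd i φ x + pd i w x • φ x‖ ^ 2 := by positivity
    rw [norm_add_sq_real, real_inner_smul_left, real_inner_smul_right, norm_smul, norm_smul,
      mul_pow, mul_pow, Real.norm_eq_abs, Real.norm_eq_abs, sq_abs, sq_abs,
      real_inner_comm] at h2
    linarith

/-! ### Graphs of partially defined operators -/

/-- Domains of partial maps are subtypes that are awkward to rewrite. Every later argument about
unbounded operators is therefore phrased through membership of pairs in graphs, for which
composition is composition of relations. -/
theorem mem_graph_pcomp {B A : L2 →ₗ.[ℂ] L2} {x z : L2} :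
    (x, z) ∈ (pcomp B A).graph ↔ ∃ y, (x, y) ∈ A.graph ∧ (y, z) ∈ B.graph := by
  constructor
  · intro h
    obtain ⟨⟨u, hu⟩, hux, huz⟩ := (LinearPMap.mem_graph_iff _).1 h
    obtain ⟨y, hy, hyu⟩ : u ∈ (B.domain.comap A.toFun).map A.domain.subtype := hu.1
    have hy' : A y ∈ B.domain := hy
    simp only at hux
    subst hux
    refine ⟨A y, ?_, ?_⟩
    · have := A.mem_graph y
      rwa [show (y : L2) = u from hyu] at this
    · have h1 : (pcomp B A) ⟨u, hu⟩ = B ⟨A y, hy'⟩ := by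
        refine congrArg B (Subtype.ext ?_)
        exact LinearPMap.domRestrict_apply (by exact hyu.symm)
      simp only at huz
      rw [← huz, h1]
      exact B.mem_graph ⟨A y, hy'⟩
  · rintro ⟨y, h1, h2⟩
    obtain ⟨⟨u, hu⟩, hux, huy⟩ := (LinearPMap.mem_graph_iff _).1 h1
    obtain ⟨⟨v, hv⟩, hvx, hvy⟩ := (LinearPMap.mem_graph_iff _).1 h2
    simp only at hux hvx
    subst hux hvx
    have hd : u ∈ (pcomp B A).domain := by
      refine ⟨⟨⟨u, hu⟩, ?_, rfl⟩, hu⟩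
      change A ⟨u, hu⟩ ∈ B.domain
      rw [huy]; exact hv
    refine (LinearPMap.mem_graph_iff _).2 ⟨⟨u, hd⟩, rfl, ?_⟩
    rw [← hvy]
    refine congrArg B (Subtype.ext ?_)
    refine (LinearPMap.domRestrict_apply (x := ⟨u, hd⟩) (y := ⟨u, hu⟩) rfl).trans huy

theorem mem_graph_ofBounded {T : L2 →L[ℂ] L2} {x y : L2} :
    (x, y) ∈ (ofBounded T).graph ↔ T x = y := by
  rw [LinearPMap.mem_graph_iff]
  constructor
  · rintro ⟨⟨u, hu⟩, rfl, h⟩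
    exact h
  · intro h
    exact ⟨⟨x, Submodule.mem_top⟩, rfl, h⟩

theorem mem_graph_add {A B : L2 →ₗ.[ℂ] L2} {x y z : L2} (h1 : (x, y) ∈ A.graph)
    (h2 : (x, z) ∈ B.graph) : (x, y + z) ∈ (A + B).graph := by
  obtain ⟨⟨u, hu⟩, rfl, hy⟩ := (LinearPMap.mem_graph_iff _).1 h1
  obtain ⟨⟨v, hv⟩, hvu, hz⟩ := (LinearPMap.mem_graph_iff _).1 h2
  simp only at hvu
  subst hvu
  refine (LinearPMap.mem_graph_iff _).2 ⟨⟨v, hu, hv⟩, rfl, ?_⟩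
  rw [LinearPMap.add_apply]
  simp only at hy hz
  rw [← hy, ← hz]

theorem mem_graph_const_smul {A : L2 →ₗ.[ℂ] L2} {x y : L2} (c : ℂ) (h : (x, y) ∈ A.graph) :
    (x, c • y) ∈ (c • A).graph := by
  obtain ⟨⟨u, hu⟩, rfl, hy⟩ := (LinearPMap.mem_graph_iff _).1 h
  refine (LinearPMap.mem_graph_iff _).2 ⟨⟨u, hu⟩, rfl, ?_⟩
  rw [LinearPMap.smul_apply]
  simp only at hy
  rw [← hy]

theorem mem_graph_sum {ι : Type*} (s : Finset ι) {A : ι → L2 →ₗ.[ℂ] L2} {x : L2} {y : ι → L2}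
    (h : ∀ i ∈ s, (x, y i) ∈ (A i).graph) : (x, ∑ i ∈ s, y i) ∈ (∑ i ∈ s, A i).graph := by
  classical
  induction s using Finset.induction_on with
  | empty => exact (LinearPMap.mem_graph_iff _).2 ⟨⟨x, Submodule.mem_top⟩, rfl, rfl⟩
  | insert a s ha ih =>
    rw [Finset.sum_insert ha, Finset.sum_insert ha]
    exact mem_graph_add (h a (Finset.mem_insert_self a s))
      (ih fun i hi => h i (Finset.mem_insert_of_mem hi))

theorem mem_graph_mulOp {V : Plane → ℝ} {f g : L2} :
    (f, g) ∈ (mulOp V).graph ↔ g =ᵐ[volume] fun x => (V x : ℂ) * f x := by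
  unfold mulOp
  rw [Submodule.toLinearPMap_graph_eq]
  · rfl
  · rintro ⟨u, v⟩ h hu
    have h' : v =ᵐ[volume] fun x => (V x : ℂ) * u x := h
    simp only at hu
    subst hu
    refine Lp.ext ?_
    filter_upwards [h', Lp.coeFn_zero ℂ 2 (volume : Measure Plane)] with x h1 h2
    simp only [h1, h2, Pi.zero_apply, mul_zero]

theorem mem_eigenspace {A : L2 →ₗ.[ℂ] L2} {μ : ℂ} {f : L2} :
    f ∈ eigenspace A μ ↔ (f, μ • f) ∈ A.graph := Iff.rfl

theorem mem_graph_compress {P : L2 →L[ℂ] L2} {A : L2 →ₗ.[ℂ] L2} {x z : L2} :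
    (x, z) ∈ (compress P A).graph ↔ ∃ y, (P x, y) ∈ A.graph ∧ P y = z := by
  simp only [compress, mem_graph_pcomp, mem_graph_ofBounded]
  constructor
  · rintro ⟨y, ⟨u, rfl, h⟩, h'⟩
    exact ⟨y, h, h'⟩
  · rintro ⟨y, h, h'⟩
    exact ⟨y, ⟨_, rfl, h⟩, h'⟩

/-! ### Test functions and polynomially bounded potentials -/

/-- Smooth functions of compact support. -/
structure IsTest (φ : Plane → ℂ) : Prop where
  smooth : ContDiff ℝ ∞ φ
  compact : HasCompactSupport φ

/-- The weight `1 + |x|²`. -/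
def wt (x : Plane) : ℝ := 1 + ‖x‖ ^ 2

theorem one_le_wt (x : Plane) : 1 ≤ wt x := by unfold wt; linarith [sq_nonneg ‖x‖]
theorem wt_pos (x : Plane) : 0 < wt x := zero_lt_one.trans_le (one_le_wt x)

theorem contDiff_wt {n : WithTop ℕ∞} : ContDiff ℝ n wt :=
  contDiff_const.add (contDiff_norm_sq ℝ)

theorem continuous_wt : Continuous wt := (contDiff_wt (n := 0)).continuous

/-- Measurable functions with an almost everywhere polynomial bound. -/
structure PolyBdd (V : Plane → ℝ) : Prop where
  meas : AEStronglyMeasurable V volume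
  bound : ∃ (C : ℝ) (m : ℕ), 0 ≤ C ∧ ∀ᵐ x, |V x| ≤ C * wt x ^ m

theorem IsTest.contDiff_two {φ : Plane → ℂ} (h : IsTest φ) : ContDiff ℝ 2 φ :=
  h.smooth.of_le two_le_infty

theorem IsTest.conj {φ : Plane → ℂ} (h : IsTest φ) : IsTest fun x => starRingEnd ℂ (φ x) :=
  ⟨Complex.conjCLE.contDiff.comp h.smooth, h.compact.comp_left (map_zero _)⟩

theorem laplacian_conj {φ : Plane → ℂ} (x : Plane) :
    (Δ fun x => starRingEnd ℂ (φ x)) x = starRingEnd ℂ ((Δ φ) x) :=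
  congrFun (InnerProductSpace.laplacian_CLE_comp_left (f := φ) (l := Complex.conjCLE)) x

theorem memLp_of_test {φ : Plane → ℂ} (h : Continuous φ) (hc : HasCompactSupport φ) :
    MemLp φ 2 (volume : Measure Plane) := h.memLp_of_hasCompactSupport hc

theorem PolyBdd.memLp_mul {V : Plane → ℝ} (hV : PolyBdd V) {φ : Plane → ℂ} (h : Continuous φ)
    (hc : HasCompactSupport φ) : MemLp (fun x => (V x : ℂ) * φ x) 2 (volume : Measure Plane) := by
  obtain ⟨C, m, hC, hb⟩ := hV.bound
  have h1 : MemLp (fun x => ((C * wt x ^ m : ℝ) : ℂ) * φ x) 2 (volume : Measure Plane) := by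
    have := continuous_wt
    exact memLp_of_test (by fun_prop) hc.mul_left
  refine h1.mono ((Complex.continuous_ofReal.comp_aestronglyMeasurable hV.meas).mul
    h.aestronglyMeasurable) ?_
  filter_upwards [hb] with x hx
  rw [norm_mul, norm_mul, Complex.norm_real, Complex.norm_real]
  gcongr
  exact hx.trans (le_abs_self _)

theorem PolyBdd.memLp_core {W : Plane → ℝ} (hW : PolyBdd W) {φ : Plane → ℂ} (h : IsTest φ) :
    MemLp (fun x => -(Δ φ) x + (W x : ℂ) * φ x) 2 (volume : Measure Plane) :=
  (memLp_of_test (continuous_laplacian h.contDiff_two)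
    (hasCompactSupport_laplacian h.compact)).neg.add (hW.memLp_mul h.smooth.continuous h.compact)

theorem exists_mem_coreGraph {W : Plane → ℝ} (hW : PolyBdd W) {φ : Plane → ℂ} (h : IsTest φ) :
    ∃ f g : L2, (f, g) ∈ coreGraph W ∧ f =ᵐ[volume] φ ∧
      g =ᵐ[volume] fun x => -(Δ φ) x + (W x : ℂ) * φ x := by
  have h1 := (memLp_of_test h.smooth.continuous h.compact).coeFn_toLp
  have h2 := (hW.memLp_core h).coeFn_toLp
  exact ⟨_, _, ⟨φ, h.smooth, h.compact, h1, h2⟩, h1, h2⟩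

/-- A square integrable function orthogonal to all test functions vanishes. -/
theorem eq_zero_of_integral_test {f : L2} (h : ∀ φ, IsTest φ → ∫ x, φ x * f x = 0) : f = 0 := by
  have hf : LocallyIntegrable f (volume : Measure Plane) :=
    (Lp.memLp f).locallyIntegrable (by norm_num)
  have := ae_eq_zero_of_integral_contDiff_smul_eq_zero hf fun g hg hgc => by
    have := h (fun x => (g x : ℂ)) ⟨Complex.ofRealCLM.contDiff.comp hg,
      hgc.comp_left (g := fun r : ℝ => (r : ℂ)) Complex.ofReal_zero⟩
    simpa only [Complex.real_smul] using this
  exact (Lp.eq_zero_iff_ae_eq_zero).2 this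

theorem inner_eq_integral {f g : L2} {φ ψ : Plane → ℂ} (hf : f =ᵐ[volume] φ)
    (hg : g =ᵐ[volume] ψ) : inner ℂ f g = ∫ x, starRingEnd ℂ (φ x) * ψ x := by
  rw [L2.inner_def]
  refine integral_congr_ae ?_
  filter_upwards [hf, hg] with x h1 h2
  rw [h1, h2, RCLike.inner_apply, mul_comm]

theorem eq_zero_of_inner_test {f : L2}
    (h : ∀ (g : L2) (φ : Plane → ℂ), IsTest φ → g =ᵐ[volume] φ → inner ℂ g f = 0) : f = 0 := by
  refine eq_zero_of_integral_test fun φ hφ => ?_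
  have h1 := h _ _ hφ.conj (memLp_of_test hφ.conj.smooth.continuous hφ.conj.compact).coeFn_toLp
  rw [inner_eq_integral (MemLp.coeFn_toLp _) (ae_eq_refl f)] at h1
  simpa using h1

theorem coreGraph_symm {W : Plane → ℝ} (hW : PolyBdd W) {f g f' g' : L2}
    (h : (f, g) ∈ coreGraph W) (h' : (f', g') ∈ coreGraph W) : inner ℂ f g' = inner ℂ g f' := by
  obtain ⟨φ, s, c, h1, h2⟩ := h
  obtain ⟨φ', s', c', h1', h2'⟩ := h'
  have t : IsTest φ := ⟨s, c⟩
  have t' : IsTest φ' := ⟨s', c'⟩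
  rw [inner_eq_integral h1 h2', inner_eq_integral h2 h1']
  have i1 : Integrable fun x => starRingEnd ℂ (φ x) * (Δ φ') x :=
    Continuous.integrable_of_hasCompactSupport
      (t.conj.smooth.continuous.mul (continuous_laplacian t'.contDiff_two)) t.conj.compact.mul_right
  have i2 : Integrable fun x => starRingEnd ℂ ((Δ φ) x) * φ' x :=
    Continuous.integrable_of_hasCompactSupport
      ((Complex.continuous_conj.comp (continuous_laplacian t.contDiff_two)).mul s'.continuous)
      c'.mul_left
  have i3 : Integrable fun x => starRingEnd ℂ (φ x) * ((W x : ℂ) * φ' x) := by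
    have := (memLp_of_test t.conj.smooth.continuous t.conj.compact).integrable_mul
      (hW.memLp_mul s'.continuous c')
    exact this
  have key := integral_mul_laplacian_comm t.conj.contDiff_two t'.contDiff_two t.conj.compact
  simp_rw [laplacian_conj] at key
  have e1 : ∀ x, starRingEnd ℂ (φ x) * (-(Δ φ') x + (W x : ℂ) * φ' x) =
      starRingEnd ℂ (φ x) * ((W x : ℂ) * φ' x) - starRingEnd ℂ (φ x) * (Δ φ') x := fun x => by ring
  have e2 : ∀ x, starRingEnd ℂ (-(Δ φ) x + (W x : ℂ) * φ x) * φ' x =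
      starRingEnd ℂ (φ x) * ((W x : ℂ) * φ' x) - starRingEnd ℂ ((Δ φ) x) * φ' x := fun x => by
    simp only [map_add, map_neg, map_mul, Complex.conj_ofReal]; ring
  simp_rw [e1, e2]
  rw [integral_sub i3 i1, integral_sub i3 i2, key]

/-- A symmetric densely defined operator is closable: a limit $(0,g)$ of pairs in the graph
satisfies $\langle f,g\rangle=\langle Af,0\rangle=0$ for every test function $f$. -/
theorem coreGraph_functional {W : Plane → ℝ} (hW : PolyBdd W) {g : L2}
    (h : ((0 : L2), g) ∈ (coreGraph W).topologicalClosure) : g = 0 := by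
  refine eq_zero_of_inner_test fun f φ hφ hf => ?_
  obtain ⟨f₁, g₁, hmem, h1, -⟩ := exists_mem_coreGraph hW hφ
  have hff : f = f₁ := Lp.ext (hf.trans h1.symm)
  subst hff
  have hcl : IsClosed {q : L2 × L2 | inner ℂ f q.2 = inner ℂ g₁ q.1} :=
    isClosed_eq (by fun_prop) (by fun_prop)
  have : ((0 : L2), g) ∈ {q : L2 × L2 | inner ℂ f q.2 = inner ℂ g₁ q.1} :=
    closure_minimal (fun q hq => coreGraph_symm hW hmem hq) hcl h
  simpa using this

/-- The graph of a Schrödinger operator is the closure of its restriction to test functions. -/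
theorem schrodinger_graph {W : Plane → ℝ} (hW : PolyBdd W) :
    (schrodinger W).graph = (coreGraph W).topologicalClosure := by
  -- `toLinearPMap` is known to have the given submodule as its graph only when that submodule is
  -- functional, so functionality is checked for the core and again for its closure.
  have h1 : (coreGraph W).toLinearPMap.graph = coreGraph W :=
    Submodule.toLinearPMap_graph_eq _ fun q hq h => coreGraph_functional hW (by
      have := (coreGraph W).le_topologicalClosure hq
      rwa [show q = (0, q.2) from Prod.ext h rfl] at this)
  have hcl : (coreGraph W).toLinearPMap.IsClosable := by
    refine ⟨(coreGraph W).topologicalClosure.toLinearPMap, ?_⟩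
    rw [h1, Submodule.toLinearPMap_graph_eq]
    intro q hq h
    refine coreGraph_functional hW ?_
    rwa [show q = (0, q.2) from Prod.ext h rfl] at hq
  rw [schrodinger, ← hcl.graph_closure_eq_closure_graph, h1]

/-- A closed condition holding on test functions holds on the whole graph. -/
theorem schrodinger_graph_induction {W : Plane → ℝ} (hW : PolyBdd W) {p : L2 × L2 → Prop}
    (hp : IsClosed {q | p q}) (h : ∀ q ∈ coreGraph W, p q) {q : L2 × L2}
    (hq : q ∈ (schrodinger W).graph) : p q := by
  rw [schrodinger_graph hW] at hq
  exact closure_minimal (s := (coreGraph W : Set (L2 × L2))) h hp hq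

theorem coreGraph_le {W : Plane → ℝ} (hW : PolyBdd W) {q : L2 × L2} (hq : q ∈ coreGraph W) :
    q ∈ (schrodinger W).graph := by
  rw [schrodinger_graph hW]
  exact Submodule.le_topologicalClosure _ hq

/-! ### Mollification -/

/-- The convolution `ρ * f`. -/
def mollify (ρ : Plane → ℝ) (f : Plane → ℂ) (x : Plane) : ℂ := ∫ t, ρ (x - t) • f t

theorem mollify_eq_convolution (ρ : Plane → ℝ) (f : Plane → ℂ) :
    mollify ρ f =
      MeasureTheory.convolution f ρ (ContinuousLinearMap.lsmul ℝ ℝ (E := ℂ)).flip volume := rfl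

theorem mollify_swap (ρ : Plane → ℝ) (f : Plane → ℂ) (x : Plane) :
    mollify ρ f x = ∫ t, ρ t • f (x - t) := by
  rw [mollify, ← integral_sub_left_eq_self _ volume x]
  simp

theorem contDiff_mollify {ρ : Plane → ℝ} {f : Plane → ℂ} (hρ : ContDiff ℝ ∞ ρ)
    (hc : HasCompactSupport ρ) (hf : LocallyIntegrable f volume) : ContDiff ℝ ∞ (mollify ρ f) :=
  
  hc.contDiff_convolution_right (ContinuousLinearMap.lsmul ℝ ℝ (E := ℂ)).flip hf hρ

theorem pd_mollify {ρ : Plane → ℝ} {f : Plane → ℂ} (hρ : ContDiff ℝ 1 ρ)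
    (hc : HasCompactSupport ρ) (hf : LocallyIntegrable f volume) (i : Fin 2) :
    pd i (mollify ρ f) = mollify (pd i ρ) f := by
  funext x
  have h := (hc.hasFDerivAt_convolution_right (ContinuousLinearMap.lsmul ℝ ℝ (E := ℂ)).flip
    hf hρ x).fderiv
  rw [pd, mollify_eq_convolution, h, convolution_precompR_apply _ hf (hc.fderiv ℝ)
    (hρ.continuous_fderiv (by norm_num))]
  rfl

theorem laplacian_mollify {ρ : Plane → ℝ} {f : Plane → ℂ} (hρ : ContDiff ℝ ∞ ρ)
    (hc : HasCompactSupport ρ) (hf : LocallyIntegrable f volume) (x : Plane) :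
    (Δ (mollify ρ f)) x = mollify (Δ ρ) f x := by
  have h2 : ContDiff ℝ 2 ρ := hρ.of_le two_le_infty
  rw [laplacian_eq_sum_pd ((contDiff_mollify hρ hc hf).of_le two_le_infty)]
  have h1 : ∀ i, pd i (pd i (mollify ρ f)) = mollify (pd i (pd i ρ)) f := fun i => by
    rw [pd_mollify (h2.of_le (by norm_num)) hc hf,
      pd_mollify (contDiff_pd h2 (by norm_num) i) (hasCompactSupport_pd hc i) hf]
  simp_rw [h1, mollify, laplacian_eq_sum_pd h2, Finset.sum_smul]
  rw [integral_finsetSum]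
  intro i _
  have hi : HasCompactSupport (pd i (pd i ρ)) := hasCompactSupport_pd (hasCompactSupport_pd hc i) i
  have := (hi.convolutionExists_right (ContinuousLinearMap.lsmul ℝ ℝ (E := ℂ)).flip hf
    (contDiff_pd (m := 0) (contDiff_pd (m := 1) h2 (by norm_num) i) (by norm_num) i).continuous x)
  exact this.integrable

theorem pd_reflect {F : Type*} [NormedAddCommGroup F] [NormedSpace ℝ F] {ρ : Plane → F}
    (hρ : Differentiable ℝ ρ) (x : Plane) (i : Fin 2) :
    pd i (fun t => ρ (x - t)) = fun t => -pd i ρ (x - t) := by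
  funext t
  have h1 : HasFDerivAt (fun t : Plane => x - t) (-ContinuousLinearMap.id ℝ Plane) t :=
    (hasFDerivAt_id t).const_sub x
  have := ((hρ (x - t)).hasFDerivAt.comp t h1).fderiv
  simp only [pd]
  rw [show (fun t => ρ (x - t)) = ρ ∘ fun t => x - t from rfl, this]
  simp

theorem isTest_reflect {ρ : Plane → ℝ} (hρ : ContDiff ℝ ∞ ρ) (hc : HasCompactSupport ρ)
    (x : Plane) : IsTest fun t => (ρ (x - t) : ℂ) := by
  refine ⟨Complex.ofRealCLM.contDiff.comp (hρ.comp (contDiff_const.sub contDiff_id)), ?_⟩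
  exact (hc.comp_homeomorph (Homeomorph.subLeft x)).comp_left (g := fun r : ℝ => (r : ℂ))
    Complex.ofReal_zero

/-- Testing a weak equation with $t\mapsto\rho(x-t)$ yields the pointwise equation for the mollified
function at $x$. Two reflections leave the sign of the Laplacian unchanged. -/
theorem laplacian_reflect {ρ : Plane → ℝ} (hρ : ContDiff ℝ ∞ ρ) (x t : Plane) :
    (Δ fun t => (ρ (x - t) : ℂ)) t = (((Δ ρ) (x - t) : ℝ) : ℂ) := by
  have h2 : ContDiff ℝ 2 ρ := hρ.of_le two_le_infty
  have h3 : ContDiff ℝ 2 fun t => ρ (x - t) := h2.comp (contDiff_const.sub contDiff_id)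
  have := h3.contDiffAt.laplacian_CLM_comp_left (x := t) (l := Complex.ofRealCLM)
  rw [show (fun t => (ρ (x - t) : ℂ)) = Complex.ofRealCLM ∘ fun t => ρ (x - t) from rfl, this]
  simp only [Function.comp_apply, Complex.ofRealCLM_apply]
  rw [laplacian_eq_sum_pd h3, laplacian_eq_sum_pd h2]
  congr 1
  refine Finset.sum_congr rfl fun i _ => ?_
  have d1 : Differentiable ℝ (pd i ρ) :=
    (contDiff_pd (m := 1) h2 (by norm_num) i).differentiable (by norm_num)
  rw [pd_reflect (h2.differentiable (by norm_num))]
  have h4 : pd i (fun t => -pd i ρ (x - t)) t = -pd i (fun t => pd i ρ (x - t)) t := by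
    have := fderiv_neg (𝕜 := ℝ) (f := fun t => pd i ρ (x - t)) (x := t)
    simp only [pd] at this ⊢
    exact congrArg (fun L => L (EuclideanSpace.single i 1)) this
  rw [h4, pd_reflect d1, neg_neg]

/-- Translations form a continuous family of measure preserving maps, and composition with such a
family is continuous in $L^p$ for $p<\infty$. -/
theorem continuous_translate_L2 (f : L2) :
    Tendsto (fun t : Plane => eLpNorm (fun x => f (x - t) - f x) 2 volume) (𝓝 0) (𝓝 0) := by
  let g : Plane → C(Plane, Plane) := fun t => ⟨fun x => x - t, continuous_id.sub continuous_const⟩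
  have hg : Continuous g :=
    ContinuousMap.continuous_of_continuous_uncurry _ (continuous_snd.sub continuous_fst)
  have hm : ∀ t, MeasurePreserving (g t) (volume : Measure Plane) volume := fun t =>
    measurePreserving_sub_right volume t
  have h := (continuous_const (y := f)).compMeasurePreservingLp hg hm (by norm_num)
  have h0 := (h.tendsto 0).edist (tendsto_const_nhds (x := f))
  have e0 : Lp.compMeasurePreserving (g 0) (hm 0) f = f := by
    refine Lp.ext ((Lp.coeFn_compMeasurePreserving f (hm 0)).trans ?_)
    refine Eventually.of_forall fun x => ?_
    simp [g]
  rw [e0, edist_self] at h0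
  refine h0.congr fun t => ?_
  rw [Lp.edist_def]
  refine eLpNorm_congr_ae ?_
  filter_upwards [Lp.coeFn_compMeasurePreserving f (hm t)] with x hx
  simp only [Pi.sub_apply, hx]
  rfl

theorem eLpNorm_two_sq {g : Plane → ℂ} :
    eLpNorm g 2 volume ^ 2 = ∫⁻ x, ‖g x‖ₑ ^ 2 := by
  have := eLpNorm_nnreal_pow_eq_lintegral (f := g) (μ := volume) (p := 2) (by norm_num)
  simpa only [ENNReal.coe_ofNat, NNReal.coe_ofNat, ENNReal.rpow_ofNat] using this

/-- Jensen's inequality for the square with respect to a probability density. -/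
theorem sq_lintegral_mul_le {α : Type*} [MeasurableSpace α] {μ : Measure α} {r h : α → ENNReal}
    (hr : Measurable r) (hh : Measurable h) (hr1 : ∫⁻ t, r t ∂μ = 1) :
    (∫⁻ t, r t * h t ∂μ) ^ 2 ≤ ∫⁻ t, r t * h t ^ 2 ∂μ := by
  have : IsProbabilityMeasure (μ.withDensity r) :=
    ⟨by rw [withDensity_apply _ MeasurableSet.univ]; simpa⟩
  have e3 := eLpNorm_le_eLpNorm_of_exponent_le (μ := μ.withDensity r) (p := 1) (q := 2)
    (by norm_num) hh.aestronglyMeasurable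
  rw [eLpNorm_one_eq_lintegral_enorm] at e3
  have e4 := eLpNorm_nnreal_pow_eq_lintegral (f := h) (μ := μ.withDensity r) (p := 2) (by norm_num)
  simp only [ENNReal.coe_ofNat, NNReal.coe_ofNat, ENNReal.rpow_ofNat, enorm_eq_self] at e3 e4
  rw [lintegral_withDensity_eq_lintegral_mul _ hr (hh.pow_const 2)] at e4
  rw [lintegral_withDensity_eq_lintegral_mul _ hr hh] at e3
  simp only [Pi.mul_apply] at e3 e4
  rw [← e4]
  gcongr

/-- `‖ρ * f - f‖ ≤ κ` if translates of `f` by vectors of the support of `ρ` are `κ`-close to `f`. -/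
theorem eLpNorm_mollify_sub_le {ρ : Plane → ℝ} (hρ : Continuous ρ) (hc : HasCompactSupport ρ)
    (h0 : ∀ t, 0 ≤ ρ t) (h1 : ∫ t, ρ t = 1) {f : Plane → ℂ} (hf : StronglyMeasurable f)
    (hf2 : MemLp f 2 volume) {κ : ENNReal}
    (hκ : ∀ t, ρ t ≠ 0 → eLpNorm (fun x => f (x - t) - f x) 2 volume ≤ κ) :
    eLpNorm (fun x => mollify ρ f x - f x) 2 volume ≤ κ := by
  have hρi : Integrable ρ (volume : Measure Plane) := hρ.integrable_of_hasCompactSupport hc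
  have hrm : Measurable fun t => ENNReal.ofReal (ρ t) := hρ.measurable.ennreal_ofReal
  have hr1 : ∫⁻ t, ENNReal.ofReal (ρ t) = 1 := by
    rw [← ofReal_integral_eq_lintegral_ofReal hρi (Eventually.of_forall h0), h1,
      ENNReal.ofReal_one]
  have hfl : LocallyIntegrable f (volume : Measure Plane) := hf2.locallyIntegrable (by norm_num)
  have hdm : Measurable fun p : Plane × Plane => ‖f (p.1 - p.2) - f p.1‖ₑ := by
    have := hf.measurable
    fun_prop
  have hd1 : ∀ x, Measurable fun t => ‖f (x - t) - f x‖ₑ := fun x => by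
    have := hf.measurable
    fun_prop
  have hd2 : ∀ t, Measurable fun x => ‖f (x - t) - f x‖ₑ := fun t => by
    have := hf.measurable
    fun_prop
  -- Since $\rho$ is a probability density, the difference is an average of $f(x-t)-f(x)$ and Jensen
  -- applies. Integration in $x$ with Tonelli then bounds the left side by an average of squared
  -- translation errors.
  have hpt : ∀ x, ‖mollify ρ f x - f x‖ₑ ^ 2 ≤
      ∫⁻ t, ENNReal.ofReal (ρ t) * ‖f (x - t) - f x‖ₑ ^ 2 := by
    intro x
    have i1 : Integrable fun t => ρ t • f (x - t) :=
      (hc.convolutionExists_left (ContinuousLinearMap.lsmul ℝ ℝ (E := ℂ)) hρ hfl x).integrable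
    have e1 : mollify ρ f x - f x = ∫ t, ρ t • (f (x - t) - f x) := by
      simp_rw [smul_sub]
      rw [integral_sub i1 (hρi.smul_const _), integral_smul_const, h1, one_smul, mollify_swap]
    refine le_trans ?_ (sq_lintegral_mul_le hrm (hd1 x) hr1)
    gcongr
    rw [e1]
    refine (enorm_integral_le_lintegral_enorm _).trans_eq (lintegral_congr fun t => ?_)
    rw [enorm_smul, Real.enorm_eq_ofReal (h0 t)]
  have hfin : eLpNorm (fun x => mollify ρ f x - f x) 2 volume ^ 2 ≤ κ ^ 2 := by
    rw [eLpNorm_two_sq]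
    refine (lintegral_mono hpt).trans ?_
    rw [lintegral_lintegral_swap]
    · calc ∫⁻ t, ∫⁻ x, ENNReal.ofReal (ρ t) * ‖f (x - t) - f x‖ₑ ^ 2
          ≤ ∫⁻ t, ENNReal.ofReal (ρ t) * κ ^ 2 := by
            refine lintegral_mono fun t => ?_
            rw [lintegral_const_mul _ ((hd2 t).pow_const 2)]
            by_cases ht : ρ t = 0
            · simp [ht]
            · gcongr
              rw [← eLpNorm_two_sq (g := fun x => f (x - t) - f x)]
              gcongr
              exact hκ t ht
        _ = κ ^ 2 := by rw [lintegral_mul_const _ hrm, hr1, one_mul]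
    · exact ((hrm.comp measurable_snd).mul (hdm.pow_const 2)).aemeasurable
  exact (ENNReal.pow_le_pow_left_iff two_ne_zero).1 hfin

/-! ### Bounded multiplication operators -/

/-- Bounded measurable functions. -/
structure BddMeas (w : Plane → ℝ) : Prop where
  meas : AEStronglyMeasurable w volume
  bound : ∃ C, ∀ x, |w x| ≤ C

theorem BddMeas.memLp {w : Plane → ℝ} (hw : BddMeas w) {f : Plane → ℂ} (hf : MemLp f 2 volume) :
    MemLp (fun x => (w x : ℂ) * f x) 2 (volume : Measure Plane) := by
  obtain ⟨C, hC⟩ := hw.bound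
  refine hf.of_le_mul (c := C) ((Complex.continuous_ofReal.comp_aestronglyMeasurable hw.meas).mul
    hf.aestronglyMeasurable) (Eventually.of_forall fun x => ?_)
  rw [norm_mul, Complex.norm_real]
  gcongr
  exact hC x

open Classical in
/-- Multiplication by a bounded measurable real function. -/
def mulL2 (w : Plane → ℝ) : L2 →L[ℂ] L2 :=
  if hw : BddMeas w then
    LinearMap.mkContinuous
      { toFun := fun f => (hw.memLp (Lp.memLp f)).toLp _
        map_add' := fun f g => by
          rw [← MemLp.toLp_add]
          refine MemLp.toLp_congr _ _ ?_
          filter_upwards [Lp.coeFn_add f g] with x hx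
          simp only [hx, Pi.add_apply, mul_add]
        map_smul' := fun c f => by
          rw [RingHom.id_apply, ← MemLp.toLp_const_smul]
          refine MemLp.toLp_congr _ _ ?_
          filter_upwards [Lp.coeFn_smul c f] with x hx
          simp only [hx, Pi.smul_apply, smul_eq_mul]
          ring } hw.bound.choose (fun f => by
        refine Lp.norm_le_mul_norm_of_ae_le_mul ?_
        filter_upwards [(hw.memLp (Lp.memLp f)).coeFn_toLp] with x hx
        simp only [LinearMap.coe_mk, AddHom.coe_mk, hx, norm_mul, Complex.norm_real]
        gcongr
        exact hw.bound.choose_spec x)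
  else 0

theorem coeFn_mulL2 {w : Plane → ℝ} (hw : BddMeas w) (f : L2) :
    mulL2 w f =ᵐ[volume] fun x => (w x : ℂ) * f x := by
  rw [mulL2, dif_pos hw]
  exact (hw.memLp (Lp.memLp f)).coeFn_toLp

theorem re_inner_eq_integral {f g : L2} {φ ψ : Plane → ℂ} (hf : f =ᵐ[volume] φ)
    (hg : g =ᵐ[volume] ψ) : (inner ℂ f g).re = ∫ x, inner ℝ (φ x) (ψ x) := by
  have h1 : Integrable (fun x => inner ℂ (f x) (g x)) volume := L2.integrable_inner f g
  rw [L2.inner_def]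
  have := integral_re h1
  refine (this.symm.trans (integral_congr_ae ?_))
  filter_upwards [hf, hg] with x h1 h2
  rw [h1, h2]
  rfl

theorem re_inner_mulL2 {w : Plane → ℝ} (hw : BddMeas w) {f g : L2} {φ ψ : Plane → ℂ}
    (hf : f =ᵐ[volume] φ) (hg : g =ᵐ[volume] ψ) :
    (inner ℂ (mulL2 w f) g).re = ∫ x, w x * inner ℝ (φ x) (ψ x) := by
  have h1 : mulL2 w f =ᵐ[volume] fun x => (w x : ℂ) * φ x := by
    filter_upwards [coeFn_mulL2 hw f, hf] with x h1 h2
    rw [h1, h2]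
  rw [re_inner_eq_integral h1 hg]
  refine integral_congr_ae (Eventually.of_forall fun x => ?_)
  simp only
  rw [← Complex.real_smul, real_inner_smul_left]

theorem norm_sq_eq_integral {f : L2} {φ : Plane → ℂ} (hf : f =ᵐ[volume] φ) :
    ‖f‖ ^ 2 = ∫ x, ‖φ x‖ ^ 2 := by
  rw [← inner_self_eq_norm_sq (𝕜 := ℂ)]
  refine (re_inner_eq_integral hf hf).trans (integral_congr_ae (Eventually.of_forall fun x => ?_))
  exact real_inner_self_eq_norm_sq _

theorem integrable_sq_norm (f : L2) : Integrable fun x => ‖f x‖ ^ 2 :=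
  (Lp.memLp f).integrable_norm_pow (by norm_num)

theorem BddMeas.integrable_mul {w : Plane → ℝ} (hw : BddMeas w) {h : Plane → ℝ}
    (hh : Integrable h) : Integrable fun x => w x * h x := by
  obtain ⟨C, hC⟩ := hw.bound
  exact hh.bdd_mul hw.meas (Eventually.of_forall hC)

/-! ### Mollifiers and cutoffs -/

/-- Smooth probability densities supported in the ball of radius `δ`. -/
structure IsMollifier (ρ : Plane → ℝ) (δ : ℝ) : Prop where
  smooth : ContDiff ℝ ∞ ρ
  compact : HasCompactSupport ρ
  nonneg : ∀ t, 0 ≤ ρ t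
  integral : ∫ t, ρ t = 1
  small : ∀ t, ρ t ≠ 0 → ‖t‖ < δ

theorem exists_mollifier {δ : ℝ} (hδ : 0 < δ) : ∃ ρ, IsMollifier ρ δ := by
  let b : ContDiffBump (0 : Plane) := ⟨δ / 2, δ, by positivity, by linarith⟩
  refine ⟨b.normed volume, b.contDiff_normed, b.hasCompactSupport_normed,
    fun t => b.nonneg_normed t, b.integral_normed, fun t ht => ?_⟩
  have : t ∈ Function.support (b.normed volume) := ht
  rw [b.support_normed_eq] at this
  simpa using this

theorem IsMollifier.mono {ρ : Plane → ℝ} {δ δ' : ℝ} (h : IsMollifier ρ δ) (hd : δ ≤ δ') :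
    IsMollifier ρ δ' :=
  ⟨h.1, h.2, h.3, h.4, fun t ht => (h.5 t ht).trans_le hd⟩

/-- The radius works for every mollifier supported in it, so a single mollifier can serve several
functions at once. -/
theorem exists_mollify_close (f : L2) {κ : ℝ} (hκ : 0 < κ) :
    ∃ δ > 0, ∀ ρ, IsMollifier ρ δ → ∃ g : L2, g =ᵐ[volume] mollify ρ f ∧ ‖g - f‖ ≤ κ := by
  have h := (continuous_translate_L2 f).eventually
    (Iic_mem_nhds (ENNReal.ofReal_pos.2 hκ))
  obtain ⟨δ, hδ, hball⟩ := Metric.eventually_nhds_iff.1 h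
  refine ⟨δ, hδ, fun ρ hρ => ?_⟩
  have h1 := eLpNorm_mollify_sub_le hρ.smooth.continuous hρ.compact hρ.nonneg hρ.integral
    (Lp.stronglyMeasurable f) (Lp.memLp f) (κ := ENNReal.ofReal κ)
    (fun t ht => hball (by simpa using hρ.small t ht))
  have hfl : LocallyIntegrable f (volume : Measure Plane) :=
    (Lp.memLp f).locallyIntegrable (by norm_num)
  have hcont := (contDiff_mollify hρ.smooth hρ.compact hfl).continuous
  have h2 : MemLp (fun x => mollify ρ f x - f x) 2 volume :=
    ⟨hcont.aestronglyMeasurable.sub (Lp.stronglyMeasurable f).aestronglyMeasurable,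
      h1.trans_lt ENNReal.ofReal_lt_top⟩
  have h3 : MemLp (mollify ρ f) 2 volume := by
    have := h2.add (Lp.memLp f)
    refine this.ae_eq (Eventually.of_forall fun x => ?_)
    simp
  refine ⟨h3.toLp _, h3.coeFn_toLp, ?_⟩
  rw [Lp.norm_def]
  refine ENNReal.toReal_le_of_le_ofReal hκ.le (le_trans (le_of_eq (eLpNorm_congr_ae ?_)) h1)
  filter_upwards [Lp.coeFn_sub (h3.toLp _) f, h3.coeFn_toLp] with x hx hx'
  rw [hx, Pi.sub_apply, hx']

/-- Smooth cutoffs equal to one on the ball of radius `R` and with gradient `O(1/R)`. -/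
theorem exists_cutoff : ∃ M : ℝ, ∀ R : ℝ, 0 < R → ∃ η : Plane → ℝ, ContDiff ℝ ∞ η ∧
    (∀ x, 2 * R ≤ ‖x‖ → η x = 0) ∧ (∀ x, ‖x‖ ≤ R → η x = 1) ∧ (∀ x, |η x| ≤ 1) ∧
    ∀ x, ∑ i, pd i η x ^ 2 ≤ M / R ^ 2 := by
  let b : ContDiffBump (0 : Plane) := ⟨1, 2, by positivity, by norm_num⟩
  have hb : ContDiff ℝ ∞ b := b.contDiff
  have hp : ∀ i, ∃ C, ∀ x, ‖pd i b x‖ ≤ C := fun i =>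
    (hasCompactSupport_pd b.hasCompactSupport i).exists_bound_of_continuous
      (contDiff_pd (m := 0) hb (by norm_num) i).continuous
  choose C hC using hp
  refine ⟨∑ i, C i ^ 2, fun R hR => ⟨fun x => b (R⁻¹ • x), hb.comp (contDiff_const_smul _),
    fun x hx => ?_, fun x hx => ?_, fun x => ?_, fun x => ?_⟩⟩
  · refine b.zero_of_le_dist ?_
    rw [dist_zero_right, norm_smul, norm_inv, Real.norm_of_nonneg hR.le]
    change 2 ≤ _
    rw [le_inv_mul_iff₀ hR]
    linarith
  · refine b.one_of_mem_closedBall ?_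
    rw [mem_closedBall_zero_iff, norm_smul, norm_inv, Real.norm_of_nonneg hR.le]
    change _ ≤ 1
    rw [inv_mul_le_iff₀ hR]
    linarith
  · rw [abs_of_nonneg b.nonneg]
    exact b.le_one
  · rw [Finset.sum_div]
    refine Finset.sum_le_sum fun i _ => ?_
    have e : pd i (fun x => b (R⁻¹ • x)) x = R⁻¹ * pd i b (R⁻¹ • x) := by
      simp only [pd]
      rw [fderiv_comp_smul]
      simp
    rw [e, mul_pow, inv_pow, div_eq_inv_mul]
    gcongr ?_ * ?_
    rw [← sq_abs]
    gcongr
    exact hC i _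

theorem integral_pd_sq_le {η : Plane → ℝ} {M : ℝ}
    (h : ∀ x, ∑ i, pd i η x ^ 2 ≤ M) {f : L2} {φ : Plane → ℂ} (hf : f =ᵐ[volume] φ) :
    ∫ x, (∑ i, pd i η x ^ 2) * ‖φ x‖ ^ 2 ≤ M * ‖f‖ ^ 2 := by
  rw [norm_sq_eq_integral hf, ← integral_const_mul]
  have hi : Integrable fun x => ‖φ x‖ ^ 2 := (integrable_sq_norm f).congr (by
    filter_upwards [hf] with x hx
    rw [hx])
  refine integral_mono_of_nonneg (Eventually.of_forall fun x => by positivity)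
    (hi.const_mul M) (Eventually.of_forall fun x => ?_)
  simp only
  gcongr
  exact h x

theorem PolyBdd.add_const {W : Plane → ℝ} (hW : PolyBdd W) (c : ℝ) :
    PolyBdd fun x => W x + c := by
  obtain ⟨C, m, hC, hb⟩ := hW.bound
  refine ⟨hW.meas.add aestronglyMeasurable_const, C + |c|, m, by positivity, ?_⟩
  filter_upwards [hb] with x hx
  have := one_le_pow₀ (one_le_wt x) (n := m)
  calc |W x + c| ≤ |W x| + |c| * 1 := by rw [mul_one]; exact abs_add_le _ _
    _ ≤ C * wt x ^ m + |c| * wt x ^ m := by gcongr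
    _ = _ := by ring

theorem PolyBdd.memLp_indicator {V : Plane → ℝ} (hV : PolyBdd V) (f : L2) (R : ℝ) :
    MemLp ((Metric.ball (0 : Plane) R).indicator fun x => (V x : ℂ) * f x) 2 volume := by
  obtain ⟨C, m, hC, hb⟩ := hV.bound
  refine (Lp.memLp f).of_le_mul (c := C * (1 + R ^ 2) ^ m)
    (((Complex.continuous_ofReal.comp_aestronglyMeasurable hV.meas).mul
    (Lp.memLp f).aestronglyMeasurable).indicator measurableSet_ball) ?_
  filter_upwards [hb] with x hx
  by_cases h : x ∈ Metric.ball (0 : Plane) R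
  · rw [indicator_of_mem h, norm_mul, Complex.norm_real]
    have h1 : ‖x‖ < R := by simpa using h
    gcongr
    refine hx.trans ?_
    gcongr
    · exact (wt_pos x).le
    · unfold wt
      gcongr
  · rw [indicator_of_notMem h, norm_zero]
    positivity

/-- A square integrable distributional solution of `-Δu + (W + c)u = 0` with `W ≥ 0`, `c > 0`
vanishes. -/
theorem eq_zero_of_weak_solution {W : Plane → ℝ} (hW : PolyBdd W) (h0 : ∀ x, 0 ≤ W x) {c : ℝ}
    (hc : 0 < c) {u : L2}
    (h : ∀ φ, IsTest φ → ∫ x, (-(Δ φ) x + ((W x + c : ℝ) : ℂ) * φ x) * u x = 0) : u = 0 := by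
  obtain ⟨M, hM⟩ := exists_cutoff
  have hM0 : 0 ≤ M := by
    obtain ⟨η, -, -, -, -, h5⟩ := hM 1 one_pos
    have := (Finset.sum_nonneg fun i _ => sq_nonneg (pd i η 0)).trans (h5 0)
    simpa using this
  have hul : LocallyIntegrable u (volume : Measure Plane) :=
    (Lp.memLp u).locallyIntegrable (by norm_num)
  have hq := hW.add_const c
  -- the localized inequality
  have key : ∀ R : ℝ, 0 < R → c * ∫ x in Metric.closedBall (0 : Plane) R, ‖u x‖ ^ 2 ≤
      M / R ^ 2 * ‖u‖ ^ 2 := by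
    intro R hR
    obtain ⟨η, hη, hη0, hη1, hηb, hηd⟩ := hM R hR
    -- The cutoff vanishes for $|x|\ge2R$ and mollifiers will have radius at most $1$, so only the
    -- values of $(W+c)u$ on this ball enter. Truncating there makes the product square integrable.
    set B := Metric.ball (0 : Plane) (2 * R + 1) with hB
    let G : L2 := (hq.memLp_indicator u (2 * R + 1)).toLp _
    have hG : G =ᵐ[volume] B.indicator fun x => ((W x + c : ℝ) : ℂ) * u x :=
      MemLp.coeFn_toLp _
    have hw : BddMeas fun x => η x ^ 2 :=
      ⟨(hη.continuous.pow 2).aestronglyMeasurable, 1, fun x => by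
        rw [abs_pow]; exact pow_le_one₀ (abs_nonneg _) (hηb x)⟩
    have hηc : HasCompactSupport η := by
      refine HasCompactSupport.intro (isCompact_closedBall (0 : Plane) (2 * R)) fun x hx => ?_
      refine hη0 x ?_
      have : 2 * R < ‖x‖ := by simpa using hx
      exact this.le
    -- The localized energy inequality as a closed condition on pairs. The pair $(\rho*u,\rho*G)$
    -- satisfies it by smoothness, and $(u,G)$ is a limit of such pairs.
    let s : Set (L2 × L2) := {q | (inner ℂ (mulL2 (fun x => η x ^ 2) q.1) q.2).re ≤
      M / R ^ 2 * ‖q.1‖ ^ 2}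
    have hs : IsClosed s := isClosed_le (by fun_prop) (by fun_prop)
    have hmem : (u, G) ∈ closure s := by
      rw [Metric.mem_closure_iff]
      intro κ hκ
      obtain ⟨δ₁, hδ₁, h1⟩ := exists_mollify_close u (half_pos hκ)
      obtain ⟨δ₂, hδ₂, h2⟩ := exists_mollify_close G (half_pos hκ)
      obtain ⟨ρ, hρ⟩ := exists_mollifier (lt_min one_pos (lt_min hδ₁ hδ₂))
      obtain ⟨U, hU, hUκ⟩ := h1 ρ (hρ.mono ((min_le_right _ _).trans (min_le_left _ _)))
      obtain ⟨G', hG', hGκ⟩ := h2 ρ (hρ.mono ((min_le_right _ _).trans (min_le_right _ _)))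
      refine ⟨(U, G'), ?_, ?_⟩
      · have e1 : (inner ℂ (mulL2 (fun x => η x ^ 2) U) G').re =
            ∫ x, η x ^ 2 * inner ℝ (mollify ρ u x) (mollify ρ G x) := re_inner_mulL2 hw hU hG'
        have e2 : ∀ x, η x ^ 2 * inner ℝ (mollify ρ u x) (mollify ρ G x) =
            - (η x ^ 2 * inner ℝ (mollify ρ u x) (-(Δ (mollify ρ u)) x)) := by
          intro x
          by_cases hx : 2 * R ≤ ‖x‖
          · simp [hη0 x hx]
          -- For $|x|<2R$ the support of $\rho(x-\cdot)$ lies in $B$, so the truncation is invisible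
          -- and the weak equation gives $\Delta(\rho*u)=\rho*G$ at $x$.
          · have e3 : mollify ρ G x = (Δ (mollify ρ u)) x := by
              rw [laplacian_mollify hρ.smooth hρ.compact hul]
              have ht := h _ (isTest_reflect hρ.smooth hρ.compact x)
              simp_rw [laplacian_reflect hρ.smooth] at ht
              have i1 : Integrable fun t => (Δ ρ) (x - t) • u t :=
                ((hasCompactSupport_laplacian hρ.compact).convolutionExists_right
                  (ContinuousLinearMap.lsmul ℝ ℝ (E := ℂ)).flip hul
                  (continuous_laplacian (hρ.smooth.of_le two_le_infty)) x).integrable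
              have i2 : Integrable fun t => ρ (x - t) • G t :=
                (hρ.compact.convolutionExists_right
                  (ContinuousLinearMap.lsmul ℝ ℝ (E := ℂ)).flip
                  ((Lp.memLp G).locallyIntegrable (by norm_num)) hρ.smooth.continuous x).integrable
              have e4 : ∫ t, (-(((Δ ρ) (x - t) : ℝ) : ℂ) +
                  ((W t + c : ℝ) : ℂ) * (ρ (x - t) : ℂ)) * u t =
                  ∫ t, (ρ (x - t) • G t - (Δ ρ) (x - t) • u t) := by
                refine integral_congr_ae ?_
                filter_upwards [hG] with t ht
                rw [ht]
                by_cases hb : t ∈ B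
                · rw [indicator_of_mem hb, Complex.real_smul, Complex.real_smul]
                  ring
                · have : ρ (x - t) = 0 := by
                    by_contra hne
                    have h5 := (hρ.small _ hne).trans_le (min_le_left _ _)
                    refine hb ?_
                    rw [hB, mem_ball_zero_iff]
                    have h6 : ‖t‖ ≤ ‖x‖ + ‖x - t‖ := by
                      have := norm_sub_le x (x - t)
                      simpa using this
                    linarith [not_le.1 hx]
                  simp [this, hb]
              rw [e4, integral_sub i2 i1] at ht
              exact sub_eq_zero.1 ht
            rw [e3, inner_neg_right]
            ring
        change (inner ℂ (mulL2 (fun x => η x ^ 2) U) G').re ≤ M / R ^ 2 * ‖U‖ ^ 2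
        rw [e1]
        simp_rw [e2]
        rw [integral_neg]
        have e5 := energy_ineq (hη.of_le (by norm_num))
          ((contDiff_mollify hρ.smooth hρ.compact hul).of_le two_le_infty) (Or.inl hηc)
        have e6 := integral_pd_sq_le hηd hU
        linarith
      · rw [dist_comm, Prod.dist_eq, max_lt_iff, dist_eq_norm, dist_eq_norm]
        exact ⟨hUκ.trans_lt (half_lt_self hκ), hGκ.trans_lt (half_lt_self hκ)⟩
    have hfin : (inner ℂ (mulL2 (fun x => η x ^ 2) u) G).re ≤ M / R ^ 2 * ‖u‖ ^ 2 :=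
      hs.closure_subset hmem
    refine le_trans ?_ hfin
    rw [re_inner_mulL2 hw (ae_eq_refl _) hG, ← integral_const_mul,
      ← integral_indicator Metric.isClosed_closedBall.measurableSet]
    refine integral_mono_of_nonneg ?_ ?_ (Eventually.of_forall fun x => ?_)
    · exact Eventually.of_forall fun x => indicator_nonneg (fun x _ => by positivity) x
    · refine hw.integrable_mul ?_
      have : Integrable (fun x => inner ℂ (u x) (G x)) volume := L2.integrable_inner u G
      refine this.re.congr ?_
      filter_upwards [hG] with x hx
      rw [hx]
      rfl
    · simp only
      by_cases hx : x ∈ Metric.closedBall (0 : Plane) R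
      · have hx' : ‖x‖ ≤ R := by simpa using hx
        have hxB : x ∈ B := by
          rw [hB, mem_ball_zero_iff]
          linarith
        rw [indicator_of_mem hx, indicator_of_mem hxB, hη1 x hx', ← Complex.real_smul,
          real_inner_smul_right, real_inner_self_eq_norm_sq]
        have := h0 x
        have : 0 ≤ W x * ‖u x‖ ^ 2 := by positivity
        linarith
      · rw [indicator_of_notMem hx]
        by_cases hxB : x ∈ B
        · rw [indicator_of_mem hxB, ← Complex.real_smul,
            real_inner_smul_right, real_inner_self_eq_norm_sq]
          have := h0 x
          positivity
        · rw [indicator_of_notMem hxB]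
          simp
  -- As $R\to\infty$ the left side of the localized inequality tends to $c\|u\|^2$ and the right
  -- side, of order $R^{-2}$, to zero.
  have hlim : Tendsto (fun n : ℕ => ∫ x in Metric.closedBall (0 : Plane) n, ‖u x‖ ^ 2) atTop
      (𝓝 (∫ x in ⋃ n : ℕ, Metric.closedBall (0 : Plane) n, ‖u x‖ ^ 2)) :=
    tendsto_setIntegral_of_monotone (fun n => Metric.isClosed_closedBall.measurableSet)
      (fun m n hmn => Metric.closedBall_subset_closedBall (by exact_mod_cast hmn))
      (integrable_sq_norm u).integrableOn
  rw [Metric.iUnion_closedBall_nat, setIntegral_univ, ← norm_sq_eq_integral (ae_eq_refl _)] at hlim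
  have hlim2 : Tendsto (fun n : ℕ => M / (n : ℝ) ^ 2 * ‖u‖ ^ 2) atTop (𝓝 (0 * ‖u‖ ^ 2)) := by
    refine Tendsto.mul_const _ ?_
    exact tendsto_const_nhds.div_atTop
      ((tendsto_pow_atTop two_ne_zero).comp tendsto_natCast_atTop_atTop)
  have hle := le_of_tendsto_of_tendsto (hlim.const_mul c) hlim2 (by
    filter_upwards [eventually_gt_atTop 0] with n hn
    exact key n (by exact_mod_cast hn))
  have : ‖u‖ ^ 2 ≤ 0 := by
    rw [zero_mul] at hle
    exact nonpos_of_mul_nonpos_right hle hc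
  simpa using this

/-! ### Nonnegative self-adjoint operators -/

/-- Nonnegative self-adjoint operators, described by their symmetry and their resolvents at the
negative reals. -/
structure PosSA (A : L2 →ₗ.[ℂ] L2) : Prop where
  symm : ∀ {f g f' g' : L2}, (f, g) ∈ A.graph → (f', g') ∈ A.graph → inner ℂ f g' = inner ℂ g f'
  nonneg : ∀ {f g : L2}, (f, g) ∈ A.graph → 0 ≤ (inner ℂ f g).re
  resolvent : ∀ c : ℝ, 0 < c → ∃ R, IsResolventAt A (-c) R

theorem re_inner_core {W : Plane → ℝ} {f g : L2} {φ : Plane → ℂ} (hφ : IsTest φ)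
    (hf : f =ᵐ[volume] φ) (hg : g =ᵐ[volume] fun x => -(Δ φ) x + (W x : ℂ) * φ x)
    (hW : PolyBdd W) :
    Integrable (fun x => W x * ‖φ x‖ ^ 2) ∧
    (inner ℂ f g).re = (∫ x, inner ℝ (φ x) (-(Δ φ) x)) + ∫ x, W x * ‖φ x‖ ^ 2 := by
  have i2 : Integrable fun x => W x * ‖φ x‖ ^ 2 := by
    have := ((memLp_of_test hφ.conj.smooth.continuous hφ.conj.compact).integrable_mul
      (hW.memLp_mul hφ.smooth.continuous hφ.compact)).re
    refine this.congr (Eventually.of_forall fun x => ?_)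
    have : starRingEnd ℂ (φ x) * ((W x : ℂ) * φ x) = ((W x * ‖φ x‖ ^ 2 : ℝ) : ℂ) := by
      rw [mul_left_comm, Complex.conj_mul']
      push_cast
      ring
    simp only [Pi.mul_apply, this]
    rfl
  refine ⟨i2, ?_⟩
  rw [re_inner_eq_integral hf hg, ← integral_add _ i2]
  · refine integral_congr_ae (Eventually.of_forall fun x => ?_)
    simp only
    rw [inner_add_right, ← Complex.real_smul, real_inner_smul_right, real_inner_self_eq_norm_sq]
  · refine Continuous.integrable_of_hasCompactSupport
      (hφ.smooth.continuous.inner (continuous_laplacian hφ.contDiff_two).neg)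
      (hφ.compact.mono fun x hx => ?_)
    contrapose! hx
    simp only [Function.mem_support, not_not] at hx ⊢
    simp [hx]

theorem integral_inner_laplacian_nonneg {φ : Plane → ℂ} (hφ : IsTest φ) :
    0 ≤ ∫ x, inner ℝ (φ x) (-(Δ φ) x) := by
  rw [integral_inner_laplacian (hφ.smooth.of_le (by norm_num)) hφ.contDiff_two hφ.compact]
  exact integral_nonneg fun x => Finset.sum_nonneg fun i _ => real_inner_self_nonneg

/-! ### Coercivity and the existence of resolvents -/

section Resolvent

variable {A : L2 →ₗ.[ℂ] L2}

/-- Pair $g+cf$ with $f$: positivity gives $c\|f\|^2\le\mathrm{Re}\langle f,g+cf\rangle$, and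
Cauchy–Schwarz finishes. -/
theorem mul_norm_le_norm_add_smul {f g : L2} (hn : 0 ≤ (inner ℂ f g).re) (c : ℝ) :
    c * ‖f‖ ≤ ‖g + (c : ℂ) • f‖ := by
  rcases eq_or_ne f 0 with rfl | hf
  · simp
  have h1 : (inner ℂ f (g + (c : ℂ) • f)).re = (inner ℂ f g).re + c * ‖f‖ ^ 2 := by
    rw [inner_add_right, inner_smul_right, inner_self_eq_norm_sq_to_K, Complex.add_re,
      Complex.re_ofReal_mul]
    norm_cast
  have h3 : (inner ℂ f (g + (c : ℂ) • f)).re ≤ ‖f‖ * ‖g + (c : ℂ) • f‖ :=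
    (Complex.re_le_norm _).trans (norm_inner_le_norm _ _)
  have hpos : 0 < ‖f‖ := norm_pos_iff.2 hf
  have : ‖f‖ * (c * ‖f‖) ≤ ‖f‖ * ‖g + (c : ℂ) • f‖ := by nlinarith
  exact le_of_mul_le_mul_left this hpos

/-- A closed nonnegative graph for which `A + c` has dense range has a resolvent at `-c`. -/
theorem exists_resolvent_of_dense (hcl : IsClosed (A.graph : Set (L2 × L2)))
    (hn : ∀ {f g : L2}, (f, g) ∈ A.graph → 0 ≤ (inner ℂ f g).re) {c : ℝ} (hc : 0 < c)
    (hd : ∀ u : L2, (∀ f g : L2, (f, g) ∈ A.graph → inner ℂ (g + (c : ℂ) • f) u = 0) → u = 0) :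
    ∃ R, IsResolventAt A (-c) R := by
  have : CompleteSpace A.graph := hcl.completeSpace_coe
  let Φ : A.graph →L[ℂ] L2 :=
    (ContinuousLinearMap.snd ℂ L2 L2 + (c : ℂ) • ContinuousLinearMap.fst ℂ L2 L2).comp
      A.graph.subtypeL
  have hΦ : ∀ q : A.graph, Φ q = q.1.2 + (c : ℂ) • q.1.1 := fun q => rfl
  -- Coercivity gives $\|f\|\le c^{-1}\|(A+c)f\|$ and hence $\|Af\|\le2\|(A+c)f\|$; the sum of the
  -- constants dominates the maximum norm on the graph. So $A+c$ has closed range, and density makes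
  -- it onto.
  have hbd : ∀ q : A.graph, ‖q‖ ≤ (2 + c⁻¹ : ℝ) * ‖Φ q‖ := by
    rintro ⟨⟨f, g⟩, h⟩
    have h1 := mul_norm_le_norm_add_smul (hn h) c
    rw [hΦ]
    simp only
    have h2 : ‖f‖ ≤ c⁻¹ * ‖g + (c : ℂ) • f‖ := by
      rw [le_inv_mul_iff₀ hc]; exact h1
    have h3 : ‖g‖ ≤ 2 * ‖g + (c : ℂ) • f‖ := by
      have : ‖g‖ ≤ ‖g + (c : ℂ) • f‖ + ‖(c : ℂ) • f‖ := by
        simpa using norm_sub_le (g + (c : ℂ) • f) ((c : ℂ) • f)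
      rw [norm_smul, Complex.norm_real, Real.norm_of_nonneg hc.le] at this
      linarith
    have h4 : ‖(⟨(f, g), h⟩ : A.graph)‖ = max ‖f‖ ‖g‖ := rfl
    rw [h4]
    have h5 : 0 ≤ c⁻¹ * ‖g + (c : ℂ) • f‖ := by positivity
    have h6 := norm_nonneg (g + (c : ℂ) • f)
    refine max_le ?_ ?_ <;> nlinarith
  have hanti : AntilipschitzWith (2 + c⁻¹).toNNReal Φ :=
    AddMonoidHomClass.antilipschitz_of_bound Φ fun q => by
      rw [Real.coe_toNNReal _ (by positivity)]
      exact hbd q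
  have hinj : LinearMap.ker (Φ : A.graph →ₗ[ℂ] L2) = ⊥ := LinearMap.ker_eq_bot.2 hanti.injective
  have hrc : IsClosed (Set.range Φ) := hanti.isClosed_range Φ.uniformContinuous
  have hsurj : LinearMap.range (Φ : A.graph →ₗ[ℂ] L2) = ⊤ := by
    have hrc' : IsClosed ((LinearMap.range (Φ : A.graph →ₗ[ℂ] L2) : Submodule ℂ L2) : Set L2) := by
      rw [LinearMap.coe_range]
      exact hrc
    have : CompleteSpace (LinearMap.range (Φ : A.graph →ₗ[ℂ] L2)) := hrc'.completeSpace_coe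
    rw [← Submodule.orthogonal_eq_bot_iff, Submodule.eq_bot_iff]
    intro u hu
    refine hd u fun f g h => ?_
    exact (Submodule.mem_orthogonal _ _).1 hu _ ⟨⟨(f, g), h⟩, rfl⟩
  let e := ContinuousLinearEquiv.ofBijective Φ hinj hsurj
  have he : ∀ q, e q = Φ q := fun q => rfl
  refine ⟨(ContinuousLinearMap.fst ℂ L2 L2).comp (A.graph.subtypeL.comp
    (e.symm : L2 →L[ℂ] A.graph)), fun f => ?_, fun f g h => ?_⟩
  · have h1 : Φ (e.symm f) = f := e.apply_symm_apply f
    rw [hΦ] at h1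
    have h2 : f + (-(c : ℂ)) • (e.symm f).1.1 = (e.symm f).1.2 := by
      rw [neg_smul, ← sub_eq_add_neg, sub_eq_iff_eq_add]
      exact h1.symm
    change ((e.symm f).1.1, f + (-(c : ℂ)) • (e.symm f).1.1) ∈ A.graph
    rw [h2]
    exact (e.symm f).2
  · have h1 : e.symm (g - (-(c : ℂ)) • f) = ⟨(f, g), h⟩ := by
      rw [e.symm_apply_eq, he, hΦ, neg_smul, sub_neg_eq_add]
    change (e.symm (g - (-(c : ℂ)) • f)).1.1 = f
    rw [h1]

end Resolvent

/-- Schrödinger operators with a nonnegative polynomially bounded potential are self-adjoint. -/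
theorem posSA_schrodinger {W : Plane → ℝ} (hW : PolyBdd W) (h0 : ∀ x, 0 ≤ W x) :
    PosSA (schrodinger W) := by
  have hcl : IsClosed ((schrodinger W).graph : Set (L2 × L2)) := by
    rw [schrodinger_graph hW]
    exact Submodule.isClosed_topologicalClosure _
  have hn : ∀ {f g : L2}, (f, g) ∈ (schrodinger W).graph → 0 ≤ (inner ℂ f g).re := by
    intro f g h
    refine schrodinger_graph_induction hW (p := fun q => 0 ≤ (inner ℂ q.1 q.2).re)
      (isClosed_le (by fun_prop) (by fun_prop)) ?_ h
    rintro ⟨f, g⟩ ⟨φ, s, c, h1, h2⟩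
    have t : IsTest φ := ⟨s, c⟩
    simp only at h1 h2 ⊢
    rw [(re_inner_core t h1 h2 hW).2]
    refine add_nonneg (integral_inner_laplacian_nonneg t) (integral_nonneg fun x => ?_)
    have := h0 x
    positivity
  refine ⟨?_, hn, ?_⟩
  · intro f g f' g' h h'
    refine schrodinger_graph_induction hW (p := fun q => inner ℂ q.1 g' = inner ℂ q.2 f')
      (isClosed_eq (by fun_prop) (by fun_prop)) ?_ h
    rintro ⟨f, g⟩ hq
    refine schrodinger_graph_induction hW (p := fun q => inner ℂ f q.2 = inner ℂ g q.1)
      (isClosed_eq (by fun_prop) (by fun_prop)) ?_ h'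
    rintro ⟨f', g'⟩ hq'
    exact coreGraph_symm hW hq hq'
  · intro c hc
    -- A vector orthogonal to the range of $A+c$ is a square integrable weak solution of the
    -- homogeneous equation, hence zero. Testing with conjugates turns inner products into plain
    -- integrals.
    refine exists_resolvent_of_dense hcl hn hc fun u hu => ?_
    refine eq_zero_of_weak_solution hW h0 hc fun φ hφ => ?_
    obtain ⟨f, g, hfg, hf, hg⟩ := exists_mem_coreGraph hW hφ.conj
    have h1 := hu f g (coreGraph_le hW hfg)
    have h2 : g + (c : ℂ) • f =ᵐ[volume] fun x => starRingEnd ℂ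
        (-(Δ φ) x + ((W x + c : ℝ) : ℂ) * φ x) := by
      filter_upwards [Lp.coeFn_add g ((c : ℂ) • f), Lp.coeFn_smul (c : ℂ) f, hf, hg] with x a b d e
      rw [a, Pi.add_apply, b, Pi.smul_apply, d, e, laplacian_conj]
      simp only [map_add, map_neg, map_mul, Complex.conj_ofReal, smul_eq_mul, Complex.ofReal_add]
      ring
    rw [inner_eq_integral h2 (ae_eq_refl _)] at h1
    simpa only [Complex.conj_conj] using h1

/-! ### Stone's theorem for nonnegative self-adjoint operators -/

theorem norm_apply_of_mem_unitary {U : L2 →L[ℂ] L2} (hU : U ∈ unitary (L2 →L[ℂ] L2)) (f : L2) :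
    ‖U f‖ = ‖f‖ :=
  (ContinuousLinearMap.norm_map_iff_adjoint_comp_self U).2 (Unitary.mem_iff.1 hU).1 f

theorem exp_smul_mem_unitary {D : L2 →L[ℂ] L2} (hD : D ∈ skewAdjoint (L2 →L[ℂ] L2)) (t : ℝ) :
    NormedSpace.exp (t • D) ∈ unitary (L2 →L[ℂ] L2) := by
  let _ : NormedAlgebra ℚ (L2 →L[ℂ] L2) := NormedAlgebra.restrictScalars ℚ ℂ _
  refine NormedSpace.exp_mem_unitary_of_mem_skewAdjoint ?_
  rw [skewAdjoint.mem_iff] at hD ⊢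
  have e : t • D = (t : ℂ) • D := RCLike.real_smul_eq_coe_smul (K := ℂ) t D
  rw [e, star_smul, hD, RCLike.star_def, Complex.conj_ofReal, smul_neg]

theorem hasDerivAt_exp_apply (D : L2 →L[ℂ] L2) (f : L2) (t : ℝ) :
    HasDerivAt (fun s : ℝ => NormedSpace.exp (s • D) f) (NormedSpace.exp (t • D) (D f)) t := by
  have h := hasDerivAt_exp_smul_const (𝕂 := ℝ) D t
  exact ((ContinuousLinearMap.apply ℂ L2 f).restrictScalars ℝ).hasFDerivAt.comp_hasDerivAt t h

/-- Mean value inequality: the derivative $e^{sD}Df$ has constant norm $\|Df\|$ because $e^{sD}$ is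
unitary. The bound thus involves only $Df$ and not the size of $D$. -/
theorem norm_exp_smul_sub_le {D : L2 →L[ℂ] L2} (hD : D ∈ skewAdjoint (L2 →L[ℂ] L2)) (t : ℝ)
    (f : L2) : ‖NormedSpace.exp (t • D) f - f‖ ≤ |t| * ‖D f‖ := by
  have := convex_univ.norm_image_sub_le_of_norm_hasDerivWithin_le (𝕜 := ℝ)
    (f := fun s : ℝ => NormedSpace.exp (s • D) f) (x := 0) (y := t) (C := ‖D f‖)
    (fun s _ => (hasDerivAt_exp_apply D f s).hasDerivWithinAt)
    (fun s _ => (norm_apply_of_mem_unitary (exp_smul_mem_unitary hD s) _).le)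
    (mem_univ _) (mem_univ _)
  simpa [mul_comm] using this

/-! ### Resolvent identities and Yosida approximations -/

section Resolvents

variable {A : L2 →ₗ.[ℂ] L2} {R R' : L2 →L[ℂ] L2} {c c' : ℝ}

theorem IsResolventAt.mem_graph (h : IsResolventAt A (-c) R) (f : L2) :
    (R f, f - (c : ℂ) • R f) ∈ A.graph := by
  have := h.1 f
  rwa [neg_smul, ← sub_eq_add_neg] at this

theorem IsResolventAt.apply_add (h : IsResolventAt A (-c) R) {f g : L2} (hf : (f, g) ∈ A.graph) :
    R (g + (c : ℂ) • f) = f := by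
  have := h.2 f g hf
  rwa [neg_smul, sub_neg_eq_add] at this

theorem PosSA.inner_resolvent (hA : PosSA A) (h : IsResolventAt A (-c) R) (f g : L2) :
    inner ℂ (R f) g = inner ℂ f (R g) := by
  have := hA.symm (h.mem_graph f) (h.mem_graph g)
  rw [inner_sub_left, inner_sub_right, inner_smul_left, inner_smul_right,
    Complex.conj_ofReal] at this
  exact sub_left_injective this

theorem PosSA.isSelfAdjoint_resolvent (hA : PosSA A) (h : IsResolventAt A (-c) R) :
    IsSelfAdjoint R :=
  ContinuousLinearMap.isSelfAdjoint_iff_isSymmetric.2 fun f g => hA.inner_resolvent h f g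

theorem PosSA.norm_resolvent_le (hA : PosSA A) (h : IsResolventAt A (-c) R) (f : L2) :
    c * ‖R f‖ ≤ ‖f‖ := by
  have := mul_norm_le_norm_add_smul (hA.nonneg (h.mem_graph f)) c
  simpa using this

theorem IsResolventAt.identity (h : IsResolventAt A (-c) R) (h' : IsResolventAt A (-c') R')
    (f : L2) : R f + ((c : ℂ) - c') • R (R' f) = R' f := by
  have := h.apply_add (h'.mem_graph f)
  rw [map_add, map_sub, map_smul, map_smul] at this
  rw [sub_smul]
  refine Eq.trans ?_ this
  abel

theorem IsResolventAt.commute (h : IsResolventAt A (-c) R) (h' : IsResolventAt A (-c') R') :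
    Commute R R' := by
  ext1 f
  change R (R' f) = R' (R f)
  have h1 := h.identity h' f
  have h2 := h'.identity h f
  rcases eq_or_ne c c' with rfl | hne
  · have h3 : ∀ f, R f = R' f := fun f => by simpa using h.identity h' f
    rw [h3, h3]
  · have hne' : (c : ℂ) - c' ≠ 0 := sub_ne_zero.2 (by exact_mod_cast hne)
    have h3 : ((c : ℂ) - c') • R (R' f) = ((c : ℂ) - c') • R' (R f) := by
      rw [eq_comm, ← sub_eq_iff_eq_add'] at h1 h2
      rw [← h1, ← neg_sub (c' : ℂ) c, neg_smul, ← h2, neg_sub]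
    exact smul_right_injective _ hne' h3

theorem PosSA.eq_zero_of_resolvent_eq_zero (h : IsResolventAt A (-c) R)
    {f : L2} (hf : R f = 0) : f = 0 := by
  have := h.mem_graph f
  rw [hf, smul_zero, sub_zero] at this
  exact A.graph_fst_eq_zero_snd this rfl

/-- The domain of a nonnegative self-adjoint operator is dense. -/
theorem PosSA.dense_range_resolvent (hA : PosSA A) (h : IsResolventAt A (-c) R) :
    DenseRange R := by
  have : (LinearMap.range (R : L2 →ₗ[ℂ] L2)).topologicalClosure = ⊤ := by
    rw [Submodule.topologicalClosure_eq_top_iff, Submodule.eq_bot_iff]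
    intro u hu
    refine PosSA.eq_zero_of_resolvent_eq_zero h (ext_inner_left ℂ fun v => ?_)
    rw [← hA.inner_resolvent h, inner_zero_right]
    exact (Submodule.mem_orthogonal _ _).1 hu _ ⟨v, rfl⟩
  have h2 := Submodule.dense_iff_topologicalClosure_eq_top.2 this
  rwa [LinearMap.coe_range] at h2

/-- The Yosida approximation `c - c² (A + c)⁻¹`, multiplied by `-i`. -/
def yosida (R : L2 →L[ℂ] L2) (c : ℝ) : L2 →L[ℂ] L2 :=
  (-Complex.I) • ((c : ℂ) • (1 : L2 →L[ℂ] L2) - ((c : ℂ) ^ 2) • R)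

theorem PosSA.yosida_mem (hA : PosSA A) (h : IsResolventAt A (-c) R) :
    yosida R c ∈ skewAdjoint (L2 →L[ℂ] L2) := by
  rw [skewAdjoint.mem_iff, yosida, star_smul, star_sub, star_smul, star_smul,
    (hA.isSelfAdjoint_resolvent h).star_eq, star_one, star_pow]
  simp only [star_neg, RCLike.star_def, Complex.conj_I, Complex.conj_ofReal, neg_neg, neg_smul]

/-- On the domain, $c-c^2R=cRA$. Since $cR\to1$ strongly as $c\to\infty$, the approximations
converge there to $-iA$. -/
theorem yosida_apply (h : IsResolventAt A (-c) R) {f g : L2} (hf : (f, g) ∈ A.graph) :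
    yosida R c f = (-Complex.I) • ((c : ℂ) • R g) := by
  have h1 := h.apply_add hf
  rw [map_add, map_smul] at h1
  have h2 : yosida R c f = (-Complex.I) • ((c : ℂ) • f - ((c : ℂ) ^ 2) • R f) := rfl
  rw [h2]
  nth_rewrite 1 [← h1]
  rw [smul_add, smul_smul, ← pow_two, add_sub_cancel_right]

theorem commute_yosida (h : IsResolventAt A (-c) R) (h' : IsResolventAt A (-c') R') :
    Commute (yosida R c) (yosida R' c') := by
  unfold yosida
  refine Commute.smul_left (Commute.smul_right ?_ _) _
  refine Commute.sub_left (Commute.smul_left (Commute.one_left _) _) ?_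
  refine Commute.sub_right (Commute.smul_right (Commute.one_right _) _) ?_
  exact Commute.smul_left (Commute.smul_right (h.commute h') _) _

end Resolvents

/-- The $\kappa/3$ argument: contractions carry the Cauchy property from a dense set to the whole
space. -/
theorem tendsto_apply_of_dense {T : ℕ → L2 →L[ℂ] L2} (hT : ∀ n f, ‖T n f‖ ≤ ‖f‖) {s : Set L2}
    (hs : Dense s) (h : ∀ f ∈ s, CauchySeq fun n => T n f) (f : L2) :
    CauchySeq fun n => T n f := by
  rw [Metric.cauchySeq_iff]
  intro κ hκ
  obtain ⟨g, hg, hfg⟩ := Metric.dense_iff.1 hs f (κ / 3) (by positivity)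
  obtain ⟨n₀, hn₀⟩ := Metric.cauchySeq_iff.1 (h g hfg) (κ / 3) (by positivity)
  refine ⟨n₀, fun m hm n hn => ?_⟩
  have h1 := hn₀ m hm n hn
  have h2 : ∀ n, dist (T n f) (T n g) < κ / 3 := fun n => by
    rw [dist_eq_norm, ← map_sub]
    refine (hT n _).trans_lt ?_
    rw [← dist_eq_norm, dist_comm]
    exact hg
  calc dist (T m f) (T n f) ≤ dist (T m f) (T m g) + dist (T m g) (T n g) + dist (T n g) (T n f) :=
        dist_triangle4 _ _ _ _
    _ < κ := by
        have := h2 m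
        have := h2 n
        rw [dist_comm] at this
        linarith

/-- On the domain $cRf-f=-RAf$ has norm at most $\|Af\|/c$. Since each $cR$ is a contraction and the
domain is dense, convergence extends to every vector. -/
theorem PosSA.tendsto_smul_resolvent {A : L2 →ₗ.[ℂ] L2} (hA : PosSA A) {R : ℕ → L2 →L[ℂ] L2}
    (hR : ∀ n : ℕ, IsResolventAt A (-(((n : ℝ) + 1 : ℝ) : ℂ)) (R n)) (g : L2) :
    Tendsto (fun n : ℕ => (((n : ℝ) + 1 : ℝ) : ℂ) • R n g) atTop (𝓝 g) := by
  have hpos : ∀ n : ℕ, (0 : ℝ) < (n : ℝ) + 1 := fun n => by positivity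
  have hnorm : ∀ (n : ℕ) f, ‖(((n : ℝ) + 1 : ℝ) : ℂ) • R n f‖ ≤ ‖f‖ := fun n f => by
    rw [norm_smul, Complex.norm_real, Real.norm_of_nonneg (hpos n).le]
    exact hA.norm_resolvent_le (hR n) f
  rw [Metric.tendsto_atTop]
  intro κ hκ
  obtain ⟨_, hg, ⟨k, rfl⟩⟩ :=
    Metric.dense_iff.1 (hA.dense_range_resolvent (hR 0)) g (κ / 3) (by positivity)
  have hk := (hR 0).mem_graph k
  set f := R 0 k
  set b := k - ((((0 : ℕ) : ℝ) + 1 : ℝ) : ℂ) • f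
  obtain ⟨n₀, hn₀⟩ := exists_nat_gt (‖b‖ / (κ / 3))
  refine ⟨n₀, fun n hn => ?_⟩
  have h1 : (((n : ℝ) + 1 : ℝ) : ℂ) • R n f - f = -R n b := by
    have := (hR n).apply_add hk
    rw [map_add, map_smul] at this
    rw [sub_eq_iff_eq_add, neg_add_eq_sub, eq_sub_iff_add_eq', this]
  have h2 : ‖R n b‖ < κ / 3 := by
    have h3 := hA.norm_resolvent_le (hR n) b
    rw [div_lt_iff₀ (by positivity)] at hn₀
    have h4 : (n₀ : ℝ) ≤ n := by exact_mod_cast hn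
    by_contra hcon
    push Not at hcon
    have h5 : ((n : ℝ) + 1) * (κ / 3) ≤ ((n : ℝ) + 1) * ‖R n b‖ := by gcongr
    nlinarith
  rw [dist_eq_norm]
  have e : (((n : ℝ) + 1 : ℝ) : ℂ) • R n g - g = (((n : ℝ) + 1 : ℝ) : ℂ) • R n (g - f) +
      ((((n : ℝ) + 1 : ℝ) : ℂ) • R n f - f) + (f - g) := by
    rw [map_sub, smul_sub]
    abel
  have h6 : ‖f - g‖ < κ / 3 := by
    rw [← dist_eq_norm]
    exact hg
  have h7 := hnorm n (g - f)
  rw [norm_sub_rev g f] at h7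
  rw [e, h1]
  calc _ ≤ ‖(((n : ℝ) + 1 : ℝ) : ℂ) • R n (g - f)‖ + ‖-R n b‖ + ‖f - g‖ := norm_add₃_le
    _ < κ := by
      rw [norm_neg]
      linarith

/-- Stone's theorem for nonnegative self-adjoint operators. -/
theorem PosSA.exists_unitaryGroup {A : L2 →ₗ.[ℂ] L2} (hA : PosSA A) :
    ∃ U, IsUnitaryGroupOf A U := by
  have hpos : ∀ n : ℕ, (0 : ℝ) < (n : ℝ) + 1 := fun n => by positivity
  choose R hR using fun n : ℕ => hA.resolvent ((n : ℝ) + 1) (hpos n)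
  set D : ℕ → L2 →L[ℂ] L2 := fun n => yosida (R n) ((n : ℝ) + 1) with hD
  have hDs : ∀ n, D n ∈ skewAdjoint (L2 →L[ℂ] L2) := fun n => hA.yosida_mem (hR n)
  have hDc : ∀ m n, Commute (D m) (D n) := fun m n => commute_yosida (hR m) (hR n)
  set V : ℕ → ℝ → L2 →L[ℂ] L2 := fun n t => NormedSpace.exp (t • D n) with hV
  have hVu : ∀ n t, V n t ∈ unitary (L2 →L[ℂ] L2) := fun n t => exp_smul_mem_unitary (hDs n) t
  have hVn : ∀ n t f, ‖V n t f‖ = ‖f‖ := fun n t f => norm_apply_of_mem_unitary (hVu n t) f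
  have hDlim : ∀ {f g}, (f, g) ∈ A.graph → Tendsto (fun n => D n f) atTop
      (𝓝 (-(Complex.I • g))) := fun {f g} h => by
    have := (hA.tendsto_smul_resolvent hR g).const_smul (-Complex.I)
    rw [neg_smul] at this
    exact this.congr fun n => (yosida_apply (hR n) h).symm
  have hVadd : ∀ n s t, V n (s + t) = V n s * V n t := fun n s t => by
    rw [hV]
    simp only [add_smul]
    let _ : NormedAlgebra ℚ (L2 →L[ℂ] L2) := NormedAlgebra.restrictScalars ℚ ℂ _
    exact NormedSpace.exp_add_of_commute ((Commute.refl _).smul_left _ |>.smul_right _)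
  -- The approximations commute, so $e^{tD_m}-e^{tD_n}=e^{tD_n}(e^{t(D_m-D_n)}-1)$, whose value at
  -- $f$ is bounded by $|t|\,\|D_mf-D_nf\|$. On the domain $D_nf$ converges.
  have hcauchy : ∀ t f, CauchySeq fun n => V n t f := by
    intro t
    refine tendsto_apply_of_dense (fun n f => (hVn n t f).le)
      (hA.dense_range_resolvent (hR 0)) ?_
    rintro _ ⟨k, rfl⟩
    have hk := (hR 0).mem_graph k
    have hc := (hDlim hk).cauchySeq
    rw [Metric.cauchySeq_iff] at hc ⊢
    intro κ hκ
    obtain ⟨n₀, h₀⟩ := hc (κ / (|t| + 1)) (by positivity)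
    refine ⟨n₀, fun m hm n hn => ?_⟩
    have h1 := h₀ m hm n hn
    have e : V m t = V n t * NormedSpace.exp (t • (D m - D n)) := by
      rw [hV]
      simp only
      let _ : NormedAlgebra ℚ (L2 →L[ℂ] L2) := NormedAlgebra.restrictScalars ℚ ℂ _
      rw [← NormedSpace.exp_add_of_commute, smul_sub, add_sub_cancel]
      exact (((hDc n m).sub_right (Commute.refl _)).smul_left _).smul_right _
    have h2 : V m t (R 0 k) - V n t (R 0 k) =
        V n t (NormedSpace.exp (t • (D m - D n)) (R 0 k) - R 0 k) := by
      rw [e, map_sub]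
      rfl
    rw [dist_eq_norm, h2, hVn]
    have h3 := norm_exp_smul_sub_le (sub_mem (hDs m) (hDs n)) t (R 0 k)
    rw [dist_eq_norm, lt_div_iff₀ (by positivity)] at h1
    have h4 : ‖(D m - D n) (R 0 k)‖ = ‖D m (R 0 k) - D n (R 0 k)‖ := rfl
    rw [h4] at h3
    nlinarith [norm_nonneg (D m (R 0 k) - D n (R 0 k))]
  choose u hu using fun t f => cauchySeq_tendsto_of_complete (hcauchy t f)
  let U : ℝ → L2 →L[ℂ] L2 := fun t =>
    continuousLinearMapOfTendsto (fun n => V n t) (tendsto_pi_nhds.2 (hu t))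
  have hU : ∀ t f, Tendsto (fun n => V n t f) atTop (𝓝 (U t f)) := hu
  have hUn : ∀ t f, ‖U t f‖ = ‖f‖ := fun t f =>
    tendsto_nhds_unique (hU t f).norm (tendsto_const_nhds.congr fun n => (hVn n t f).symm)
  have hcomb : ∀ t {f : ℕ → L2} {g : L2}, Tendsto f atTop (𝓝 g) →
      Tendsto (fun n => V n t (f n)) atTop (𝓝 (U t g)) := by
    intro t f g hf
    have h1 : Tendsto (fun n => V n t (f n - g)) atTop (𝓝 0) := by
      rw [tendsto_zero_iff_norm_tendsto_zero]
      simp_rw [hVn]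
      exact tendsto_iff_norm_sub_tendsto_zero.1 hf
    have := h1.add (hU t g)
    rw [zero_add] at this
    exact this.congr fun n => by rw [map_sub, sub_add_cancel]
  have hU0 : U 0 = 1 := by
    ext1 f
    refine tendsto_nhds_unique (hU 0 f) (tendsto_const_nhds.congr fun n => ?_)
    rw [hV]
    simp
  have hUadd : ∀ s t, U (s + t) = U s * U t := by
    intro s t
    ext1 f
    refine tendsto_nhds_unique (hU (s + t) f) ?_
    refine (hcomb s (hU t f)).congr fun n => ?_
    rw [hVadd]
    rfl
  have hUinv : ∀ t, U (-t) * U t = 1 := fun t => by rw [← hUadd, neg_add_cancel, hU0]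
  have hUinv' : ∀ t, U t * U (-t) = 1 := fun t => by rw [← hUadd, add_neg_cancel, hU0]
  have hstar : ∀ t, star (U t) = U (-t) := by
    intro t
    have h1 : star (U t) * U t = 1 :=
      (ContinuousLinearMap.norm_map_iff_adjoint_comp_self (U t)).1 (hUn t)
    calc star (U t) = star (U t) * (U t * U (-t)) := by rw [hUinv', mul_one]
      _ = U (-t) := by rw [← mul_assoc, h1, one_mul]
  have hUlip : ∀ {f g}, (f, g) ∈ A.graph → ∀ t, ‖U t f - f‖ ≤ |t| * ‖g‖ := by
    intro f g h t
    have h1 : Tendsto (fun n => |t| * ‖D n f‖) atTop (𝓝 (|t| * ‖-(Complex.I • g)‖)) :=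
      (hDlim h).norm.const_mul _
    rw [norm_neg, norm_smul, Complex.norm_I, one_mul] at h1
    exact le_of_tendsto_of_tendsto' ((hU t f).sub_const f).norm h1
      fun n => norm_exp_smul_sub_le (hDs n) t f
  have hUc0 : ∀ f, Tendsto (fun t => U t f) (𝓝 0) (𝓝 f) := by
    intro f
    rw [Metric.tendsto_nhds]
    intro κ hκ
    obtain ⟨_, hg, ⟨k, rfl⟩⟩ :=
      Metric.dense_iff.1 (hA.dense_range_resolvent (hR 0)) f (κ / 3) (by positivity)
    have hk := (hR 0).mem_graph k
    have h1 : Tendsto (fun t : ℝ => |t| * ‖k - (((0 : ℕ) + 1 : ℝ) : ℂ) • R 0 k‖) (𝓝 0) (𝓝 0) := by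
      have : Continuous fun t : ℝ => |t| * ‖k - (((0 : ℕ) + 1 : ℝ) : ℂ) • R 0 k‖ := by fun_prop
      simpa using this.tendsto 0
    filter_upwards [h1.eventually (gt_mem_nhds (show 0 < κ / 3 by positivity))] with t ht
    have h2 := (hUlip hk t).trans_lt ht
    have h3 : ‖f - R 0 k‖ < κ / 3 := by
      rw [norm_sub_rev, ← dist_eq_norm]
      exact hg
    have e : U t f - f = U t (f - R 0 k) + (U t (R 0 k) - R 0 k) - (f - R 0 k) := by
      rw [map_sub]
      abel
    rw [dist_eq_norm, e]
    calc _ ≤ ‖U t (f - R 0 k)‖ + ‖U t (R 0 k) - R 0 k‖ + ‖f - R 0 k‖ :=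
          (norm_sub_le _ _).trans (by gcongr; exact norm_add_le _ _)
      _ < κ := by
        rw [hUn]
        linarith
  have hUc : ∀ f, Continuous fun t => U t f := by
    intro f
    rw [continuous_iff_continuousAt]
    intro t
    have h1 : Tendsto (fun s => U t (U (s - t) f)) (𝓝 t) (𝓝 (U t f)) := by
      refine ((U t).continuous.tendsto f).comp ((hUc0 f).comp ?_)
      have : Continuous fun s : ℝ => s - t := by fun_prop
      simpa using this.tendsto t
    refine h1.congr fun s => ?_
    have := hUadd t (s - t)
    rw [add_sub_cancel] at this
    rw [this]
    rfl
  -- The identity $V_n(t)f=f+\int_0^tV_n(s)D_nf\,ds$ passes to the limit by dominated convergence,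
  -- and the limiting integrand is continuous.
  have hder : ∀ {f g}, (f, g) ∈ A.graph → HasDerivAt (fun t => U t f) (-(Complex.I • g)) 0 := by
    intro f g h
    have hint : ∀ t : ℝ, U t f = f + ∫ s in (0 : ℝ)..t, U s (-(Complex.I • g)) := by
      intro t
      have h1 : ∀ n, V n t f = f + ∫ s in (0 : ℝ)..t, V n s (D n f) := by
        intro n
        have hc : Continuous fun s => V n s (D n f) := by
          refine continuous_iff_continuousAt.2 fun s => ?_
          exact (hasDerivAt_exp_apply (D n) (D n f) s).continuousAt
        rw [intervalIntegral.integral_eq_sub_of_hasDerivAt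
          (fun s _ => hasDerivAt_exp_apply (D n) f s) (hc.intervalIntegrable _ _)]
        simp [hV]
      have h2 : Tendsto (fun n => ∫ s in (0 : ℝ)..t, V n s (D n f)) atTop
          (𝓝 (∫ s in (0 : ℝ)..t, U s (-(Complex.I • g)))) := by
        obtain ⟨C, hC⟩ := (hDlim h).norm.bddAbove_range
        refine intervalIntegral.tendsto_integral_filter_of_dominated_convergence (fun _ => C)
          (Eventually.of_forall fun n => ?_) (Eventually.of_forall fun n => ?_)
          intervalIntegrable_const (Eventually.of_forall fun s _ => ?_)
        · refine Continuous.aestronglyMeasurable (continuous_iff_continuousAt.2 fun s => ?_)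
          exact (hasDerivAt_exp_apply (D n) (D n f) s).continuousAt
        · refine Eventually.of_forall fun s _ => ?_
          rw [hVn]
          exact hC ⟨n, rfl⟩
        · exact hcomb s (hDlim h)
      exact tendsto_nhds_unique (hU t f) ((h2.const_add f).congr fun n => (h1 n).symm)
    have h3 := intervalIntegral.integral_hasDerivAt_right
      ((hUc (-(Complex.I • g))).intervalIntegrable 0 0)
      ((hUc (-(Complex.I • g))).stronglyMeasurableAtFilter _ _) (hUc (-(Complex.I • g))).continuousAt
    have h4 := h3.const_add f
    rw [hU0] at h4
    refine h4.congr_of_eventuallyEq (Eventually.of_forall fun t => hint t)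
  refine ⟨U, hU0, hUadd, fun t => Unitary.mem_iff.2 ?_, hUc, fun f g => ⟨hder, fun h => ?_⟩⟩
  · rw [hstar]
    exact ⟨hUinv t, hUinv' t⟩
  -- The generator is no larger than $-iA$. With $R_0=(A+1)^{-1}$, differentiating $\langle
  -- R_0k,U_tf\rangle=\langle U_{-t}R_0k,f\rangle$ at $0$ in both forms gives $\langle
  -- R_0k,g\rangle=\langle k-R_0k,f\rangle$ for all $k$. Hence $f=R_0(g+f)$ lies in the domain.
  · have h1 : ∀ k, inner ℂ k (R 0 (g + f)) = inner ℂ k f := by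
      intro k
      have hk := (hR 0).mem_graph k
      simp only [Nat.cast_zero, zero_add, Complex.ofReal_one, one_smul] at hk
      have d1 : HasDerivAt (fun t => inner ℂ (R 0 k) (U t f))
          (inner ℂ (R 0 k) (-(Complex.I • g))) 0 := by
        have := (hasDerivAt_const (0 : ℝ) (R 0 k)).inner ℂ h
        simpa using this
      have d2 : HasDerivAt (fun t : ℝ => U (-t) (R 0 k)) (Complex.I • (k - R 0 k)) 0 := by
        have h0 := hder hk
        rw [← neg_zero] at h0
        exact (h0.scomp (0 : ℝ) (hasDerivAt_neg (0 : ℝ))).congr_deriv (by simp)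
      have d3 : HasDerivAt (fun t => inner ℂ (U (-t) (R 0 k)) f)
          (inner ℂ (Complex.I • (k - R 0 k)) f) 0 := by
        have := d2.inner ℂ (hasDerivAt_const (0 : ℝ) f)
        simpa using this
      have e : (fun t => inner ℂ (U (-t) (R 0 k)) f) = fun t => inner ℂ (R 0 k) (U t f) := by
        funext t
        rw [← hstar, ContinuousLinearMap.star_eq_adjoint, ContinuousLinearMap.adjoint_inner_left]
      rw [e] at d3
      have h2 := d1.unique d3
      rw [inner_neg_right, inner_smul_right, inner_smul_left, Complex.conj_I, neg_mul, neg_inj] at h2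
      have h3 := mul_left_cancel₀ Complex.I_ne_zero h2
      rw [inner_sub_left, hA.inner_resolvent (hR 0)] at h3
      rw [map_add, inner_add_right, h3, ← hA.inner_resolvent (hR 0) k f, sub_add_cancel]
    have h2 : R 0 (g + f) = f := ext_inner_left ℂ h1
    have h3 := (hR 0).mem_graph (g + f)
    rw [h2] at h3
    simpa using h3

/-! ### Compactness of the resolvent -/

theorem norm_fderiv_apply_sq_le {φ : Plane → ℂ} (x t : Plane) :
    ‖fderiv ℝ φ x t‖ ^ 2 ≤ ‖t‖ ^ 2 * ∑ i, ‖pd i φ x‖ ^ 2 := by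
  have h1 : fderiv ℝ φ x t = ∑ i, t i • pd i φ x := by
    have : t = ∑ i, t i • EuclideanSpace.single i (1 : ℝ) := by
      have := (EuclideanSpace.basisFun (Fin 2) ℝ).sum_repr t
      simpa using this.symm
    conv_lhs => rw [this]
    simp [pd]
  rw [h1, EuclideanSpace.norm_sq_eq]
  have h2 : ‖∑ i, t i • pd i φ x‖ ≤ ∑ i, ‖t i‖ * ‖pd i φ x‖ :=
    (norm_sum_le _ _).trans (Finset.sum_le_sum fun i _ => (norm_smul _ _).le)
  calc ‖∑ i, t i • pd i φ x‖ ^ 2 ≤ (∑ i, ‖t i‖ * ‖pd i φ x‖) ^ 2 := by gcongr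
    _ ≤ _ := Finset.sum_mul_sq_le_sq_mul_sq _ _ _

/-- Write the difference as the integral of the derivative along the segment from $x$ to $x-t$,
apply Jensen in the segment parameter, and use translation invariance in $x$. -/
theorem lintegral_translate_sub_le {φ : Plane → ℂ} (hφ : IsTest φ) (t : Plane) :
    ∫⁻ x, ‖φ (x - t) - φ x‖ₑ ^ 2 ≤
      ENNReal.ofReal (‖t‖ ^ 2 * ∫ x, ∑ i, ‖pd i φ x‖ ^ 2) := by
  have hd := hφ.contDiff_two
  have hd1 : Differentiable ℝ φ := hd.differentiable (by norm_num)
  have hcf : Continuous (fderiv ℝ φ) := hd.continuous_fderiv (by norm_num)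
  have hpt : ∀ x, ‖φ (x - t) - φ x‖ₑ ^ 2 ≤
      ∫⁻ s in Ioc (0 : ℝ) 1, ‖fderiv ℝ φ (x - s • t) t‖ₑ ^ 2 := by
    intro x
    have hder : ∀ s : ℝ, HasDerivAt (fun s : ℝ => φ (x - s • t)) (-fderiv ℝ φ (x - s • t) t) s := by
      intro s
      have h1 : HasDerivAt (fun s : ℝ => x - s • t) (-t) s := by
        simpa using ((hasDerivAt_id s).smul_const t).const_sub x
      exact ((hd1 (x - s • t)).hasFDerivAt.comp_hasDerivAt s h1).congr_deriv (by simp)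
    have hc : Continuous fun s : ℝ => fderiv ℝ φ (x - s • t) t := by fun_prop
    have e : φ (x - t) - φ x = ∫ s in Ioc (0 : ℝ) 1, -fderiv ℝ φ (x - s • t) t := by
      rw [← intervalIntegral.integral_of_le zero_le_one,
        intervalIntegral.integral_eq_sub_of_hasDerivAt (fun s _ => hder s)
          (hc.neg.intervalIntegrable _ _)]
      simp
    have h2 := sq_lintegral_mul_le (μ := volume.restrict (Ioc (0 : ℝ) 1)) (r := fun _ => 1)
      (h := fun s => ‖fderiv ℝ φ (x - s • t) t‖ₑ) measurable_const hc.enorm.measurable (by simp)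
    simp only [one_mul] at h2
    refine le_trans ?_ h2
    gcongr
    rw [e]
    refine (enorm_integral_le_lintegral_enorm _).trans_eq ?_
    simp
  refine (lintegral_mono hpt).trans ?_
  have hint : Integrable fun x => ∑ i, ‖pd i φ x‖ ^ 2 := by
    refine integrable_finsetSum _ fun i _ => ?_
    have hci := (contDiff_pd (m := 0) hd (by norm_num) i).continuous
    refine Continuous.integrable_of_hasCompactSupport (by fun_prop)
      ((hasCompactSupport_pd hφ.compact i).mono fun x hx => ?_)
    contrapose! hx
    simp only [Function.mem_support, not_not] at hx ⊢
    simp [hx]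
  have hmeas : Measurable fun p : Plane × ℝ => ‖fderiv ℝ φ (p.1 - p.2 • t) t‖ₑ ^ 2 := by
    have : Continuous fun p : Plane × ℝ => fderiv ℝ φ (p.1 - p.2 • t) t := by fun_prop
    exact this.enorm.measurable.pow_const 2
  rw [lintegral_lintegral_swap hmeas.aemeasurable]
  have hs : ∀ s : ℝ, ∫⁻ x, ‖fderiv ℝ φ (x - s • t) t‖ₑ ^ 2 ≤
      ENNReal.ofReal (‖t‖ ^ 2 * ∫ x, ∑ i, ‖pd i φ x‖ ^ 2) := by
    intro s
    rw [lintegral_sub_right_eq_self (fun x => ‖fderiv ℝ φ x t‖ₑ ^ 2) (s • t),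
      ← integral_const_mul, ofReal_integral_eq_lintegral_ofReal (hint.const_mul _)
        (Eventually.of_forall fun x => by positivity)]
    refine lintegral_mono fun x => ?_
    rw [← ofReal_norm, ← ENNReal.ofReal_pow (norm_nonneg _)]
    exact ENNReal.ofReal_le_ofReal (norm_fderiv_apply_sq_le x t)
  refine (lintegral_mono hs).trans ?_
  simp

/-- Bounded Dirichlet energy makes the mollification error small uniformly in $\varphi$; this is the
Rellich part of the compactness argument. -/
theorem integral_mollify_sub_sq_le {φ : Plane → ℂ} (hφ : IsTest φ) {ρ : Plane → ℝ} {δ : ℝ}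
    (hρ : IsMollifier ρ δ) (hδ0 : 0 ≤ δ) :
    Integrable (fun x => ‖mollify ρ φ x - φ x‖ ^ 2) ∧ ∫ x, ‖mollify ρ φ x - φ x‖ ^ 2 ≤
      δ ^ 2 * ∫ x, ∑ i, ‖pd i φ x‖ ^ 2 := by
  have hφc := hφ.smooth.continuous
  have hml := memLp_of_test hφc hφ.compact
  have hfl : LocallyIntegrable φ (volume : Measure Plane) := hml.locallyIntegrable (by norm_num)
  have hmc : Continuous (mollify ρ φ) :=
    (contDiff_mollify hρ.smooth hρ.compact hfl).continuous
  set E := ∫ x, ∑ i, ‖pd i φ x‖ ^ 2 with hE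
  have hE0 : 0 ≤ E := integral_nonneg fun x => by positivity
  have h1 := eLpNorm_mollify_sub_le hρ.smooth.continuous hρ.compact hρ.nonneg hρ.integral
    hφc.stronglyMeasurable hml (κ := ENNReal.ofReal (δ * √E)) (fun t ht => by
      have hδ : ‖t‖ < δ := hρ.small t ht
      rw [← ENNReal.pow_le_pow_left_iff two_ne_zero, eLpNorm_two_sq]
      refine (lintegral_translate_sub_le hφ t).trans ?_
      rw [← ENNReal.ofReal_pow (mul_nonneg ((norm_nonneg t).trans hδ.le) (Real.sqrt_nonneg _))]
      refine ENNReal.ofReal_le_ofReal ?_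
      rw [mul_pow, Real.sq_sqrt hE0]
      gcongr)
  rw [← ENNReal.pow_le_pow_left_iff two_ne_zero, eLpNorm_two_sq] at h1
  have hsub : MemLp (fun x => mollify ρ φ x - φ x) 2 volume := by
    refine ⟨(hmc.sub hφc).aestronglyMeasurable, ?_⟩
    rw [← eLpNorm_two_sq, ENNReal.pow_le_pow_left_iff two_ne_zero] at h1
    exact h1.trans_lt ENNReal.ofReal_lt_top
  refine ⟨hsub.integrable_norm_pow (by norm_num), ?_⟩
  have hcm : Continuous fun x => ‖mollify ρ φ x - φ x‖ ^ 2 := by fun_prop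
  rw [integral_eq_lintegral_of_nonneg_ae (Eventually.of_forall fun x => by positivity)
    hcm.aestronglyMeasurable]
  refine ENNReal.toReal_le_of_le_ofReal (by positivity) ?_
  refine le_trans (le_of_eq (lintegral_congr fun x => ?_)) (h1.trans_eq ?_)
  · rw [ENNReal.ofReal_pow (norm_nonneg _), ofReal_norm]
  · rw [← ENNReal.ofReal_pow (by positivity), mul_pow, Real.sq_sqrt hE0]

/-- On a ball, mollification is controlled by finitely many coefficients up to a small error. -/
theorem exists_finiteDimensional_mollify {ρ : Plane → ℝ} {δ : ℝ} (hρ : IsMollifier ρ δ) (r : ℝ)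
    {κ : ℝ} (hκ : 0 < κ) : ∃ F : Submodule ℂ L2, ∃ _ : FiniteDimensional ℂ F, ∃ C : ℝ, 0 ≤ C ∧
      ∀ (f : L2) (φ : Plane → ℂ), f =ᵐ[volume] φ → ∀ x, ‖x‖ ≤ r →
        ‖mollify ρ φ x‖ ≤ C * ‖F.starProjection f‖ + κ * ‖f‖ := by
  have hml : MemLp (fun t => (ρ t : ℂ)) 2 (volume : Measure Plane) :=
    memLp_of_test (Complex.continuous_ofReal.comp hρ.smooth.continuous)
      (hρ.compact.comp_left (g := fun r : ℝ => (r : ℂ)) Complex.ofReal_zero)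
  let g : Plane → C(Plane, Plane) := fun x => ⟨fun t => x - t, continuous_const.sub continuous_id⟩
  have hg : Continuous g :=
    ContinuousMap.continuous_of_continuous_uncurry _ (continuous_fst.sub continuous_snd)
  have hm : ∀ x, MeasurePreserving (g x) (volume : Measure Plane) volume := fun x =>
    Measure.measurePreserving_sub_left volume x
  -- $(\rho*f)(x)=\langle K_x,f\rangle$ with $K_x=\rho(x-\cdot)$ continuous in $x$. The kernels over
  -- a ball form a compact set, and $F$ is the span of a finite $\kappa$-net of it.
  let K : Plane → L2 := fun x => Lp.compMeasurePreserving (g x) (hm x) (hml.toLp _)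
  have hK : Continuous K := continuous_const.compMeasurePreservingLp hg hm (by norm_num)
  have hKf : ∀ (f : L2) (φ : Plane → ℂ), f =ᵐ[volume] φ → ∀ x,
      inner ℂ (K x) f = mollify ρ φ x := by
    intro f φ hf x
    have h1 : K x =ᵐ[volume] fun t => (ρ (x - t) : ℂ) := by
      refine (Lp.coeFn_compMeasurePreserving _ (hm x)).trans ?_
      exact (hm x).quasiMeasurePreserving.ae_eq_comp hml.coeFn_toLp
    rw [inner_eq_integral h1 hf]
    refine integral_congr_ae (Eventually.of_forall fun t => ?_)
    simp only [Complex.conj_ofReal, Complex.real_smul]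
  have hcomp : IsCompact (K '' Metric.closedBall 0 r) := (isCompact_closedBall 0 r).image hK
  obtain ⟨s, hs, hcov⟩ := Metric.totallyBounded_iff.1 hcomp.totallyBounded κ hκ
  obtain ⟨C, hC⟩ := hcomp.isBounded.exists_norm_le
  have hfin : FiniteDimensional ℂ (Submodule.span ℂ s) := FiniteDimensional.span_of_finite ℂ hs
  refine ⟨Submodule.span ℂ s, hfin, max C 0, le_max_right _ _, fun f φ hf x hx => ?_⟩
  have hmem : K x ∈ K '' Metric.closedBall 0 r := ⟨x, by simpa using hx, rfl⟩
  obtain ⟨y, hy, hxy⟩ := mem_iUnion₂.1 (hcov hmem)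
  set P := (Submodule.span ℂ s).starProjection
  have hyP : inner ℂ y (f - P f) = 0 := by
    have := (Submodule.span ℂ s).sub_starProjection_mem_orthogonal f
    exact (Submodule.mem_orthogonal _ _).1 this y (Submodule.subset_span hy)
  -- A net point $y\in F$ may be subtracted for free, since it is orthogonal to $f-Pf$.
  have e : mollify ρ φ x = inner ℂ (K x) (P f) + inner ℂ (K x - y) (f - P f) := by
    rw [inner_sub_left, hyP, sub_zero, ← inner_add_right, add_sub_cancel, hKf f φ hf]
  have hfP : ‖f - P f‖ ≤ ‖f‖ := by
    have h1 : f - P f = (Submodule.span ℂ s)ᗮ.starProjection f := by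
      rw [Submodule.starProjection_orthogonal_val]
    rw [h1]
    exact Submodule.norm_starProjection_apply_le _ _
  rw [e]
  refine (norm_add_le _ _).trans (add_le_add ?_ ?_)
  · refine (norm_inner_le_norm _ _).trans ?_
    gcongr
    exact (hC _ hmem).trans (le_max_left _ _)
  · refine (norm_inner_le_norm _ _).trans ?_
    gcongr
    rw [← dist_eq_norm]
    exact (Metric.mem_ball.1 hxy).le

/-- Inside the ball $|\varphi|^2\le2|\psi-\varphi|^2+2D^2$; outside it $W\ge\kappa^{-1}$ gives
$|\varphi|^2\le\kappa W|\varphi|^2$. -/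
theorem integral_sq_le_of_mollify {W : Plane → ℝ} (h0 : ∀ x, 0 ≤ W x) {r κ D : ℝ} (hκ : 0 < κ)
    (hr : ∀ x, r ≤ ‖x‖ → κ⁻¹ ≤ W x) {φ ψ : Plane → ℂ}
    (hW : Integrable fun x => W x * ‖φ x‖ ^ 2) (hψ : Integrable fun x => ‖ψ x - φ x‖ ^ 2)
    (hD : ∀ x, ‖x‖ ≤ r → ‖ψ x‖ ≤ D) :
    ∫ x, ‖φ x‖ ^ 2 ≤ 2 * (∫ x, ‖ψ x - φ x‖ ^ 2) +
      volume.real (Metric.closedBall (0 : Plane) r) * (2 * D ^ 2) +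
      κ * ∫ x, W x * ‖φ x‖ ^ 2 := by
  set B := Metric.closedBall (0 : Plane) r with hB
  have hBm : MeasurableSet B := Metric.isClosed_closedBall.measurableSet
  have hind : Integrable (B.indicator fun _ => 2 * D ^ 2) :=
    (integrable_indicator_iff hBm).2 (integrableOn_const (measure_closedBall_lt_top.ne))
  have i1 : Integrable fun x => 2 * ‖ψ x - φ x‖ ^ 2 := hψ.const_mul 2
  have i2 : Integrable fun x => κ * (W x * ‖φ x‖ ^ 2) := hW.const_mul κ
  have i3 : Integrable fun x => 2 * ‖ψ x - φ x‖ ^ 2 + B.indicator (fun _ => 2 * D ^ 2) x :=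
    i1.add hind
  have i4 : Integrable fun x => 2 * ‖ψ x - φ x‖ ^ 2 + B.indicator (fun _ => 2 * D ^ 2) x +
    κ * (W x * ‖φ x‖ ^ 2) := i3.add i2
  have hpt : ∀ x, ‖φ x‖ ^ 2 ≤ 2 * ‖ψ x - φ x‖ ^ 2 + B.indicator (fun _ => 2 * D ^ 2) x +
      κ * (W x * ‖φ x‖ ^ 2) := by
    intro x
    have hW0 := h0 x
    by_cases hx : x ∈ B
    · rw [indicator_of_mem hx]
      have h1 := hD x (by simpa [hB] using hx)
      have h2 : ‖φ x‖ ≤ ‖ψ x - φ x‖ + ‖ψ x‖ := by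
        have := norm_sub_le (ψ x) (ψ x - φ x)
        rw [sub_sub_cancel] at this
        linarith
      have h3 : ‖φ x‖ ≤ ‖ψ x - φ x‖ + D := h2.trans (by gcongr)
      have h4 : ‖φ x‖ ^ 2 ≤ (‖ψ x - φ x‖ + D) ^ 2 := by gcongr
      have h5 : 0 ≤ κ * (W x * ‖φ x‖ ^ 2) := by positivity
      nlinarith [sq_nonneg (‖ψ x - φ x‖ - D)]
    · rw [indicator_of_notMem hx]
      have h1 : κ⁻¹ ≤ W x := hr x (by
        have : r < ‖x‖ := by simpa [hB] using hx
        exact this.le)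
      have h2 : 1 ≤ κ * W x := by
        rwa [inv_le_iff_one_le_mul₀' hκ] at h1
      have h3 : 0 ≤ ‖ψ x - φ x‖ ^ 2 := by positivity
      have h4 : 0 ≤ ‖φ x‖ ^ 2 := by positivity
      nlinarith
  refine (integral_mono_of_nonneg (Eventually.of_forall fun x => sq_nonneg _) i4
    (Eventually.of_forall hpt)).trans_eq ?_
  rw [integral_add i3 i2, integral_add i1 hind, integral_const_mul, integral_const_mul,
    integral_indicator hBm, setIntegral_const, smul_eq_mul]

theorem exists_finiteDimensional_form_core {W : Plane → ℝ} (hW : PolyBdd W) (h0 : ∀ x, 0 ≤ W x)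
    (hg : ∀ L : ℝ, ∃ r : ℝ, ∀ x, r ≤ ‖x‖ → L ≤ W x) {κ : ℝ} (hκ : 0 < κ) :
    ∃ F : Submodule ℂ L2, ∃ _ : FiniteDimensional ℂ F, ∃ C : ℝ,
      ∀ q ∈ coreGraph W, ‖q.1‖ ^ 2 ≤
        κ * (inner ℂ q.1 q.2).re + κ * ‖q.1‖ ^ 2 + C * ‖F.starProjection q.1‖ ^ 2 := by
  obtain ⟨r, hr⟩ := hg κ⁻¹
  obtain ⟨b, hb⟩ : ∃ b, b = volume.real (Metric.closedBall (0 : Plane) r) := ⟨_, rfl⟩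
  have hb0 : 0 ≤ b := hb ▸ measureReal_nonneg
  have hκ2 : 0 ≤ κ / 2 := by positivity
  have hκb : 0 < κ / (4 * b + 1) := by positivity
  -- With $\delta^2=\kappa/2$, twice the mollification error is at most $\kappa$ times the Dirichlet
  -- energy. The net error $\sqrt{\kappa/(4b+1)}$, with $b$ the volume of the ball, makes its
  -- contribution $4bq^2$ at most $\kappa\|f\|^2$.
  obtain ⟨ρ, hρ⟩ := exists_mollifier (δ := √(κ / 2)) (by positivity)
  obtain ⟨F, hF, C, hC0, hFC⟩ := exists_finiteDimensional_mollify hρ r (Real.sqrt_pos.2 hκb)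
  refine ⟨F, hF, 4 * b * C ^ 2, ?_⟩
  rintro ⟨f, g⟩ ⟨φ, s, c, hf, hg⟩
  have t : IsTest φ := ⟨s, c⟩
  simp only at hf hg ⊢
  obtain ⟨hWi, hre⟩ := re_inner_core t hf hg hW
  obtain ⟨hmi, hmle⟩ := integral_mollify_sub_sq_le t hρ (Real.sqrt_nonneg _)
  have hE : ∫ x, inner ℝ (φ x) (-(Δ φ) x) = ∫ x, ∑ i, ‖pd i φ x‖ ^ 2 := by
    rw [integral_inner_laplacian (s.of_le (by norm_num)) t.contDiff_two c]
    simp_rw [real_inner_self_eq_norm_sq]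
  rw [Real.sq_sqrt hκ2, ← hE] at hmle
  have hmain := integral_sq_le_of_mollify h0 hκ hr hWi hmi (hFC f φ hf)
  rw [← hb, ← norm_sq_eq_integral hf] at hmain
  have hqs : (√(κ / (4 * b + 1)) * ‖f‖) ^ 2 = κ / (4 * b + 1) * ‖f‖ ^ 2 := by
    rw [mul_pow, Real.sq_sqrt hκb.le]
  generalize √(κ / (4 * b + 1)) * ‖f‖ = q at hqs hmain
  generalize ‖F.starProjection f‖ = p at hmain ⊢
  have hDsq : (C * p + q) ^ 2 ≤ 2 * (C * p) ^ 2 + 2 * q ^ 2 := by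
    nlinarith [sq_nonneg (C * p - q)]
  have hfin : b * (4 * q ^ 2) ≤ κ * ‖f‖ ^ 2 := by
    have : b * (4 * q ^ 2) = (4 * b / (4 * b + 1)) * (κ * ‖f‖ ^ 2) := by
      rw [hqs]
      ring
    rw [this]
    refine mul_le_of_le_one_left (by positivity) ?_
    rw [div_le_one (by positivity)]
    linarith
  have hbD := mul_le_mul_of_nonneg_left hDsq hb0
  rw [hre]
  linarith

/-- Local compactness: the form domain of a Schrödinger operator with a growing potential is
controlled by finitely many coefficients up to a small error. -/
theorem exists_finiteDimensional_form {W : Plane → ℝ} (hW : PolyBdd W) (h0 : ∀ x, 0 ≤ W x)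
    (hg : ∀ L : ℝ, ∃ r : ℝ, ∀ x, r ≤ ‖x‖ → L ≤ W x) {κ : ℝ} (hκ : 0 < κ) :
    ∃ F : Submodule ℂ L2, ∃ _ : FiniteDimensional ℂ F, ∃ C : ℝ,
      ∀ q ∈ (schrodinger W).graph, ‖q.1‖ ^ 2 ≤
        κ * (inner ℂ q.1 q.2).re + κ * ‖q.1‖ ^ 2 + C * ‖F.starProjection q.1‖ ^ 2 := by
  obtain ⟨F, hF, C, hC⟩ := exists_finiteDimensional_form_core hW h0 hg hκ
  refine ⟨F, hF, C, fun q hq => ?_⟩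
  have hcl : IsClosed {q : L2 × L2 | ‖q.1‖ ^ 2 ≤
      κ * (inner ℂ q.1 q.2).re + κ * ‖q.1‖ ^ 2 + C * ‖F.starProjection q.1‖ ^ 2} :=
    isClosed_le (by fun_prop) (by fun_prop)
  exact schrodinger_graph_induction hW hcl hC hq

/-- A bounded self-adjoint operator which is small off finite dimensional spaces is compact. -/
theorem isCompactOperator_of_small {R : L2 →L[ℂ] L2}
    (hR : ∀ f g, inner ℂ (R f) g = inner ℂ f (R g))
    (h : ∀ κ > 0, ∃ F : Submodule ℂ L2, ∃ _ : FiniteDimensional ℂ F,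
      ∀ k, F.starProjection (R k) = 0 → ‖R k‖ ≤ κ * ‖k‖) : IsCompactOperator R := by
  choose F hF hFs using fun n : ℕ => h (1 / ((n : ℝ) + 1)) (by positivity)
  have hfd : ∀ n, FiniteDimensional ℂ ((F n).map (R : L2 →ₗ[ℂ] L2)) := fun n => inferInstance
  -- If $k\perp R(F_n)$ then $Rk\perp F_n$ by symmetry, and the smallness hypothesis applies. So
  -- these finite rank operators approximate $R$ in norm within $1/(n+1)$.
  let T : ℕ → L2 →L[ℂ] L2 := fun n => R ∘L ((F n).map (R : L2 →ₗ[ℂ] L2)).starProjection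
  have hT : ∀ n, IsCompactOperator (T n) := fun n => by
    have h1 : IsCompactOperator (R ∘L ((F n).map (R : L2 →ₗ[ℂ] L2)).subtypeL) := by
      have := FiniteDimensional.proper ℂ ((F n).map (R : L2 →ₗ[ℂ] L2))
      have : LocallyCompactSpace ((F n).map (R : L2 →ₗ[ℂ] L2)) := inferInstance
      exact isCompactOperator_of_locallyCompactSpace_rng _
    exact h1.comp_clm ((F n).map (R : L2 →ₗ[ℂ] L2)).orthogonalProjectionOnto
  refine isCompactOperator_of_tendsto (l := atTop) (F := T) ?_ (Eventually.of_forall hT)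
  rw [tendsto_iff_norm_sub_tendsto_zero]
  refine squeeze_zero (fun n => norm_nonneg _) (fun n => ?_) tendsto_one_div_add_atTop_nhds_zero_nat
  refine ContinuousLinearMap.opNorm_le_bound _ (by positivity) fun k => ?_
  set M := (F n).map (R : L2 →ₗ[ℂ] L2)
  have e : (T n - R) k = -R (k - M.starProjection k) := by
    rw [map_sub, neg_sub]
    rfl
  have hz : (F n).starProjection (R (k - M.starProjection k)) = 0 := by
    rw [Submodule.starProjection_apply_eq_zero_iff, Submodule.mem_orthogonal]
    intro u hu
    rw [← hR]
    exact (Submodule.mem_orthogonal _ _).1 (M.sub_starProjection_mem_orthogonal k) _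
      (Submodule.mem_map_of_mem hu)
  rw [e, norm_neg]
  refine (hFs n _ hz).trans ?_
  gcongr
  have h1 : k - M.starProjection k = Mᗮ.starProjection k := by
    rw [Submodule.starProjection_orthogonal_val]
  rw [h1]
  exact Submodule.norm_starProjection_apply_le _ _

/-- If the finite dimensional component of $Rk$ vanishes, the form bound reads
$\|Rk\|^2\le\frac{\kappa^2}2\mathrm{Re}\langle Rk,k\rangle\le\frac{\kappa^2}2\|k\|^2$. This is the
smallness required by `isCompactOperator_of_small`. -/
theorem isCompactOperator_resolvent {W : Plane → ℝ} (hW : PolyBdd W) (h0 : ∀ x, 0 ≤ W x)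
    (hg : ∀ L : ℝ, ∃ r : ℝ, ∀ x, r ≤ ‖x‖ → L ≤ W x) {R : L2 →L[ℂ] L2}
    (hR : IsResolventAt (schrodinger W) (-((1 : ℝ) : ℂ)) R) : IsCompactOperator R := by
  have hA := posSA_schrodinger hW h0
  refine isCompactOperator_of_small (hA.inner_resolvent hR) fun κ hκ => ?_
  obtain ⟨F, hF, C, hFC⟩ := exists_finiteDimensional_form hW h0 hg (κ := κ ^ 2 / 2) (by positivity)
  refine ⟨F, hF, fun k hk => ?_⟩
  have hmem := hR.mem_graph k
  have h1 := hFC _ hmem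
  simp only at h1
  rw [hk, norm_zero, Complex.ofReal_one, one_smul] at h1
  have hle : ‖R k‖ ≤ ‖k‖ := by
    have := hA.norm_resolvent_le hR k
    rwa [one_mul] at this
  have h2 : (inner ℂ (R k) (k - R k)).re + ‖R k‖ ^ 2 ≤ ‖k‖ ^ 2 := by
    have h3 : (inner ℂ (R k) (k - R k)).re + ‖R k‖ ^ 2 = (inner ℂ (R k) k).re := by
      rw [inner_sub_right, Complex.sub_re]
      have : (inner ℂ (R k) (R k)).re = ‖R k‖ ^ 2 := inner_self_eq_norm_sq (𝕜 := ℂ) _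
      rw [this, sub_add_cancel]
    rw [h3]
    refine (Complex.re_le_norm _).trans ((norm_inner_le_norm _ _).trans ?_)
    rw [pow_two]
    gcongr
  refine (pow_le_pow_iff_left₀ (norm_nonneg _) (by positivity) two_ne_zero).1 ?_
  rw [mul_pow]
  nlinarith

/-! ### Isolated simple eigenvalues of operators with compact resolvent -/

section Spectral

variable {A : L2 →ₗ.[ℂ] L2} {R : L2 →L[ℂ] L2}

theorem IsResolventAt.unique {z : ℂ} {X Y : L2 →L[ℂ] L2} (hX : IsResolventAt A z X)
    (hY : IsResolventAt A z Y) : X = Y := by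
  ext1 f
  have := hY.2 _ _ (hX.1 f)
  rw [add_sub_cancel_right] at this
  exact this.symm

theorem presolvent_eq {z : ℂ} {X : L2 →L[ℂ] L2} (hX : IsResolventAt A z X) : presolvent A z = X :=
  (Classical.epsilon_spec (p := IsResolventAt A z) ⟨X, hX⟩).unique hX

/-- The graph of `A` in terms of `(A + 1)⁻¹`. -/
theorem IsResolventAt.mem_graph_iff (hR : IsResolventAt A (-((1 : ℝ) : ℂ)) R) {f g : L2} :
    (f, g) ∈ A.graph ↔ R (g + f) = f := by
  constructor
  · intro h
    have := hR.apply_add h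
    rwa [Complex.ofReal_one, one_smul] at this
  · intro h
    have := hR.mem_graph (g + f)
    rwa [h, Complex.ofReal_one, one_smul, add_sub_cancel_right] at this

/-- Reduces statements about $(A-z)^{-1}$ to identities between bounded operators, so that spectral
theory of $A$ becomes algebra with the compact operator $R$. -/
theorem isResolventAt_iff (hR : IsResolventAt A (-((1 : ℝ) : ℂ)) R) {z : ℂ} {X : L2 →L[ℂ] L2} :
    IsResolventAt A z X ↔ R * (1 + (z + 1) • X) = X ∧ X * (1 - (z + 1) • R) = R := by
  constructor
  · rintro ⟨h1, h2⟩
    constructor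
    · ext1 f
      have := hR.mem_graph_iff.1 (h1 f)
      rw [← this]
      simp only [mul_apply_eq_comp, add_apply,
        one_apply_eq_self, smul_apply, add_smul, one_smul, add_assoc]
    · ext1 f
      have := h2 _ _ (hR.mem_graph f)
      rw [← this]
      simp only [mul_apply_eq_comp, sub_apply,
        one_apply_eq_self, smul_apply, add_apply, add_smul, one_smul,
        Complex.ofReal_one]
      congr 1
      abel
  · rintro ⟨h1, h2⟩
    constructor
    · intro f
      rw [hR.mem_graph_iff]
      have := DFunLike.congr_fun h1 f
      simp only [mul_apply_eq_comp, add_apply, one_apply_eq_self, smul_apply, add_smul, one_smul,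
        ← add_assoc] at this
      exact this
    · intro f g hfg
      have h3 := hR.mem_graph_iff.1 hfg
      have := DFunLike.congr_fun h2 (g + f)
      simp only [mul_apply_eq_comp, sub_apply,
        one_apply_eq_self, smul_apply, h3] at this
      nth_rw 2 [← this]
      rw [add_smul, one_smul]
      congr 1
      abel

theorem mem_graph_of_apply_eq_smul (hR : IsResolventAt A (-((1 : ℝ) : ℂ)) R) {f : L2} {z : ℂ}
    (h : (z + 1) • R f = f) : (f, z • f) ∈ A.graph := by
  rw [hR.mem_graph_iff]
  nth_rw 2 [← one_smul ℂ f]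
  rw [← add_smul, map_smul, h]

/-- Indicators of two disjoint balls span a plane, which contains a nonzero vector orthogonal to
$\chi$. This is what makes the spectrum away from $\lambda$ nonempty; otherwise `Metric.infDist`
would take its default value $0$ and the contour would degenerate. -/
theorem exists_orthogonal_ne_zero (χ : L2) : ∃ f : L2, f ≠ 0 ∧ inner ℂ χ f = 0 := by
  have hdim : ∃ u v : L2, u ≠ 0 ∧ v ≠ 0 ∧ inner ℂ u v = 0 := by
    have ne : ∀ (c : Plane), indicatorConstLp 2 (μ := (volume : Measure Plane))
        (measurableSet_ball (x := c) (ε := 1)) measure_ball_lt_top.ne (1 : ℂ) ≠ 0 := by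
      intro c h
      have h1 := norm_indicatorConstLp (μ := (volume : Measure Plane)) (p := 2)
        (hs := measurableSet_ball (x := c) (ε := 1)) (hμs := measure_ball_lt_top.ne) (c := (1 : ℂ))
        two_ne_zero ENNReal.ofNat_ne_top
      rw [h, norm_zero, norm_one, one_mul] at h1
      have h2 : 0 < (volume : Measure Plane).real (Metric.ball c 1) :=
        ENNReal.toReal_pos (Metric.measure_ball_pos _ _ one_pos).ne' measure_ball_lt_top.ne
      exact (Real.rpow_pos_of_pos h2 _).ne h1
    refine ⟨_, _, ne 0, ne (EuclideanSpace.single 0 3), ?_⟩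
    have hd : Metric.ball (0 : Plane) 1 ∩ Metric.ball (EuclideanSpace.single 0 3) 1 = ∅ := by
      rw [← disjoint_iff_inter_eq_empty]
      refine Metric.ball_disjoint_ball ?_
      rw [dist_zero_left, PiLp.norm_single]
      norm_num
    rw [L2.inner_indicatorConstLp_indicatorConstLp, hd]
    simp
  obtain ⟨u, v, hu, hv, huv⟩ := hdim
  rcases eq_or_ne (inner ℂ χ u : ℂ) 0 with h | h
  · exact ⟨u, hu, h⟩
  · refine ⟨(inner ℂ χ u : ℂ) • v - (inner ℂ χ v : ℂ) • u, fun h0 => ?_, ?_⟩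
    · have h1 := congrArg (inner ℂ v) h0
      rw [inner_sub_right, inner_smul_right, inner_smul_right, inner_zero_right,
        inner_eq_zero_symm.1 huv, mul_zero, sub_zero, mul_eq_zero] at h1
      exact h1.elim h fun h2 => hv (inner_self_eq_zero.1 h2)
    · rw [inner_sub_right, inner_smul_right, inner_smul_right, mul_comm, sub_self]

/-- A self-adjoint operator with compact resolvent and a simple eigenvalue. -/
structure SimpleEigen (A : L2 →ₗ.[ℂ] L2) (R : L2 →L[ℂ] L2) (lam : ℝ) (χ : L2) : Prop where
  posSA : PosSA A
  res : IsResolventAt A (-((1 : ℝ) : ℂ)) R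
  compact : IsCompactOperator R
  norm_eq : ‖χ‖ = 1
  mem : (χ, (lam : ℂ) • χ) ∈ A.graph
  simple : ∀ f, (f, (lam : ℂ) • f) ∈ A.graph → ∃ c : ℂ, f = c • χ
  proj : ∀ f, eigenProj A lam f = (inner ℂ χ f : ℂ) • χ

theorem exists_simpleEigen (hA : PosSA A) (hR : IsResolventAt A (-((1 : ℝ) : ℂ)) R)
    (hK : IsCompactOperator R) {lam : ℝ} (hfin : Module.finrank ℂ (eigenspace A lam) = 1) :
    ∃ χ, SimpleEigen A R lam χ := by
  obtain ⟨v, hv0, hv⟩ := finrank_eq_one_iff'.1 hfin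
  have hn : ‖(v : L2)‖ ≠ 0 := by simpa using hv0
  have hspan : eigenspace A lam = ℂ ∙ ((‖(v : L2)‖⁻¹ : ℂ) • (v : L2)) := by
    apply le_antisymm
    · intro w hw
      obtain ⟨c, hc⟩ := hv ⟨w, hw⟩
      rw [Submodule.mem_span_singleton]
      refine ⟨c * ‖(v : L2)‖, ?_⟩
      have hc' : c • (v : L2) = w := congrArg Subtype.val hc
      rw [smul_smul, mul_assoc, mul_inv_cancel₀ (by exact_mod_cast hn), mul_one, hc']
    · rw [Submodule.span_singleton_le_iff_mem]
      exact Submodule.smul_mem _ _ v.2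
  have hnorm : ‖(‖(v : L2)‖⁻¹ : ℂ) • (v : L2)‖ = 1 := by
    rw [norm_smul, norm_inv, Complex.norm_real, norm_norm, inv_mul_cancel₀ hn]
  generalize (‖(v : L2)‖⁻¹ : ℂ) • (v : L2) = χ at hspan hnorm
  refine ⟨χ, hA, hR, hK, hnorm, ?_, fun f hf => ?_, fun f => ?_⟩
  · exact mem_eigenspace.1 (hspan ▸ Submodule.mem_span_singleton_self χ)
  · have : f ∈ eigenspace A lam := mem_eigenspace.2 hf
    rw [hspan, Submodule.mem_span_singleton] at this
    obtain ⟨c, hc⟩ := this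
    exact ⟨c, hc.symm⟩
  · unfold eigenProj
    have : (eigenspace A lam).topologicalClosure = ℂ ∙ χ := by
      rw [hspan]
      exact (Submodule.closed_of_finiteDimensional _).submodule_topologicalClosure_eq
    simp only [this]
    exact Submodule.starProjection_unit_singleton ℂ hnorm f

variable {lam : ℝ} {χ : L2}

namespace SimpleEigen

theorem lam_nonneg (h : SimpleEigen A R lam χ) : 0 ≤ lam := by
  have := h.posSA.nonneg h.mem
  rw [inner_smul_right, inner_self_eq_norm_sq_to_K, h.norm_eq] at this
  simpa using this

theorem lam_add_one_ne (h : SimpleEigen A R lam χ) : ((lam : ℂ) + 1) ≠ 0 := by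
  have := h.lam_nonneg
  exact_mod_cast (by positivity : lam + 1 ≠ 0)

theorem res_apply (h : SimpleEigen A R lam χ) : R χ = ((lam : ℂ) + 1)⁻¹ • χ := by
  have := h.res.mem_graph_iff.1 h.mem
  nth_rw 2 [← one_smul ℂ χ] at this
  rw [← add_smul, map_smul] at this
  rw [eq_inv_smul_iff₀ h.lam_add_one_ne, this]

theorem inner_self (h : SimpleEigen A R lam χ) : inner ℂ χ χ = (1 : ℂ) := by
  rw [inner_self_eq_norm_sq_to_K, h.norm_eq]
  simp

/-- The part of the resolvent on the orthogonal complement of the eigenspace. -/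
def rest (A : L2 →ₗ.[ℂ] L2) (R : L2 →L[ℂ] L2) (lam : ℝ) : L2 →L[ℂ] L2 :=
  R - ((lam : ℂ) + 1)⁻¹ • eigenProj A lam

theorem proj_mul_proj (h : SimpleEigen A R lam χ) :
    eigenProj A lam * eigenProj A lam = eigenProj A lam := by
  ext1 f
  simp only [mul_apply_eq_comp, h.proj, inner_smul_right, h.inner_self, mul_one]

theorem res_mul_proj (h : SimpleEigen A R lam χ) :
    R * eigenProj A lam = ((lam : ℂ) + 1)⁻¹ • eigenProj A lam := by
  ext1 f
  simp only [mul_apply_eq_comp, h.proj, map_smul, h.res_apply,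
    smul_apply]
  rw [smul_comm]

theorem inner_res (h : SimpleEigen A R lam χ) (f g : L2) : inner ℂ (R f) g = inner ℂ f (R g) :=
  h.posSA.inner_resolvent h.res f g

theorem proj_mul_res (h : SimpleEigen A R lam χ) :
    eigenProj A lam * R = ((lam : ℂ) + 1)⁻¹ • eigenProj A lam := by
  ext1 f
  simp only [mul_apply_eq_comp, h.proj, smul_apply]
  rw [← h.inner_res, h.res_apply, inner_smul_left, smul_smul]
  congr 2
  rw [map_inv₀, map_add, Complex.conj_ofReal, map_one]

theorem inner_proj (h : SimpleEigen A R lam χ) (f g : L2) :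
    inner ℂ (eigenProj A lam f) g = inner ℂ f (eigenProj A lam g) := by
  rw [h.proj, h.proj, inner_smul_left, inner_smul_right, inner_conj_symm, mul_comm]

theorem rest_mul_proj (h : SimpleEigen A R lam χ) : rest A R lam * eigenProj A lam = 0 := by
  rw [rest, sub_mul, h.res_mul_proj, smul_mul_assoc, h.proj_mul_proj, sub_self]

theorem proj_mul_rest (h : SimpleEigen A R lam χ) : eigenProj A lam * rest A R lam = 0 := by
  rw [rest, mul_sub, h.proj_mul_res, mul_smul_comm, h.proj_mul_proj, sub_self]

theorem inner_rest (h : SimpleEigen A R lam χ) (f g : L2) :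
    inner ℂ (rest A R lam f) g = inner ℂ f (rest A R lam g) := by
  simp only [rest, sub_apply, smul_apply, inner_sub_left,
    inner_sub_right, inner_smul_left, inner_smul_right, h.inner_res, h.inner_proj]
  rw [map_inv₀, map_add, Complex.conj_ofReal, map_one]

theorem isCompactOperator_rest (h : SimpleEigen A R lam χ) : IsCompactOperator (rest A R lam) := by
  have h1 : rest A R lam = R ∘L (1 - eigenProj A lam) := by
    have : R ∘L (1 - eigenProj A lam) = R * (1 - eigenProj A lam) := rfl
    rw [this, mul_sub, h.res_mul_proj, mul_one, rest]
  rw [h1]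
  exact h.compact.comp_clm _

/-- The projection annihilates the range of `rest`, so such an eigenvector is orthogonal to $\chi$,
where `rest` and $R$ agree. -/
theorem res_apply_of_rest (h : SimpleEigen A R lam χ) {f : L2} {c : ℂ} (hc : c ≠ 0)
    (hf : rest A R lam f = c • f) : eigenProj A lam f = 0 ∧ R f = c • f := by
  have h0 : eigenProj A lam f = 0 := by
    have := DFunLike.congr_fun h.proj_mul_rest f
    rw [mul_apply_eq_comp, hf, map_smul, zero_apply] at this
    exact (smul_eq_zero.1 this).resolve_left hc
  refine ⟨h0, ?_⟩
  rw [← hf, rest, sub_apply, smul_apply, h0, smul_zero,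
    sub_zero]

/-- Fredholm alternative for the compact operator `rest`: failure of invertibility produces an
eigenvector with eigenvalue $(z+1)^{-1}$. It is orthogonal to $\chi$ and is an eigenvector of $A$ at
$z$, contradicting the hypothesis. -/
theorem isUnit_one_sub (h : SimpleEigen A R lam χ) {z : ℂ}
    (hz : ∀ f, (f, z • f) ∈ A.graph → eigenProj A lam f = f) :
    IsUnit (1 - (z + 1) • rest A R lam) := by
  rcases eq_or_ne (z + 1) 0 with h0 | h0
  · rw [h0, zero_smul, sub_zero]
    exact isUnit_one
  have key := h.isCompactOperator_rest.hasEigenvalue_or_mem_resolventSet (inv_ne_zero h0)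
  rcases key with he | hr
  · exfalso
    obtain ⟨f, hf⟩ := he.exists_hasEigenvector
    have hf1 : rest A R lam f = (z + 1)⁻¹ • f := hf.apply_eq_smul
    obtain ⟨h1, h2⟩ := h.res_apply_of_rest (inv_ne_zero h0) hf1
    have h3 := hz f (mem_graph_of_apply_eq_smul h.res (by rw [h2, smul_inv_smul₀ h0]))
    exact hf.2 (by rw [← h3, h1])
  · rw [spectrum.mem_resolventSet_iff] at hr
    have e : (1 : L2 →L[ℂ] L2) - (z + 1) • rest A R lam =
        (Units.mk0 (z + 1) h0) • (algebraMap ℂ (L2 →L[ℂ] L2) (z + 1)⁻¹ - rest A R lam) := by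
      rw [Units.smul_def, Units.val_mk0, smul_sub, Algebra.algebraMap_eq_smul_one, smul_smul,
        mul_inv_cancel₀ h0, one_smul]
    rw [e]
    exact hr.smul _

theorem isUnit_one_sub_self (h : SimpleEigen A R lam χ) :
    IsUnit (1 - ((lam : ℂ) + 1) • rest A R lam) := by
  refine h.isUnit_one_sub fun f hf => ?_
  obtain ⟨c, rfl⟩ := h.simple f hf
  rw [map_smul, h.proj, h.inner_self, one_smul]

theorem isUnit_one_sub_of_notMem (h : SimpleEigen A R lam χ) {z : ℂ} (hz : z ∉ pspectrum A) :
    IsUnit (1 - (z + 1) • rest A R lam) := by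
  refine h.isUnit_one_sub fun f hf => ?_
  obtain ⟨X, hX⟩ := not_not.1 hz
  have := hX.2 _ _ hf
  rw [sub_self, map_zero] at this
  rw [← this, map_zero]

/-- The regular part `(A - z)⁻¹ (1 - P)` of the resolvent. -/
def regular (A : L2 →ₗ.[ℂ] L2) (R : L2 →L[ℂ] L2) (lam : ℝ) (z : ℂ) : L2 →L[ℂ] L2 :=
  rest A R lam * Ring.inverse (1 - (z + 1) • rest A R lam)

theorem inverse_eq_one_add (z : ℂ) (hz : IsUnit (1 - (z + 1) • rest A R lam)) :
    Ring.inverse (1 - (z + 1) • rest A R lam) = 1 + (z + 1) • regular A R lam z := by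
  have := Ring.mul_inverse_cancel _ hz
  rw [sub_mul, one_mul, smul_mul_assoc, sub_eq_iff_eq_add] at this
  exact this

theorem regular_eq (z : ℂ) (hz : IsUnit (1 - (z + 1) • rest A R lam)) :
    regular A R lam z = Ring.inverse (1 - (z + 1) • rest A R lam) * rest A R lam := by
  have hc : Commute (rest A R lam) (Ring.inverse (1 - (z + 1) • rest A R lam)) := by
    have h1 : Commute (rest A R lam) (1 - (z + 1) • rest A R lam) :=
      (Commute.one_right (rest A R lam)).sub_right ((Commute.refl (rest A R lam)).smul_right _)
    obtain ⟨u, hu⟩ := hz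
    rw [← hu] at h1 ⊢
    rw [Ring.inverse_unit]
    exact h1.units_inv_right
  exact hc

theorem res_mul_regular (h : SimpleEigen A R lam χ) {z : ℂ}
    (hz : IsUnit (1 - (z + 1) • rest A R lam)) :
    R * (1 - eigenProj A lam + (z + 1) • regular A R lam z) = regular A R lam z := by
  have h1 : R * (1 - eigenProj A lam) = rest A R lam := by
    rw [mul_sub, h.res_mul_proj, mul_one, rest]
  have h2 : eigenProj A lam * regular A R lam z = 0 := by
    rw [regular, ← mul_assoc, h.proj_mul_rest, zero_mul]
  have h3 : R * regular A R lam z = rest A R lam * regular A R lam z := by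
    rw [← h1, mul_assoc, sub_mul, one_mul, h2, sub_zero]
  rw [mul_add, h1, mul_smul_comm, h3, ← mul_smul_comm]
  nth_rw 1 [← mul_one (rest A R lam)]
  rw [← mul_add, ← inverse_eq_one_add z hz, regular]

/-- Laurent decomposition at $\lambda$: the pole is carried by the eigenprojection, while the second
term is holomorphic near $\lambda$. -/
theorem isResolventAt (h : SimpleEigen A R lam χ) {z : ℂ} (hne : z ≠ lam)
    (hz : IsUnit (1 - (z + 1) • rest A R lam)) :
    IsResolventAt A z (((lam : ℂ) - z)⁻¹ • eigenProj A lam + regular A R lam z) := by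
  have hs : ((lam : ℂ) - z) ≠ 0 := sub_ne_zero.2 hne.symm
  have hl := h.lam_add_one_ne
  rw [isResolventAt_iff h.res]
  have hcoef : ((lam : ℂ) + 1)⁻¹ + (z + 1) * (((lam : ℂ) - z)⁻¹ * ((lam : ℂ) + 1)⁻¹) =
      ((lam : ℂ) - z)⁻¹ := by
    field_simp
    ring
  constructor
  · have e : (1 : L2 →L[ℂ] L2) + (z + 1) • (((lam : ℂ) - z)⁻¹ • eigenProj A lam +
        regular A R lam z) = (1 - eigenProj A lam + (z + 1) • regular A R lam z) +
          (1 + (z + 1) * ((lam : ℂ) - z)⁻¹) • eigenProj A lam := by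
      module
    rw [e, mul_add, h.res_mul_regular hz, mul_smul_comm, h.res_mul_proj, smul_smul, add_comm,
      add_mul, one_mul, mul_assoc, hcoef]
  · have h1 : rest A R lam * (1 - (z + 1) • R) = rest A R lam * (1 - (z + 1) • rest A R lam) := by
      have : R = rest A R lam + ((lam : ℂ) + 1)⁻¹ • eigenProj A lam := by
        rw [rest, sub_add_cancel]
      nth_rw 2 [this]
      rw [mul_sub, mul_sub, mul_smul_comm, mul_smul_comm, mul_add, mul_smul_comm, h.rest_mul_proj,
        smul_zero, add_zero]
    have h2 : regular A R lam z * (1 - (z + 1) • R) = rest A R lam := by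
      rw [regular_eq z hz, mul_assoc, h1, ← mul_assoc, ← regular_eq z hz, regular, mul_assoc,
        Ring.inverse_mul_cancel _ hz, mul_one]
    rw [add_mul, h2, smul_mul_assoc, mul_sub, mul_smul_comm, h.proj_mul_res, mul_one, rest]
    have hcoef' : (((lam : ℂ) - z)⁻¹ - ((lam : ℂ) - z)⁻¹ * ((z + 1) * ((lam : ℂ) + 1)⁻¹)) =
        ((lam : ℂ) + 1)⁻¹ := by
      field_simp
      ring
    rw [smul_sub, smul_smul, smul_smul, ← sub_smul, mul_assoc, hcoef']
    abel

/-- Invertibility is an open condition, so resolvents exist in a punctured neighbourhood of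
$\lambda$. The remaining spectrum is nonempty because a nonzero compact self-adjoint operator has a
nonzero eigenvalue, here for `rest`. -/
theorem gap_pos (h : SimpleEigen A R lam χ) : 0 < gap A lam := by
  have hne : (pspectrum A \ {(lam : ℂ)}).Nonempty := by
    have hT : rest A R lam ≠ 0 := by
      intro h0
      obtain ⟨f, hf, hχ⟩ := exists_orthogonal_ne_zero χ
      apply hf
      refine PosSA.eq_zero_of_resolvent_eq_zero h.res ?_
      have := DFunLike.congr_fun h0 f
      rwa [rest, sub_apply, smul_apply, h.proj, hχ,
        zero_smul, smul_zero, sub_zero] at this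
    by_contra hem
    apply hT
    refine (ContinuousLinearMap.eq_zero_of_forall_hasEigenvalue_eq_zero
      h.isCompactOperator_rest h.inner_rest).1 fun μ hμ => ?_
    by_contra hμ0
    obtain ⟨f, hf⟩ := hμ.exists_hasEigenvector
    obtain ⟨h1, h2⟩ := h.res_apply_of_rest hμ0 hf.apply_eq_smul
    have h3 : (f, (μ⁻¹ - 1) • f) ∈ A.graph :=
      mem_graph_of_apply_eq_smul h.res (by rw [h2, sub_add_cancel, inv_smul_smul₀ hμ0])
    apply hem
    refine ⟨μ⁻¹ - 1, fun ⟨X, hX⟩ => ?_, fun hl => ?_⟩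
    · have := hX.2 _ _ h3
      rw [sub_self, map_zero] at this
      exact hf.2 this.symm
    · rw [mem_singleton_iff] at hl
      rw [hl] at h3
      obtain ⟨c, rfl⟩ := h.simple f h3
      rw [map_smul, h.proj, h.inner_self, one_smul] at h1
      exact hf.2 h1
  unfold gap
  rw [← Metric.infDist_pos_iff_notMem_closure hne]
  have hev : ∀ᶠ z in 𝓝 (lam : ℂ), IsUnit (1 - (z + 1) • rest A R lam) := by
    have hc : ContinuousAt (fun z : ℂ => 1 - (z + 1) • rest A R lam) (lam : ℂ) := by fun_prop
    exact hc (Units.isOpen.mem_nhds h.isUnit_one_sub_self)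
  intro hcl
  obtain ⟨z, hz, hu⟩ := (mem_closure_iff_frequently.1 hcl).and_eventually hev |>.exists
  exact hz.1 ⟨_, h.isResolventAt hz.2 hu⟩

theorem isUnit_of_dist_lt (h : SimpleEigen A R lam χ) {z : ℂ} (hz : dist z lam < gap A lam) :
    IsUnit (1 - (z + 1) • rest A R lam) := by
  rcases eq_or_ne z lam with rfl | hne
  · exact h.isUnit_one_sub_self
  · refine h.isUnit_one_sub_of_notMem fun hm => ?_
    have : gap A lam ≤ dist (lam : ℂ) z := Metric.infDist_le_dist_of_mem ⟨hm, hne⟩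
    rw [dist_comm] at this
    linarith

/-- On the contour the integrand is $(z-\lambda)^{-2}P-(z-\lambda)^{-1}$ times the regular part. The
double pole integrates to zero and Cauchy's formula evaluates the rest at $\lambda$. -/
theorem reducedResolvent_eq (h : SimpleEigen A R lam χ) :
    reducedResolvent A lam = regular A R lam lam := by
  have hg := h.gap_pos
  have hd : ∀ z ∈ Metric.closedBall (lam : ℂ) (gap A lam / 2),
      DifferentiableAt ℂ (regular A R lam) z := by
    intro z hz
    have hu := h.isUnit_of_dist_lt (z := z) (by
      have := Metric.mem_closedBall.1 hz
      linarith)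
    obtain ⟨u, hu⟩ := hu
    have h1 : DifferentiableAt ℂ (fun z : ℂ => 1 - (z + 1) • rest A R lam) z := by fun_prop
    have h2 : DifferentiableAt ℂ Ring.inverse (1 - (z + 1) • rest A R lam) := by
      rw [← hu]
      exact differentiableAt_inverse u.isUnit
    exact (h2.comp z h1).const_mul _
  have hcont : ContinuousOn (regular A R lam) (Metric.closedBall (lam : ℂ) (gap A lam / 2)) :=
    fun z hz => (hd z hz).continuousAt.continuousWithinAt
  have hcauchy := DiffContOnCl.circleIntegral_sub_inv_smul (f := regular A R lam) (c := (lam : ℂ))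
    (w := (lam : ℂ)) (R := gap A lam / 2)
    (DifferentiableOn.diffContOnCl fun z hz => (hd z (by
      rwa [closure_ball _ (by positivity)] at hz)).differentiableWithinAt)
    (Metric.mem_ball_self (by positivity))
  have hz2 : ∮ z in C((lam : ℂ), gap A lam / 2), (z - (lam : ℂ)) ^ (-2 : ℤ) = 0 :=
    circleIntegral.integral_sub_zpow_of_ne (by norm_num) _ _ _
  have hsub : ∀ z ∈ Metric.sphere (lam : ℂ) (gap A lam / 2), z - (lam : ℂ) ≠ 0 := by
    intro z hz h0
    rw [mem_sphere_iff_norm, h0, norm_zero] at hz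
    linarith
  have hpt : EqOn (fun z => ((lam : ℂ) - z)⁻¹ • presolvent A z)
      (fun z => (z - (lam : ℂ)) ^ (-2 : ℤ) • eigenProj A lam -
        (z - (lam : ℂ))⁻¹ • regular A R lam z)
      (Metric.sphere (lam : ℂ) (gap A lam / 2)) := by
    intro z hz
    have hne : z ≠ lam := sub_ne_zero.1 (hsub z hz)
    have hu := h.isUnit_of_dist_lt (z := z) (by
      have := Metric.mem_sphere.1 hz
      linarith)
    simp only [presolvent_eq (h.isResolventAt hne hu), smul_add, smul_smul]
    have e1 : ((lam : ℂ) - z)⁻¹ = -(z - (lam : ℂ))⁻¹ := by rw [← inv_neg, neg_sub]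
    rw [e1, neg_mul_neg, neg_smul, ← sub_eq_add_neg]
    congr 2
    rw [zpow_neg, ← mul_inv]
    congr 1
    exact (pow_two _).symm
  have hci1 : ContinuousOn (fun z : ℂ => (z - (lam : ℂ)) ^ (-2 : ℤ))
      (Metric.sphere (lam : ℂ) (gap A lam / 2)) :=
    ContinuousOn.zpow₀ (by fun_prop) _ fun z hz => Or.inl (hsub z hz)
  have hci2 : ContinuousOn (fun z : ℂ => (z - (lam : ℂ))⁻¹)
      (Metric.sphere (lam : ℂ) (gap A lam / 2)) :=
    ContinuousOn.inv₀ (by fun_prop) hsub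
  have hi1 : CircleIntegrable (fun z : ℂ => (z - (lam : ℂ)) ^ (-2 : ℤ) • eigenProj A lam) lam
      (gap A lam / 2) := (hci1.smul continuousOn_const).circleIntegrable (by positivity)
  have hi2 : CircleIntegrable (fun z : ℂ => (z - (lam : ℂ))⁻¹ • regular A R lam z) lam
      (gap A lam / 2) :=
    (hci2.smul (hcont.mono Metric.sphere_subset_closedBall)).circleIntegrable (by positivity)
  rw [reducedResolvent, circleIntegral.integral_congr (by positivity) hpt,
    circleIntegral.integral_sub hi1 hi2, hcauchy, circleIntegral.integral_smul_const, hz2, zero_smul, zero_sub, smul_neg, smul_smul,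
    ← neg_smul]
  have hpi : (Real.pi : ℂ) ≠ 0 := by exact_mod_cast Real.pi_ne_zero
  -- The prefactor $i/2\pi$ equals $-1/(2\pi i)$, which compensates the sign in
  -- $(\lambda-z)^{-1}=-(z-\lambda)^{-1}$.
  have : -(Complex.I / (2 * Real.pi) * (2 * Real.pi * Complex.I)) = 1 := by
    field_simp
    rw [Complex.I_sq, neg_neg]
  rw [this, one_smul]

theorem mem_graph_reducedResolvent (h : SimpleEigen A R lam χ) (f : L2) :
    (reducedResolvent A lam f,
      f - eigenProj A lam f + (lam : ℂ) • reducedResolvent A lam f) ∈ A.graph := by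
  rw [h.res.mem_graph_iff, h.reducedResolvent_eq]
  have := DFunLike.congr_fun (h.res_mul_regular h.isUnit_one_sub_self) f
  simp only [mul_apply_eq_comp, add_apply,
    sub_apply, one_apply_eq_self,
    smul_apply] at this
  rwa [add_smul, one_smul, ← add_assoc] at this

/-- Symmetry is inherited from $A$ through $(A-\lambda)S=1-P$ and $PS=0$. -/
theorem inner_reducedResolvent (h : SimpleEigen A R lam χ) (f g : L2) :
    inner ℂ (reducedResolvent A lam f) g = inner ℂ f (reducedResolvent A lam g) := by
  have hm := h.mem_graph_reducedResolvent
  have hP : ∀ f, eigenProj A lam (reducedResolvent A lam f) = 0 := fun f => by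
    have : eigenProj A lam * reducedResolvent A lam = 0 := by
      rw [h.reducedResolvent_eq, regular, ← mul_assoc, h.proj_mul_rest, zero_mul]
    exact DFunLike.congr_fun this f
  have hsym := h.posSA.symm (hm f) (hm g)
  have h1 : inner ℂ (eigenProj A lam f) (reducedResolvent A lam g) = 0 := by
    rw [h.inner_proj, hP, inner_zero_right]
  have h2 : inner ℂ (reducedResolvent A lam f) (eigenProj A lam g) = 0 := by
    rw [← h.inner_proj, hP, inner_zero_left]
  simp only [inner_add_left, inner_add_right, inner_sub_left, inner_sub_right, inner_smul_left,
    inner_smul_right, h1, h2, Complex.conj_ofReal, sub_zero] at hsym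
  exact add_right_cancel hsym

theorem reducedResolvent_apply (h : SimpleEigen A R lam χ) : reducedResolvent A lam χ = 0 := by
  have h1 : rest A R lam χ = 0 := by
    have := DFunLike.congr_fun h.rest_mul_proj χ
    rwa [mul_apply_eq_comp, h.proj, h.inner_self, one_smul] at this
  rw [h.reducedResolvent_eq, regular_eq _ h.isUnit_one_sub_self, mul_apply_eq_comp, h1,
    map_zero]

end SimpleEigen

end Spectral

/-! ### Weighted estimates -/

/-- Bounded regularization of the weight `wt ^ n`. -/
def cutWt (s : ℝ) (n : ℕ) (x : Plane) : ℝ := (wt x / (1 + s * wt x)) ^ n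

section CutWt

variable {s : ℝ}

theorem one_le_one_add_mul_wt (hs : 0 ≤ s) (x : Plane) : 1 ≤ 1 + s * wt x := by
  have := mul_nonneg hs (wt_pos x).le
  linarith

theorem cutWt_nonneg (hs : 0 ≤ s) (n : ℕ) (x : Plane) : 0 ≤ cutWt s n x := by
  have := one_le_one_add_mul_wt hs x
  have := wt_pos x
  unfold cutWt
  positivity

theorem cutWt_le (hs : 0 ≤ s) (n : ℕ) (x : Plane) : cutWt s n x ≤ wt x ^ n := by
  have h1 := one_le_one_add_mul_wt hs x
  have h2 := wt_pos x
  refine pow_le_pow_left₀ (by positivity) (div_le_self h2.le h1) n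

theorem contDiff_cutWt (hs : 0 ≤ s) (n : ℕ) : ContDiff ℝ ∞ (cutWt s n) :=
  (contDiff_wt.div (contDiff_const.add (contDiff_const.mul contDiff_wt)) fun x =>
    (zero_lt_one.trans_le (one_le_one_add_mul_wt hs x)).ne').pow n

theorem bddMeas_cutWt (hs : 0 < s) (n : ℕ) : BddMeas (cutWt s n) := by
  refine ⟨(contDiff_cutWt hs.le n).continuous.aestronglyMeasurable, s⁻¹ ^ n, fun x => ?_⟩
  rw [abs_of_nonneg (cutWt_nonneg hs.le n x)]
  have h1 := one_le_one_add_mul_wt hs.le x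
  have h2 := wt_pos x
  refine pow_le_pow_left₀ (by positivity) ?_ n
  rw [div_le_iff₀ (by positivity)]
  have : s⁻¹ * (1 + s * wt x) = s⁻¹ + wt x := by field_simp
  rw [this]
  have := inv_pos.2 hs
  linarith

theorem bddMeas_cutWt_sq (hs : 0 < s) (n : ℕ) : BddMeas fun x => cutWt s n x ^ 2 := by
  obtain ⟨h1, C, hC⟩ := bddMeas_cutWt hs n
  refine ⟨h1.pow 2, C ^ 2, fun x => ?_⟩
  rw [abs_pow]
  exact pow_le_pow_left₀ (abs_nonneg _) (hC x) 2

/-- The gradient of $1+|x|^2$ has length $2|x|\le1+|x|^2$, and $u\mapsto u/(1+su)$ has derivative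
$(1+su)^{-2}$. The constant does not depend on $s$, which permits the limit $s\to0$ in the weighted
estimates. -/
theorem sum_pd_cutWt_sq_le (hs : 0 ≤ s) (n : ℕ) (x : Plane) :
    ∑ i, pd i (cutWt s n) x ^ 2 ≤ (n : ℝ) ^ 2 * cutWt s n x ^ 2 := by
  rcases n with _ | n
  · have : cutWt s 0 = fun _ => 1 := by
      funext y
      simp [cutWt]
    simp [this, pd]
  have h1 := one_le_one_add_mul_wt hs x
  have h2 := wt_pos x
  have hne : (1 + s * wt x) ≠ 0 := by positivity
  have hwt : HasFDerivAt wt (2 • innerSL ℝ x) x :=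
    (hasStrictFDerivAt_norm_sq x).hasFDerivAt.const_add 1
  have hq : HasDerivAt (fun u : ℝ => (u / (1 + s * u)) ^ (n + 1))
      ((n + 1 : ℕ) * (wt x / (1 + s * wt x)) ^ n * (1 / (1 + s * wt x) ^ 2)) (wt x) := by
    have h3 : HasDerivAt (fun u : ℝ => 1 + s * u) s (wt x) :=
      (((hasDerivAt_id (wt x)).const_mul s).const_add 1).congr_deriv (by ring)
    have h4 : HasDerivAt (fun u : ℝ => u / (1 + s * u)) (1 / (1 + s * wt x) ^ 2) (wt x) :=
      ((hasDerivAt_id (wt x)).div h3 hne).congr_deriv (by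
        simp only [id]
        congr 1
        ring)
    exact h4.pow (n + 1)
  have hcomp := hq.comp_hasFDerivAt x hwt
  have hpd : ∀ i, pd i (cutWt s (n + 1)) x =
      ((n + 1 : ℕ) * (wt x / (1 + s * wt x)) ^ n * (1 / (1 + s * wt x) ^ 2)) * (2 * x i) := by
    intro i
    have : pd i (cutWt s (n + 1)) x = _ := congrArg (fun L => L (EuclideanSpace.single i 1))
      hcomp.fderiv
    have hx : inner ℝ x (EuclideanSpace.single i (1 : ℝ)) = x i := by
      rw [EuclideanSpace.inner_single_right, one_mul]
      rfl
    rw [this, smul_apply, smul_apply, innerSL_apply_apply, hx, smul_eq_mul, two_smul, two_mul]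
  simp_rw [hpd, mul_pow _ (2 * x _), mul_pow 2 (x _)]
  rw [← Finset.mul_sum, ← Finset.mul_sum, ← EuclideanSpace.real_norm_sq_eq]
  have hx : 2 ^ 2 * ‖x‖ ^ 2 ≤ wt x ^ 2 := by
    unfold wt
    nlinarith [sq_nonneg (‖x‖ ^ 2 - 1)]
  have hfac : (1 / (1 + s * wt x) ^ 2) ^ 2 * wt x ^ 2 ≤ (wt x / (1 + s * wt x)) ^ 2 := by
    rw [← mul_pow]
    refine pow_le_pow_left₀ (by positivity) ?_ 2
    rw [one_div, mul_comm, ← div_eq_mul_inv]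
    refine div_le_div_of_nonneg_left h2.le (by positivity) ?_
    nlinarith
  calc _ ≤ ((n + 1 : ℕ) * (wt x / (1 + s * wt x)) ^ n * (1 / (1 + s * wt x) ^ 2)) ^ 2 *
        wt x ^ 2 := by gcongr
    _ = ((n + 1 : ℕ) : ℝ) ^ 2 * ((wt x / (1 + s * wt x)) ^ n) ^ 2 *
        ((1 / (1 + s * wt x) ^ 2) ^ 2 * wt x ^ 2) := by ring
    _ ≤ ((n + 1 : ℕ) : ℝ) ^ 2 * ((wt x / (1 + s * wt x)) ^ n) ^ 2 *
        (wt x / (1 + s * wt x)) ^ 2 := by gcongr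
    _ = _ := by
      unfold cutWt
      ring

theorem tendsto_cutWt (n : ℕ) (x : Plane) :
    Tendsto (fun k : ℕ => cutWt (1 / ((k : ℝ) + 1)) n x) atTop (𝓝 (wt x ^ n)) := by
  have h1 := tendsto_one_div_add_atTop_nhds_zero_nat (𝕜 := ℝ)
  have h2 : Tendsto (fun k : ℕ => 1 + 1 / ((k : ℝ) + 1) * wt x) atTop (𝓝 (1 + 0 * wt x)) :=
    tendsto_const_nhds.add (h1.mul_const _)
  rw [zero_mul, add_zero] at h2
  have h3 := ((tendsto_const_nhds (x := wt x)).div h2 one_ne_zero).pow n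
  rwa [div_one] at h3

end CutWt

/-- An Agmon type estimate: pair the equation with $w^2f$, where $w$ is the regularized weight. The
kinetic term costs at most $|\nabla w|^2\le n^2w^2$, and the growth of $W$ absorbs this outside a
ball. -/
theorem weighted_energy_core {W : Plane → ℝ} (hW : PolyBdd W) (h0 : ∀ x, 0 ≤ W x)
    (hg : ∀ L : ℝ, ∃ r : ℝ, ∀ x, r ≤ ‖x‖ → L ≤ W x) {lam : ℝ} (hl : 0 ≤ lam) (n : ℕ) :
    ∃ C : ℝ, 0 ≤ C ∧ ∀ s : ℝ, 0 < s → ∀ q ∈ coreGraph W,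
      ‖mulL2 (cutWt s n) q.1‖ ^ 2 ≤ C * ‖q.1‖ ^ 2 +
        (inner ℂ (mulL2 (fun x => cutWt s n x ^ 2) q.1) (q.2 - (lam : ℂ) • q.1)).re := by
  obtain ⟨r, hr⟩ := hg ((n : ℝ) ^ 2 + lam + 1)
  -- Outside the ball $W-\lambda-n^2\ge1$. Inside it the deficit is at most $(n^2+\lambda+1)w^2$,
  -- with $w\le(1+r^2)^n$ there.
  refine ⟨((n : ℝ) ^ 2 + lam + 1) * ((1 + r ^ 2) ^ n) ^ 2, by positivity, fun s hs q hq => ?_⟩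
  set C := ((n : ℝ) ^ 2 + lam + 1) * ((1 + r ^ 2) ^ n) ^ 2 with hC
  obtain ⟨f, g⟩ := q
  obtain ⟨φ, hs1, hs2, hf, hgg⟩ := hq
  have t : IsTest φ := ⟨hs1, hs2⟩
  simp only at hf hgg ⊢
  have hb := bddMeas_cutWt_sq hs n
  have hcd := contDiff_cutWt hs.le n
  have hsub : (g - (lam : ℂ) • f : L2) =ᵐ[volume]
      fun x => -(Δ φ) x + ((W x - lam : ℝ) : ℂ) * φ x := by
    filter_upwards [Lp.coeFn_sub g ((lam : ℂ) • f), Lp.coeFn_smul (lam : ℂ) f, hf, hgg]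
      with x h1 h2 h3 h4
    rw [h1, Pi.sub_apply, h2, Pi.smul_apply, h3, h4, smul_eq_mul]
    push_cast
    ring
  have hwf : mulL2 (cutWt s n) f =ᵐ[volume] fun x => (cutWt s n x : ℂ) * φ x := by
    filter_upwards [coeFn_mulL2 (bddMeas_cutWt hs n) f, hf] with x h1 h2
    rw [h1, h2]
  rw [norm_sq_eq_integral hwf, norm_sq_eq_integral hf, re_inner_mulL2 hb hf hsub]
  have iφ : Integrable fun x => ‖φ x‖ ^ 2 := by
    refine (integrable_sq_norm f).congr ?_
    filter_upwards [hf] with x hx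
    rw [hx]
  have iW := (re_inner_core t hf hgg hW).1
  have i1 : Integrable fun x => cutWt s n x ^ 2 * inner ℝ (φ x) (-(Δ φ) x) := by
    refine Continuous.integrable_of_hasCompactSupport
      ((hcd.continuous.pow 2).mul
        (hs1.continuous.inner (continuous_laplacian t.contDiff_two).neg))
      (hs2.mono fun x hx => ?_)
    contrapose! hx
    simp only [Function.mem_support, not_not] at hx ⊢
    simp [hx]
  have i2 : Integrable fun x => cutWt s n x ^ 2 * ((W x - lam) * ‖φ x‖ ^ 2) := by
    refine hb.integrable_mul ?_
    simp_rw [sub_mul]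
    exact iW.sub (iφ.const_mul _)
  have i3 : Integrable fun x => (∑ i, pd i (cutWt s n) x ^ 2) * ‖φ x‖ ^ 2 := by
    have hpc : ∀ i, Continuous (pd i (cutWt s n)) := fun i =>
      (contDiff_pd (m := 0) hcd (by norm_num) i).continuous
    have hφc := hs1.continuous
    refine Continuous.integrable_of_hasCompactSupport (by fun_prop) (hs2.mono fun x hx => ?_)
    contrapose! hx
    simp only [Function.mem_support, not_not] at hx ⊢
    simp [hx]
  have i4 : Integrable fun x => cutWt s n x ^ 2 * ‖φ x‖ ^ 2 := hb.integrable_mul iφ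
  have hen := energy_ineq (hcd.of_le (by norm_num)) t.contDiff_two (Or.inr hs2)
  have e1 : ∫ x, cutWt s n x ^ 2 * inner ℝ (φ x) (-(Δ φ) x + ((W x - lam : ℝ) : ℂ) * φ x) =
      (∫ x, cutWt s n x ^ 2 * inner ℝ (φ x) (-(Δ φ) x)) +
        ∫ x, cutWt s n x ^ 2 * ((W x - lam) * ‖φ x‖ ^ 2) := by
    rw [← integral_add i1 i2]
    refine integral_congr_ae (Eventually.of_forall fun x => ?_)
    simp only
    rw [inner_add_right, ← Complex.real_smul, real_inner_smul_right, real_inner_self_eq_norm_sq,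
      mul_add]
  have e2 : ∫ x, ‖(cutWt s n x : ℂ) * φ x‖ ^ 2 = ∫ x, cutWt s n x ^ 2 * ‖φ x‖ ^ 2 := by
    refine integral_congr_ae (Eventually.of_forall fun x => ?_)
    simp only
    rw [norm_mul, Complex.norm_real, mul_pow, Real.norm_eq_abs, sq_abs]
  have hpt : ∀ x, cutWt s n x ^ 2 * ‖φ x‖ ^ 2 ≤ C * ‖φ x‖ ^ 2 +
      (cutWt s n x ^ 2 * ((W x - lam) * ‖φ x‖ ^ 2) -
        (∑ i, pd i (cutWt s n) x ^ 2) * ‖φ x‖ ^ 2) := by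
    intro x
    have h1 := sum_pd_cutWt_sq_le hs.le n x
    have key : cutWt s n x ^ 2 ≤ C + (cutWt s n x ^ 2 * (W x - lam) -
        ∑ i, pd i (cutWt s n) x ^ 2) := by
      have hsq := sq_nonneg (cutWt s n x)
      rcases le_or_gt r ‖x‖ with hx | hx
      · have := mul_le_mul_of_nonneg_left (hr x hx) hsq
        have : 0 ≤ C := by positivity
        nlinarith
      · have h2 : cutWt s n x ^ 2 ≤ ((1 + r ^ 2) ^ n) ^ 2 := by
          refine pow_le_pow_left₀ (cutWt_nonneg hs.le n x) ((cutWt_le hs.le n x).trans ?_) 2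
          refine pow_le_pow_left₀ (wt_pos x).le ?_ n
          unfold wt
          gcongr
        have h3 := mul_le_mul_of_nonneg_left h2 (by positivity : 0 ≤ (n : ℝ) ^ 2 + lam + 1)
        have h4 := mul_nonneg hsq (h0 x)
        nlinarith
    have := mul_le_mul_of_nonneg_right key (sq_nonneg ‖φ x‖)
    linarith
  have hint := integral_mono i4 ((iφ.const_mul C).add (i2.sub i3)) hpt
  have e3 : ∫ x, (C * ‖φ x‖ ^ 2 + (cutWt s n x ^ 2 * ((W x - lam) * ‖φ x‖ ^ 2) -
        (∑ i, pd i (cutWt s n) x ^ 2) * ‖φ x‖ ^ 2)) = C * (∫ x, ‖φ x‖ ^ 2) +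
      ((∫ x, cutWt s n x ^ 2 * ((W x - lam) * ‖φ x‖ ^ 2)) -
        ∫ x, (∑ i, pd i (cutWt s n) x ^ 2) * ‖φ x‖ ^ 2) := by
    rw [← integral_const_mul, ← integral_sub i2 i3]
    exact integral_add (iφ.const_mul C) (i2.sub i3)
  rw [e1, e2]
  have hint' : ∫ x, cutWt s n x ^ 2 * ‖φ x‖ ^ 2 ≤ _ := hint.trans_eq e3
  linarith

theorem re_inner_mulL2_sq {w : Plane → ℝ} (hw : BddMeas w) (hw2 : BddMeas fun x => w x ^ 2)
    (f g : L2) : (inner ℂ (mulL2 (fun x => w x ^ 2) f) g).re =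
      (inner ℂ (mulL2 w f) (mulL2 w g)).re := by
  rw [re_inner_mulL2 hw2 (ae_eq_refl f) (ae_eq_refl g),
    re_inner_mulL2 hw (ae_eq_refl f) (coeFn_mulL2 hw g)]
  refine integral_congr_ae (Eventually.of_forall fun x => ?_)
  simp only
  rw [← Complex.real_smul, real_inner_smul_right]
  ring

theorem weighted_energy {W : Plane → ℝ} (hW : PolyBdd W) (h0 : ∀ x, 0 ≤ W x)
    (hg : ∀ L : ℝ, ∃ r : ℝ, ∀ x, r ≤ ‖x‖ → L ≤ W x) {lam : ℝ} (hl : 0 ≤ lam) (n : ℕ) :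
    ∃ C : ℝ, 0 ≤ C ∧ ∀ s : ℝ, 0 < s → ∀ f g : L2, (f, g + (lam : ℂ) • f) ∈ (schrodinger W).graph →
      ‖mulL2 (cutWt s n) f‖ ≤ C * ‖f‖ + ‖mulL2 (cutWt s n) g‖ := by
  obtain ⟨C, hC, h⟩ := weighted_energy_core hW h0 hg hl n
  -- The energy inequality has the shape $a^2\le Cd^2+ab$, with $a,b$ the weighted norms of $f,g$
  -- and $d=\|f\|$. It implies $a\le(2C+1)d+b$.
  refine ⟨2 * C + 1, by positivity, fun s hs f g hfg => ?_⟩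
  have hcl : IsClosed {q : L2 × L2 | ‖mulL2 (cutWt s n) q.1‖ ^ 2 ≤ C * ‖q.1‖ ^ 2 +
      (inner ℂ (mulL2 (fun x => cutWt s n x ^ 2) q.1) (q.2 - (lam : ℂ) • q.1)).re} := by
    refine isClosed_le (by fun_prop) (Continuous.add (by fun_prop) ?_)
    exact Complex.continuous_re.comp (Continuous.inner (by fun_prop) (by fun_prop))
  have h1 := schrodinger_graph_induction hW hcl (h s hs) hfg
  simp only [add_sub_cancel_right] at h1
  rw [re_inner_mulL2_sq (bddMeas_cutWt hs n) (bddMeas_cutWt_sq hs n)] at h1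
  have h2 := (Complex.re_le_norm _).trans
    (norm_inner_le_norm (𝕜 := ℂ) (mulL2 (cutWt s n) f) (mulL2 (cutWt s n) g))
  generalize ‖mulL2 (cutWt s n) f‖ = a at *
  have hb := norm_nonneg (mulL2 (cutWt s n) g)
  generalize ‖mulL2 (cutWt s n) g‖ = b at *
  have hd := norm_nonneg f
  generalize ‖f‖ = d at *
  refine le_of_sq_le_sq ?_ (by positivity)
  nlinarith [sq_nonneg (a - b), mul_nonneg hC (sq_nonneg d), mul_nonneg hC (mul_nonneg hd hb),
    mul_nonneg hd hb, mul_nonneg (mul_nonneg hC hC) (sq_nonneg d)]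

/-! ### Rapidly decreasing functions -/

/-- The weighted norm `‖wt ^ n f‖`. -/
def wnorm (n : ℕ) (f : L2) : ENNReal := eLpNorm (fun x => ((wt x ^ n : ℝ) : ℂ) * f x) 2 volume

theorem aestronglyMeasurable_wt_mul (n : ℕ) (f : L2) :
    AEStronglyMeasurable (fun x => ((wt x ^ n : ℝ) : ℂ) * f x) volume := by
  have := continuous_wt
  exact (Continuous.aestronglyMeasurable (by fun_prop)).mul (Lp.aestronglyMeasurable f)

theorem wnorm_zero_left (f : L2) : wnorm 0 f = ‖f‖ₑ := by
  rw [Lp.enorm_def, wnorm]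
  simp

theorem wnorm_mono {n m : ℕ} (h : n ≤ m) (f : L2) : wnorm n f ≤ wnorm m f := by
  refine eLpNorm_mono_ae (Eventually.of_forall fun x => ?_)
  rw [norm_mul, norm_mul, Complex.norm_real, Complex.norm_real, Real.norm_eq_abs,
    Real.norm_eq_abs, abs_of_pos (pow_pos (wt_pos x) n), abs_of_pos (pow_pos (wt_pos x) m)]
  gcongr
  exact one_le_wt x

theorem enorm_le_wnorm (n : ℕ) (f : L2) : ‖f‖ₑ ≤ wnorm n f :=
  (wnorm_zero_left f).symm.trans_le (wnorm_mono n.zero_le f)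

theorem wnorm_add_le (n : ℕ) (f g : L2) : wnorm n (f + g) ≤ wnorm n f + wnorm n g := by
  have h : (fun x => ((wt x ^ n : ℝ) : ℂ) * (f + g : L2) x) =ᵐ[volume]
      (fun x => ((wt x ^ n : ℝ) : ℂ) * f x) + fun x => ((wt x ^ n : ℝ) : ℂ) * g x := by
    filter_upwards [Lp.coeFn_add f g] with x hx
    rw [hx, Pi.add_apply, Pi.add_apply, mul_add]
  rw [wnorm, eLpNorm_congr_ae h]
  exact eLpNorm_add_le (aestronglyMeasurable_wt_mul n f) (aestronglyMeasurable_wt_mul n g)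
    (by norm_num)

theorem wnorm_smul_le (n : ℕ) (c : ℂ) (f : L2) : wnorm n (c • f) ≤ ‖c‖ₑ * wnorm n f := by
  have h : (fun x => ((wt x ^ n : ℝ) : ℂ) * (c • f : L2) x) =ᵐ[volume]
      c • fun x => ((wt x ^ n : ℝ) : ℂ) * f x := by
    filter_upwards [Lp.coeFn_smul c f] with x hx
    rw [hx, Pi.smul_apply, Pi.smul_apply, smul_eq_mul, smul_eq_mul]
    ring
  rw [wnorm, eLpNorm_congr_ae h]
  exact eLpNorm_const_smul_le

theorem wnorm_zero (n : ℕ) : wnorm n 0 = 0 := by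
  have h : (fun x => ((wt x ^ n : ℝ) : ℂ) * (0 : L2) x) =ᵐ[volume] 0 := by
    filter_upwards [Lp.coeFn_zero ℂ 2 (volume : Measure Plane)] with x hx
    rw [hx]
    simp
  rw [wnorm, eLpNorm_congr_ae h, eLpNorm_zero]

/-- Fatou's lemma along $s=1/(k+1)$. Bounds are thus proved for bounded multipliers, where density
and closure arguments are available, and transferred to the unbounded weight. -/
theorem wnorm_le_of_forall {n : ℕ} {f : L2} {C : ENNReal}
    (h : ∀ s : ℝ, 0 < s → ‖mulL2 (cutWt s n) f‖ₑ ≤ C) : wnorm n f ≤ C := by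
  have hlim : ∀ᵐ x ∂(volume : Measure Plane), Tendsto
      (fun k : ℕ => (cutWt (1 / ((k : ℝ) + 1)) n x : ℂ) * f x) atTop
      (𝓝 (((wt x ^ n : ℝ) : ℂ) * f x)) := Eventually.of_forall fun x =>
    ((Complex.continuous_ofReal.tendsto _).comp (tendsto_cutWt n x)).mul_const _
  have hs : ∀ k : ℕ, 0 < 1 / ((k : ℝ) + 1) := fun k => by positivity
  refine (Lp.eLpNorm_lim_le_liminf_eLpNorm (fun k => ?_) _ hlim).trans ?_
  · exact ((bddMeas_cutWt (hs k) n).memLp (Lp.memLp f)).aestronglyMeasurable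
  · refine liminf_le_of_le (by isBoundedDefault) fun b hb => ?_
    obtain ⟨k, hk⟩ := hb.exists
    refine hk.trans ?_
    rw [← eLpNorm_congr_ae (coeFn_mulL2 (bddMeas_cutWt (hs k) n) f), ← Lp.enorm_def]
    exact h _ (hs k)

theorem enorm_mulL2_le {s : ℝ} (hs : 0 < s) (n : ℕ) (f : L2) :
    ‖mulL2 (cutWt s n) f‖ₑ ≤ wnorm n f := by
  rw [Lp.enorm_def, eLpNorm_congr_ae (coeFn_mulL2 (bddMeas_cutWt hs n) f)]
  refine eLpNorm_mono_ae (Eventually.of_forall fun x => ?_)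
  rw [norm_mul, norm_mul, Complex.norm_real, Complex.norm_real, Real.norm_eq_abs,
    Real.norm_eq_abs, abs_of_pos (pow_pos (wt_pos x) n), abs_of_nonneg (cutWt_nonneg hs.le n x)]
  gcongr
  exact cutWt_le hs.le n x

/-- Resolvent estimate in weighted norms. -/
theorem wnorm_le_of_mem_graph {W : Plane → ℝ} (hW : PolyBdd W) (h0 : ∀ x, 0 ≤ W x)
    (hg : ∀ L : ℝ, ∃ r : ℝ, ∀ x, r ≤ ‖x‖ → L ≤ W x) {lam : ℝ} (hl : 0 ≤ lam) (n : ℕ) :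
    ∃ C : NNReal, ∀ f g : L2, (f, g + (lam : ℂ) • f) ∈ (schrodinger W).graph →
      wnorm n f ≤ C * ‖f‖ₑ + wnorm n g := by
  obtain ⟨C, hC, h⟩ := weighted_energy hW h0 hg hl n
  lift C to NNReal using hC
  refine ⟨C, fun f g hfg => wnorm_le_of_forall fun s hs => ?_⟩
  refine le_trans ?_ (add_le_add_right (enorm_mulL2_le hs n g) _)
  have h1 : ‖mulL2 (cutWt s n) f‖₊ ≤ C * ‖f‖₊ + ‖mulL2 (cutWt s n) g‖₊ := h s hs f g hfg
  have h2 := ENNReal.coe_le_coe.2 h1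
  rwa [ENNReal.coe_add, ENNReal.coe_mul] at h2

/-- The functions all of whose weighted norms are finite. -/
def rapid : Submodule ℂ L2 where
  carrier := {f | ∀ n, wnorm n f < ⊤}
  zero_mem' n := by rw [wnorm_zero]; exact ENNReal.zero_lt_top
  add_mem' hf hg n := (wnorm_add_le n _ _).trans_lt (ENNReal.add_lt_top.2 ⟨hf n, hg n⟩)
  smul_mem' c f hf n := (wnorm_smul_le n c f).trans_lt (ENNReal.mul_lt_top enorm_lt_top (hf n))

theorem mem_rapid_of_test {f : L2} {φ : Plane → ℂ} (hφ : IsTest φ) (hf : f =ᵐ[volume] φ) :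
    f ∈ rapid := fun n => by
  have h : (fun x => ((wt x ^ n : ℝ) : ℂ) * f x) =ᵐ[volume]
      fun x => ((wt x ^ n : ℝ) : ℂ) * φ x := by
    filter_upwards [hf] with x hx
    rw [hx]
  rw [wnorm, eLpNorm_congr_ae h]
  have h1 := continuous_wt
  have h2 := hφ.smooth.continuous
  exact (memLp_of_test (by fun_prop) hφ.compact.mul_left).2

theorem PolyBdd.memLp_rapid {V : Plane → ℝ} (hV : PolyBdd V) {f : L2} (hf : f ∈ rapid) :
    MemLp (fun x => (V x : ℂ) * f x) 2 (volume : Measure Plane) := by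
  obtain ⟨C, m, hC, hb⟩ := hV.bound
  have h1 : MemLp (fun x => ((wt x ^ m : ℝ) : ℂ) * f x) 2 volume :=
    ⟨aestronglyMeasurable_wt_mul m f, hf m⟩
  refine h1.of_le_mul (c := C) ((Complex.continuous_ofReal.comp_aestronglyMeasurable hV.meas).mul
    (Lp.aestronglyMeasurable f)) ?_
  filter_upwards [hb] with x hx
  rw [norm_mul, norm_mul, Complex.norm_real, Complex.norm_real, Real.norm_eq_abs,
    Real.norm_eq_abs, abs_of_pos (pow_pos (wt_pos x) m), ← mul_assoc]
  gcongr

theorem wnorm_mul_le {V : Plane → ℝ} {f g : L2} (hg : g =ᵐ[volume] fun x => (V x : ℂ) * f x)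
    {C : NNReal} {m : ℕ} (hb : ∀ᵐ x, |V x| ≤ C * wt x ^ m) (n : ℕ) :
    wnorm n g ≤ C * wnorm (n + m) f := by
  have := eLpNorm_le_nnreal_smul_eLpNorm_of_ae_le_mul (μ := (volume : Measure Plane))
    (f := fun x => ((wt x ^ n : ℝ) : ℂ) * g x) (g := fun x => ((wt x ^ (n + m) : ℝ) : ℂ) * f x)
    (c := C) (by
      filter_upwards [hg, hb] with x h1 h2
      rw [h1, ← NNReal.coe_le_coe]
      push_cast
      rw [norm_mul, norm_mul, norm_mul, norm_pow, norm_pow, Complex.norm_real, Complex.norm_real,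
        Real.norm_eq_abs, Real.norm_eq_abs, abs_of_pos (wt_pos x), pow_add]
      have h3 := mul_le_mul_of_nonneg_left h2
        (mul_nonneg (pow_nonneg (wt_pos x).le n) (norm_nonneg (f x)))
      linarith) 2
  rwa [ENNReal.smul_def, smul_eq_mul] at this

/-- Multiplication by a polynomially bounded function on rapidly decreasing functions. -/
def mulRapid {V : Plane → ℝ} (hV : PolyBdd V) : Module.End ℂ rapid where
  toFun f := ⟨(hV.memLp_rapid f.2).toLp _, fun n => by
    obtain ⟨C, m, hC, hb⟩ := hV.bound
    exact (wnorm_mul_le (hV.memLp_rapid f.2).coeFn_toLp (C := ⟨C, hC⟩) hb n).trans_lt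
      (ENNReal.mul_lt_top ENNReal.coe_lt_top (f.2 _))⟩
  map_add' f g := by
    refine Subtype.ext (Lp.ext ?_)
    refine (hV.memLp_rapid (f + g).2).coeFn_toLp.trans ?_
    filter_upwards [(hV.memLp_rapid f.2).coeFn_toLp, (hV.memLp_rapid g.2).coeFn_toLp,
      Lp.coeFn_add (f : L2) (g : L2), Lp.coeFn_add ((hV.memLp_rapid f.2).toLp _)
        ((hV.memLp_rapid g.2).toLp _)] with x h1 h2 h3 h4
    rw [Submodule.coe_add, Submodule.coe_add, h3, h4, Pi.add_apply, Pi.add_apply, h1, h2, mul_add]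
  map_smul' c f := by
    refine Subtype.ext (Lp.ext ?_)
    refine (hV.memLp_rapid (c • f).2).coeFn_toLp.trans ?_
    filter_upwards [(hV.memLp_rapid f.2).coeFn_toLp,
      Lp.coeFn_smul c (f : L2), Lp.coeFn_smul c ((hV.memLp_rapid f.2).toLp _)] with x h1 h3 h4
    rw [RingHom.id_apply, Submodule.coe_smul, Submodule.coe_smul, h3, h4, Pi.smul_apply,
      Pi.smul_apply, h1, smul_eq_mul, smul_eq_mul]
    ring

theorem coeFn_mulRapid {V : Plane → ℝ} (hV : PolyBdd V) (f : rapid) :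
    (mulRapid hV f : L2) =ᵐ[volume] fun x => (V x : ℂ) * (f : L2) x :=
  (hV.memLp_rapid f.2).coeFn_toLp

theorem mulRapid_mem_graph {V : Plane → ℝ} (hV : PolyBdd V) (f : rapid) :
    ((f : L2), (mulRapid hV f : L2)) ∈ (mulOp V).graph :=
  mem_graph_mulOp.2 (coeFn_mulRapid hV f)

theorem inner_mulRapid {V : Plane → ℝ} (hV : PolyBdd V) (f g : rapid) :
    inner ℂ (mulRapid hV f : L2) (g : L2) = inner ℂ (f : L2) (mulRapid hV g : L2) := by
  rw [inner_eq_integral (coeFn_mulRapid hV f) (ae_eq_refl (g : L2)),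
    inner_eq_integral (ae_eq_refl (f : L2)) (coeFn_mulRapid hV g)]
  refine integral_congr_ae (Eventually.of_forall fun x => ?_)
  simp only [map_mul, Complex.conj_ofReal]
  ring

theorem eq_zero_of_inner_rapid {f : L2} (h : ∀ g ∈ rapid, inner ℂ g f = 0) : f = 0 :=
  eq_zero_of_inner_test fun g _ hφ hg => h g (mem_rapid_of_test hφ hg)

/-! ### The reduced resolvent on rapidly decreasing functions -/

/-- A confining polynomially bounded potential `W` and a simple eigenvalue of `-Δ + W`. -/
structure Confined (W : Plane → ℝ) (R : L2 →L[ℂ] L2) (lam : ℝ) (χ : L2) : Prop where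
  polyBdd : PolyBdd W
  nonneg : ∀ x, 0 ≤ W x
  grow : ∀ L : ℝ, ∃ r : ℝ, ∀ x, r ≤ ‖x‖ → L ≤ W x
  eigen : SimpleEigen (schrodinger W) R lam χ

section Words

variable {W : Plane → ℝ} {R : L2 →L[ℂ] L2} {lam : ℝ} {χ : L2}

namespace Confined

/-- The weighted resolvent estimate with zero right-hand side gives decay of the eigenfunction. -/
theorem mem_rapid_eigen (M : Confined W R lam χ) : χ ∈ rapid := fun n => by
  obtain ⟨C, hC⟩ := wnorm_le_of_mem_graph M.polyBdd M.nonneg M.grow M.eigen.lam_nonneg n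
  have := hC χ 0 (by rw [zero_add]; exact M.eigen.mem)
  rw [wnorm_zero, add_zero] at this
  exact this.trans_lt (ENNReal.mul_lt_top ENNReal.coe_lt_top enorm_lt_top)

theorem wnorm_proj_le (M : Confined W R lam χ) (n : ℕ) (f : L2) :
    wnorm n (eigenProj (schrodinger W) lam f) ≤ wnorm n χ * ‖f‖ₑ := by
  rw [M.eigen.proj]
  refine (wnorm_smul_le _ _ _).trans ?_
  rw [mul_comm]
  gcongr
  have := norm_inner_le_norm (𝕜 := ℂ) χ f
  rw [M.eigen.norm_eq, one_mul] at this
  rw [enorm_le_iff_norm_le]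
  exact this

/-- Since $(H-\lambda)Sf=f-Pf$, the weighted estimate bounds $Sf$ by $f$ and $Pf$, and $Pf$ is a
multiple of the decaying eigenfunction. -/
theorem wnorm_reducedResolvent_le (M : Confined W R lam χ) (n : ℕ) :
    ∃ C : NNReal, ∀ f, wnorm n (reducedResolvent (schrodinger W) lam f) ≤ C * wnorm n f := by
  obtain ⟨C, hC⟩ := wnorm_le_of_mem_graph M.polyBdd M.nonneg M.grow M.eigen.lam_nonneg n
  have hχ := M.mem_rapid_eigen n
  refine ⟨C * ‖reducedResolvent (schrodinger W) lam‖₊ + (1 + (wnorm n χ).toNNReal), fun f => ?_⟩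
  refine (hC _ _ (M.eigen.mem_graph_reducedResolvent f)).trans ?_
  push_cast
  rw [add_mul, add_mul, one_mul, ENNReal.coe_toNNReal hχ.ne]
  refine add_le_add ?_ ?_
  · rw [mul_assoc]
    refine mul_le_mul_right ((ContinuousLinearMap.le_opENorm _ _).trans ?_) _
    exact mul_le_mul_right (enorm_le_wnorm n f) _
  · rw [sub_eq_add_neg]
    refine (wnorm_add_le _ _ _).trans ?_
    gcongr
    rw [← neg_one_smul ℂ]
    refine (wnorm_smul_le _ _ _).trans ?_
    rw [enorm_neg, enorm_one, one_mul]
    refine (M.wnorm_proj_le n f).trans ?_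
    gcongr
    exact enorm_le_wnorm n f

theorem wnorm_redPow_le (M : Confined W R lam χ) (n k : ℕ) :
    ∃ C : NNReal, ∀ f, wnorm n (redPow (schrodinger W) lam k f) ≤ C * wnorm n f := by
  rcases k with _ | k
  · have hχ := M.mem_rapid_eigen n
    refine ⟨(wnorm n χ).toNNReal, fun f => ?_⟩
    rw [redPow, neg_apply, ← neg_one_smul ℂ, ENNReal.coe_toNNReal hχ.ne]
    refine (wnorm_smul_le _ _ _).trans ?_
    rw [enorm_neg, enorm_one, one_mul]
    refine (M.wnorm_proj_le n f).trans ?_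
    gcongr
    exact enorm_le_wnorm n f
  · obtain ⟨C, hC⟩ := M.wnorm_reducedResolvent_le n
    refine ⟨C ^ (k + 1), fun f => ?_⟩
    rw [redPow]
    generalize k + 1 = m
    induction m with
    | zero => simp
    | succ m ih =>
      rw [pow_succ', pow_succ', mul_apply_eq_comp, ENNReal.coe_mul, mul_assoc]
      exact (hC _).trans (mul_le_mul_right ih _)

theorem inner_redPow (M : Confined W R lam χ) (k : ℕ) (f g : L2) :
    inner ℂ (redPow (schrodinger W) lam k f) g = inner ℂ f (redPow (schrodinger W) lam k g) := by
  rcases k with _ | k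
  · rw [redPow, neg_apply, neg_apply, inner_neg_left, inner_neg_right, M.eigen.inner_proj]
  · rw [redPow]
    generalize k + 1 = m
    induction m generalizing f g with
    | zero => simp
    | succ m ih =>
      rw [pow_succ, mul_apply_eq_comp, ih, M.eigen.inner_reducedResolvent, ← mul_apply_eq_comp,
        ← pow_succ', pow_succ]

/-- This and the next two lemmas are $(H-\lambda)S^0=0$, $(H-\lambda)S=1+S^0$ and
$(H-\lambda)S^{k+2}=S^{k+1}$. The sign in $S^0=-P$ makes the middle one fit the pattern up to the
identity, which is the source of the commutator relations. -/
theorem redPow_zero_mem_graph (M : Confined W R lam χ) (f : L2) :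
    (redPow (schrodinger W) lam 0 f, (lam : ℂ) • redPow (schrodinger W) lam 0 f) ∈
      (schrodinger W).graph := by
  have := (schrodinger W).graph.smul_mem (-(inner ℂ χ f : ℂ)) M.eigen.mem
  rw [redPow, neg_apply, M.eigen.proj, ← neg_smul, smul_comm]
  exact this

theorem redPow_one_mem_graph (M : Confined W R lam χ) (f : L2) :
    (redPow (schrodinger W) lam 1 f, redPow (schrodinger W) lam 0 f + f +
      (lam : ℂ) • redPow (schrodinger W) lam 1 f) ∈ (schrodinger W).graph := by
  have := M.eigen.mem_graph_reducedResolvent f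
  rw [redPow, redPow, zero_add, pow_one, neg_apply, neg_add_eq_sub]
  exact this

theorem redPow_add_two_mem_graph (M : Confined W R lam χ) (k : ℕ) (f : L2) :
    (redPow (schrodinger W) lam (k + 2) f, redPow (schrodinger W) lam (k + 1) f +
      (lam : ℂ) • redPow (schrodinger W) lam (k + 2) f) ∈ (schrodinger W).graph := by
  have h1 := M.eigen.mem_graph_reducedResolvent (redPow (schrodinger W) lam (k + 1) f)
  have h2 : eigenProj (schrodinger W) lam (redPow (schrodinger W) lam (k + 1) f) = 0 := by
    rw [M.eigen.proj, ← M.inner_redPow, redPow, pow_succ, mul_apply_eq_comp,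
      M.eigen.reducedResolvent_apply, map_zero, inner_zero_left, zero_smul]
  rw [h2, sub_zero] at h1
  have h3 : reducedResolvent (schrodinger W) lam (redPow (schrodinger W) lam (k + 1) f) =
      redPow (schrodinger W) lam (k + 2) f := by
    rw [redPow, redPow, ← mul_apply_eq_comp, ← pow_succ']
  rwa [h3] at h1

/-- The restriction of `S ^ k` (with `S ^ 0 = -P`) to rapidly decreasing functions. -/
def red (M : Confined W R lam χ) (k : ℕ) : Module.End ℂ rapid :=
  (redPow (schrodinger W) lam k : L2 →ₗ[ℂ] L2).restrict fun f hf n => by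
    obtain ⟨C, hC⟩ := M.wnorm_redPow_le n k
    exact (hC f).trans_lt (ENNReal.mul_lt_top ENNReal.coe_lt_top (hf n))

theorem coe_red (M : Confined W R lam χ) (k : ℕ) (f : rapid) :
    (M.red k f : L2) = redPow (schrodinger W) lam k f := rfl

end Confined

/-! ### Families of operators on rapidly decreasing functions -/

variable {ι : Type*}

/-- Uniformly continuous families. -/
def Tame (T : ι → Module.End ℂ rapid) : Prop :=
  ∀ n, ∃ (m : ℕ) (C : NNReal), ∀ i f, wnorm n (T i f) ≤ C * wnorm m (f : L2)

/-- Uniformly smoothing families of finite rank operators. -/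
structure Smoothing (T : ι → Module.End ℂ rapid) : Prop where
  bound : ∀ n, ∃ C : NNReal, ∀ i f, wnorm n (T i f) ≤ C * ‖(f : L2)‖ₑ
  finite : ∀ i, FiniteDimensional ℂ (LinearMap.range (T i))

theorem Tame.mul {A B : ι → Module.End ℂ rapid} (hA : Tame A) (hB : Tame B) :
    Tame fun i => A i * B i := fun n => by
  obtain ⟨m, C, h⟩ := hA n
  obtain ⟨m', C', h'⟩ := hB m
  refine ⟨m', C * C', fun i f => ?_⟩
  rw [ENNReal.coe_mul, mul_assoc]
  exact (h i _).trans (mul_le_mul_right (h' i f) _)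

theorem Tame.add {A B : ι → Module.End ℂ rapid} (hA : Tame A) (hB : Tame B) :
    Tame fun i => A i + B i := fun n => by
  obtain ⟨m, C, h⟩ := hA n
  obtain ⟨m', C', h'⟩ := hB n
  refine ⟨max m m', C + C', fun i f => ?_⟩
  rw [ENNReal.coe_add, add_mul]
  refine (wnorm_add_le _ _ _).trans (add_le_add ((h i f).trans ?_) ((h' i f).trans ?_))
  · exact mul_le_mul_right (wnorm_mono (le_max_left _ _) _) _
  · exact mul_le_mul_right (wnorm_mono (le_max_right _ _) _) _

theorem Tame.zero : Tame fun _ : ι => (0 : Module.End ℂ rapid) := fun n =>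
  ⟨0, 0, fun i f => by
    have : wnorm n ((0 : Module.End ℂ rapid) f : L2) = 0 := wnorm_zero n
    rw [this]
    exact zero_le⟩

theorem Tame.sum {κ : Type*} (s : Finset κ) {A : κ → ι → Module.End ℂ rapid}
    (h : ∀ k ∈ s, Tame (A k)) : Tame fun i => ∑ k ∈ s, A k i := by
  classical
  induction s using Finset.induction_on with
  | empty => simpa using Tame.zero
  | insert a s ha ih =>
    simp_rw [Finset.sum_insert ha]
    exact (h a (Finset.mem_insert_self a s)).add
      (ih fun k hk => h k (Finset.mem_insert_of_mem hk))

theorem Tame.mul_smoothing {A B : ι → Module.End ℂ rapid} (hA : Tame A) (hB : Smoothing B) :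
    Smoothing fun i => A i * B i where
  bound n := by
    obtain ⟨m, C, h⟩ := hA n
    obtain ⟨C', h'⟩ := hB.bound m
    refine ⟨C * C', fun i f => ?_⟩
    rw [ENNReal.coe_mul, mul_assoc]
    exact (h i _).trans (mul_le_mul_right (h' i f) _)
  finite i := by
    have := hB.finite i
    rw [Module.End.mul_eq_comp, LinearMap.range_comp]
    infer_instance

theorem Smoothing.add {A B : ι → Module.End ℂ rapid} (hA : Smoothing A) (hB : Smoothing B) :
    Smoothing fun i => A i + B i where
  bound n := by
    obtain ⟨C, h⟩ := hA.bound n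
    obtain ⟨C', h'⟩ := hB.bound n
    refine ⟨C + C', fun i f => ?_⟩
    rw [ENNReal.coe_add, add_mul]
    exact (wnorm_add_le _ _ _).trans (add_le_add (h i f) (h' i f))
  finite i := by
    have := hA.finite i
    have := hB.finite i
    exact Submodule.finiteDimensional_of_le (LinearMap.range_add_le _ _)

theorem Smoothing.zero : Smoothing fun _ : ι => (0 : Module.End ℂ rapid) where
  bound n := ⟨0, fun i f => by
    have : wnorm n ((0 : Module.End ℂ rapid) f : L2) = 0 := wnorm_zero n
    rw [this]
    exact zero_le⟩
  finite i := by
    rw [LinearMap.range_zero]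
    infer_instance

theorem Smoothing.sum {κ : Type*} (s : Finset κ) {A : κ → ι → Module.End ℂ rapid}
    (h : ∀ k ∈ s, Smoothing (A k)) : Smoothing fun i => ∑ k ∈ s, A k i := by
  classical
  induction s using Finset.induction_on with
  | empty => simpa using Smoothing.zero
  | insert a s ha ih =>
    simp_rw [Finset.sum_insert ha]
    exact (h a (Finset.mem_insert_self a s)).add
      (ih fun k hk => h k (Finset.mem_insert_of_mem hk))

theorem Smoothing.smul {A : ι → Module.End ℂ rapid} (hA : Smoothing A) (c : ℂ) :
    Smoothing fun i => c • A i where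
  bound n := by
    obtain ⟨C, h⟩ := hA.bound n
    refine ⟨‖c‖₊ * C, fun i f => ?_⟩
    rw [ENNReal.coe_mul, mul_assoc]
    exact (wnorm_smul_le _ _ _).trans (mul_le_mul_right (h i f) _)
  finite i := by
    have := hA.finite i
    refine Submodule.finiteDimensional_of_le (S₂ := LinearMap.range (A i)) ?_
    rintro _ ⟨f, rfl⟩
    exact Submodule.smul_mem _ _ ⟨f, rfl⟩

theorem Confined.tame_red (M : Confined W R lam χ) (k : ℕ) : Tame fun _ : ι => M.red k := fun n =>
  let ⟨C, h⟩ := M.wnorm_redPow_le n k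
  ⟨n, C, fun _ f => h f⟩

theorem tame_mulRapid {V : ι → Plane → ℝ} (hV : ∀ i, PolyBdd (V i))
    (hb : ∃ (C : NNReal) (m : ℕ), ∀ i, ∀ᵐ x, |V i x| ≤ C * wt x ^ m) :
    Tame fun i => mulRapid (hV i) := fun n => by
  obtain ⟨C, m, h⟩ := hb
  exact ⟨n + m, C, fun i f => wnorm_mul_le (coeFn_mulRapid (hV i) f) (h i) n⟩

/-- Cutting with the eigenprojection yields smoothing families. -/
theorem Confined.smoothing_red_zero_mul (M : Confined W R lam χ) {T T' : ι → Module.End ℂ rapid}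
    (hT' : Tame T')
    (hadj : ∀ i (f g : rapid), inner ℂ (g : L2) (T i f : L2) = inner ℂ (T' i g : L2) (f : L2)) :
    Smoothing fun i => M.red 0 * T i where
  bound n := by
    obtain ⟨m, C, h⟩ := hT' 0
    have hχ := M.mem_rapid_eigen
    refine ⟨C * (wnorm m χ).toNNReal * (wnorm n χ).toNNReal, fun i f => ?_⟩
    -- Moving $T$ onto the eigenfunction leaves a rank one operator whose norm involves only
    -- $T'\chi$ and weighted norms of $\chi$.
    have e : ((M.red 0 * T i) f : L2) = -(inner ℂ (T' i ⟨χ, hχ⟩ : L2) (f : L2) : ℂ) • χ := by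
      rw [← hadj, Module.End.mul_apply, M.coe_red, redPow, neg_apply, M.eigen.proj, neg_smul]
    rw [e]
    refine (wnorm_smul_le _ _ _).trans ?_
    rw [enorm_neg]
    have h1 : ‖(inner ℂ (T' i ⟨χ, hχ⟩ : L2) (f : L2) : ℂ)‖ₑ ≤
        ‖(T' i ⟨χ, hχ⟩ : L2)‖ₑ * ‖(f : L2)‖ₑ := by
      have h2 : ‖(inner ℂ (T' i ⟨χ, hχ⟩ : L2) (f : L2) : ℂ)‖₊ ≤
        ‖(T' i ⟨χ, hχ⟩ : L2)‖₊ * ‖(f : L2)‖₊ := norm_inner_le_norm _ _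
      have h3 := ENNReal.coe_le_coe.2 h2
      rwa [ENNReal.coe_mul] at h3
    have h2 := h i ⟨χ, hχ⟩
    rw [wnorm_zero_left] at h2
    push_cast
    rw [ENNReal.coe_toNNReal (hχ m).ne, ENNReal.coe_toNNReal (hχ n).ne]
    calc _ ≤ ‖(T' i ⟨χ, hχ⟩ : L2)‖ₑ * ‖(f : L2)‖ₑ * wnorm n χ := by gcongr
      _ ≤ (C * wnorm m χ) * ‖(f : L2)‖ₑ * wnorm n χ := by gcongr
      _ = _ := by ring
  finite i := by
    refine Submodule.finiteDimensional_of_le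
      (S₂ := Submodule.span ℂ {(⟨χ, M.mem_rapid_eigen⟩ : rapid)}) ?_
    rintro _ ⟨f, rfl⟩
    rw [Submodule.mem_span_singleton]
    refine ⟨-(inner ℂ χ (T i f : L2) : ℂ), Subtype.ext ?_⟩
    rw [Module.End.mul_apply, M.coe_red, redPow, neg_apply, M.eigen.proj, ← neg_smul]
    rfl

/-! ### The coefficients of the perturbation series -/

/-- The series `∑ z^k ∑_{ν₀ + ⋯ + νₙ = k} S^{ν₀} V ⋯ V S^{νₙ}`. -/
def Confined.series (M : Confined W R lam χ) (v : Module.End ℂ rapid) (n : ℕ) :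
    PowerSeries (Module.End ℂ rapid) :=
  PowerSeries.mk M.red * (PowerSeries.C v * PowerSeries.mk M.red) ^ n

/-- The sum of all words with `n` factors `V` and total exponent `k`. -/
def Confined.wsum (M : Confined W R lam χ) (v : Module.End ℂ rapid) (n k : ℕ) :
    Module.End ℂ rapid :=
  PowerSeries.coeff k (M.series v n)

namespace Confined

variable (M : Confined W R lam χ) (v : Module.End ℂ rapid)

theorem wsum_zero (k : ℕ) : M.wsum v 0 k = M.red k := by
  rw [wsum, series, pow_zero, mul_one, PowerSeries.coeff_mk]

theorem wsum_succ (n k : ℕ) : M.wsum v (n + 1) k =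
    ∑ p ∈ Finset.HasAntidiagonal.antidiagonal k, M.red p.1 * (v * M.wsum v n p.2) := by
  rw [wsum, series, pow_succ', mul_assoc, ← series, PowerSeries.coeff_mul]
  refine Finset.sum_congr rfl fun p _ => ?_
  rw [PowerSeries.coeff_mk, PowerSeries.coeff_C_mul]
  rfl

/-- Peeling a factor off the right end. Taking adjoints reverses words, so comparison with the left
recursion proves symmetry of the sums. -/
theorem wsum_succ' (n k : ℕ) : M.wsum v (n + 1) k =
    ∑ p ∈ Finset.HasAntidiagonal.antidiagonal k, M.wsum v n p.1 * (v * M.red p.2) := by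
  rw [wsum, series, pow_succ, ← mul_assoc, ← series, PowerSeries.coeff_mul]
  refine Finset.sum_congr rfl fun p _ => ?_
  rw [PowerSeries.coeff_C_mul, PowerSeries.coeff_mk]
  rfl

theorem inner_wsum (hv : ∀ f g : rapid, inner ℂ (v f : L2) (g : L2) = inner ℂ (f : L2) (v g : L2))
    (n k : ℕ) (f g : rapid) :
    inner ℂ (M.wsum v n k f : L2) (g : L2) = inner ℂ (f : L2) (M.wsum v n k g : L2) := by
  induction n generalizing k f g with
  | zero =>
    rw [wsum_zero, coe_red, coe_red, M.inner_redPow]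
  | succ n ih =>
    have e1 : (M.wsum v (n + 1) k f : L2) = ∑ p ∈ Finset.HasAntidiagonal.antidiagonal k,
        (M.red p.1 (v (M.wsum v n p.2 f)) : L2) := by
      rw [wsum_succ, LinearMap.sum_apply, Submodule.coe_sum]
      rfl
    have e2 : (M.wsum v (n + 1) k g : L2) = ∑ p ∈ Finset.HasAntidiagonal.antidiagonal k,
        (M.wsum v n p.2 (v (M.red p.1 g)) : L2) := by
      rw [wsum_succ', LinearMap.sum_apply, Submodule.coe_sum,
        ← Finset.Nat.sum_antidiagonal_swap]
      rfl
    rw [e1, e2, sum_inner, inner_sum]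
    refine Finset.sum_congr rfl fun p _ => ?_
    rw [coe_red, M.inner_redPow, ← coe_red, hv, ih]

end Confined

end Words

/-! ### Words on rapidly decreasing functions and the coefficients they define -/

section Words

variable {W : Plane → ℝ} {R : L2 →L[ℂ] L2} {lam : ℝ} {χ : L2} {ι : Type*}

theorem sum_antidiagonalTuple_succ {E : Type*} [AddCommMonoid E] (m k : ℕ)
    (F : (Fin (m + 1) → ℕ) → E) :
    ∑ ν ∈ Finset.Nat.antidiagonalTuple (m + 1) k, F ν =
      ∑ p ∈ Finset.HasAntidiagonal.antidiagonal k,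
        ∑ μ ∈ Finset.Nat.antidiagonalTuple m p.2, F (Fin.cons p.1 μ) := by
  rw [Finset.sum_sigma']
  refine Finset.sum_bij' (fun ν _ => ⟨(ν 0, k - ν 0), Fin.tail ν⟩)
    (fun q _ => Fin.cons q.1.1 q.2) ?_ ?_ ?_ ?_ ?_
  · intro ν hν
    rw [Finset.Nat.mem_antidiagonalTuple, Fin.sum_univ_succ] at hν
    simp only [Finset.mem_sigma, Finset.HasAntidiagonal.mem_antidiagonal,
      Finset.Nat.mem_antidiagonalTuple]
    have : ∑ i, Fin.tail ν i = ∑ i : Fin m, ν i.succ := rfl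
    omega
  · rintro ⟨⟨a, b⟩, μ⟩ hq
    simp only [Finset.mem_sigma, Finset.HasAntidiagonal.mem_antidiagonal,
      Finset.Nat.mem_antidiagonalTuple] at hq
    rw [Finset.Nat.mem_antidiagonalTuple, Fin.sum_univ_succ]
    simp only [Fin.cons_zero, Fin.cons_succ]
    omega
  · intro ν hν
    exact Fin.cons_self_tail ν
  · rintro ⟨⟨a, b⟩, μ⟩ hq
    simp only [Finset.mem_sigma, Finset.HasAntidiagonal.mem_antidiagonal,
      Finset.Nat.mem_antidiagonalTuple] at hq
    simp only [Fin.cons_zero, Fin.tail_cons]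
    have : k - a = b := by omega
    rw [this]
  · intro ν hν
    simp only [Fin.cons_self_tail]

namespace Confined

/-- The word `S^{ν₀} V S^{ν₁} V ⋯ V S^{νⱼ}` on rapidly decreasing functions. -/
def wordEnd (M : Confined W R lam χ) (v : Module.End ℂ rapid) :
    (j : ℕ) → (Fin (j + 1) → ℕ) → Module.End ℂ rapid
  | 0, ν => M.red (ν 0)
  | j + 1, ν => M.red (ν 0) * (v * M.wordEnd v j (Fin.tail ν))

/-- Every factor preserves `rapid`, so rapidly decreasing functions lie in the maximal domain of the
word and no domain question remains for test functions. -/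
theorem word_mem_graph (M : Confined W R lam χ) {V : Plane → ℝ} (hV : PolyBdd V) (j : ℕ)
    (ν : Fin (j + 1) → ℕ) (f : rapid) :
    ((f : L2), (M.wordEnd (mulRapid hV) j ν f : L2)) ∈ (word (schrodinger W) lam V j ν).graph := by
  induction j with
  | zero => exact mem_graph_ofBounded.2 (M.coe_red _ f).symm
  | succ j ih =>
    refine mem_graph_pcomp.2 ⟨_, mem_graph_pcomp.2 ⟨_, ih (Fin.tail ν), mulRapid_mem_graph hV _⟩,
      mem_graph_ofBounded.2 ?_⟩
    exact (M.coe_red _ _).symm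

theorem sum_wordEnd (M : Confined W R lam χ) (v : Module.End ℂ rapid) (j k : ℕ) :
    ∑ ν ∈ Finset.Nat.antidiagonalTuple (j + 1) k, M.wordEnd v j ν = M.wsum v j k := by
  induction j generalizing k with
  | zero =>
    rw [Finset.Nat.antidiagonalTuple_one, Finset.sum_singleton, wsum_zero]
    rfl
  | succ j ih =>
    rw [sum_antidiagonalTuple_succ, wsum_succ]
    refine Finset.sum_congr rfl fun p _ => ?_
    rw [← ih, Finset.mul_sum, Finset.mul_sum]
    refine Finset.sum_congr rfl fun μ _ => ?_
    simp only [wordEnd, Fin.cons_zero, Fin.tail_cons]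

/-- The coefficient `Q_j` on rapidly decreasing functions. -/
def coeffEnd (M : Confined W R lam χ) (v : Module.End ℂ rapid) (j : ℕ) : Module.End ℂ rapid :=
  (-1 : ℂ) ^ (j + 1) • M.wsum v j j

theorem coeffEnd_mem_graph (M : Confined W R lam χ) {V : Plane → ℝ} (hV : PolyBdd V) (j : ℕ)
    (f : rapid) : ((f : L2), (M.coeffEnd (mulRapid hV) j f : L2)) ∈
      (preCoeff (schrodinger W) lam V j).graph := by
  refine mem_graph_const_smul _ ?_
  have : (M.wsum (mulRapid hV) j j f : L2) =
      ∑ ν ∈ Finset.Nat.antidiagonalTuple (j + 1) j, (M.wordEnd (mulRapid hV) j ν f : L2) := by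
    rw [← sum_wordEnd, LinearMap.sum_apply, Submodule.coe_sum]
  rw [this]
  exact mem_graph_sum _ fun ν _ => M.word_mem_graph hV j ν f

theorem tame_wsum (M : Confined W R lam χ) {v : ι → Module.End ℂ rapid} (hv : Tame v) (n k : ℕ) :
    Tame fun i => M.wsum (v i) n k := by
  induction n generalizing k with
  | zero =>
    simp_rw [wsum_zero]
    exact M.tame_red k
  | succ n ih =>
    simp_rw [wsum_succ]
    exact Tame.sum _ fun p _ => (M.tame_red p.1).mul (hv.mul (ih p.2))

/-- With $n+1$ exponents of total at most $n$, one of them is zero and the word contains $-P$. In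
the induction, either the tail already has such an exponent or the first exponent is zero, in which
case the tail is moved to the other side by its adjoint. -/
theorem smoothing_wsum (M : Confined W R lam χ) {v : ι → Module.End ℂ rapid} (hv : Tame v)
    (hs : ∀ i (f g : rapid), inner ℂ (v i f : L2) (g : L2) = inner ℂ (f : L2) (v i g : L2))
    {n k : ℕ} (hk : k ≤ n) : Smoothing fun i => M.wsum (v i) n k := by
  induction n generalizing k with
  | zero =>
    obtain rfl := Nat.le_zero.1 hk
    simp_rw [wsum_zero]
    have := M.smoothing_red_zero_mul (T := fun _ : ι => 1) (T' := fun _ => 1)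
      (fun n => ⟨n, 1, fun i f => by simp⟩) (fun i f g => rfl)
    simpa using this
  | succ n ih =>
    simp_rw [wsum_succ]
    refine Smoothing.sum _ fun p hp => ?_
    rw [Finset.HasAntidiagonal.mem_antidiagonal] at hp
    rcases le_or_gt p.2 n with h | h
    · exact (M.tame_red p.1).mul_smoothing (hv.mul_smoothing (ih h))
    · have h0 : p.1 = 0 := by omega
      rw [h0]
      refine M.smoothing_red_zero_mul (T' := fun i => M.wsum (v i) n p.2 * v i)
        ((M.tame_wsum hv n p.2).mul hv) fun i f g => ?_
      rw [Module.End.mul_apply, Module.End.mul_apply, ← hs, M.inner_wsum _ (hs i)]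

theorem smoothing_coeffEnd (M : Confined W R lam χ) {v : ι → Module.End ℂ rapid} (hv : Tame v)
    (hs : ∀ i (f g : rapid), inner ℂ (v i f : L2) (g : L2) = inner ℂ (f : L2) (v i g : L2))
    (j : ℕ) : Smoothing fun i => M.coeffEnd (v i) j :=
  (M.smoothing_wsum hv hs le_rfl).smul _

theorem inner_coeffEnd (M : Confined W R lam χ) {v : Module.End ℂ rapid}
    (hs : ∀ f g : rapid, inner ℂ (v f : L2) (g : L2) = inner ℂ (f : L2) (v g : L2))
    (j : ℕ) (f g : rapid) :
    inner ℂ (M.coeffEnd v j f : L2) (g : L2) = inner ℂ (f : L2) (M.coeffEnd v j g : L2) := by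
  simp only [coeffEnd, LinearMap.smul_apply, Submodule.coe_smul, inner_smul_left,
    inner_smul_right, M.inner_wsum v hs]
  congr 1
  rw [map_pow, map_neg, map_one]

/-! ### Commutation with the unperturbed operator -/

/-- Applying $H-\lambda$ lowers the leading exponent by one. Leading exponent $0$ is annihilated,
and leading exponent $1$ leaves an extra identity term, which accounts for $v$ times the shorter
words. -/
theorem wsum_mem_graph (M : Confined W R lam χ) (v : Module.End ℂ rapid) (n k : ℕ) (f : rapid) :
    ((M.wsum v (n + 1) (k + 1) f : L2), (M.wsum v (n + 1) k f : L2) + (v (M.wsum v n k f) : L2) +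
      (lam : ℂ) • (M.wsum v (n + 1) (k + 1) f : L2)) ∈ (schrodinger W).graph := by
  have e1 : (M.wsum v (n + 1) (k + 1) f : L2) =
      redPow (schrodinger W) lam 0 (v (M.wsum v n (k + 1) f)) +
      ∑ p ∈ Finset.HasAntidiagonal.antidiagonal k,
        redPow (schrodinger W) lam (p.1 + 1) (v (M.wsum v n p.2 f)) := by
    rw [wsum_succ, Finset.Nat.sum_antidiagonal_succ, LinearMap.add_apply, LinearMap.sum_apply,
      Submodule.coe_add, Submodule.coe_sum]
    rfl
  have e2 : (M.wsum v (n + 1) k f : L2) + (v (M.wsum v n k f) : L2) =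
      ∑ p ∈ Finset.HasAntidiagonal.antidiagonal k,
        (redPow (schrodinger W) lam p.1 (v (M.wsum v n p.2 f)) +
          if p.1 = 0 then (v (M.wsum v n p.2 f) : L2) else 0) := by
    rw [Finset.sum_add_distrib]
    congr 1
    · rw [wsum_succ, LinearMap.sum_apply, Submodule.coe_sum]
      rfl
    · rw [Finset.sum_eq_single (0, k)]
      · simp
      · rintro ⟨a, b⟩ hp hne
        rw [Finset.HasAntidiagonal.mem_antidiagonal] at hp
        rw [if_neg]
        rintro (h : a = 0)
        apply hne
        simp only at hp
        rw [Prod.mk.injEq]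
        omega
      · intro h
        exact absurd (Finset.HasAntidiagonal.mem_antidiagonal.2 (zero_add k)) h
  rw [e2, e1, smul_add, add_left_comm, Finset.smul_sum, ← Finset.sum_add_distrib]
  have hterm : ∀ a (g : L2), (redPow (schrodinger W) lam (a + 1) g,
      redPow (schrodinger W) lam a g + (if a = 0 then g else 0) +
        (lam : ℂ) • redPow (schrodinger W) lam (a + 1) g) ∈ (schrodinger W).graph := by
    intro a g
    rcases a with _ | a
    · rw [if_pos rfl]
      exact M.redPow_one_mem_graph g
    · rw [if_neg (Nat.succ_ne_zero a), add_zero]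
      exact M.redPow_add_two_mem_graph a g
  have h1 := (schrodinger W).graph.sum_mem (t := Finset.HasAntidiagonal.antidiagonal k)
    fun p _ => hterm p.1 (v (M.wsum v n p.2 f))
  have h2 := (schrodinger W).graph.add_mem
    (M.redPow_zero_mem_graph (v (M.wsum v n (k + 1) f))) h1
  convert h2 using 1
  rw [Prod.ext_iff]
  constructor
  · simp only [Prod.fst_add, Prod.fst_sum]
  · simp only [Prod.snd_add, Prod.snd_sum]

/-- The adjoint of the previous relation: all sums and $H$ are symmetric, so the identity is tested
against rapidly decreasing functions. -/
theorem wsum_apply_sub (M : Confined W R lam χ) {v : Module.End ℂ rapid}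
    (hs : ∀ f g : rapid, inner ℂ (v f : L2) (g : L2) = inner ℂ (f : L2) (v g : L2))
    (n k : ℕ) {f g : rapid} (hfg : ((f : L2), (g : L2)) ∈ (schrodinger W).graph) :
    M.wsum v (n + 1) (k + 1) g = M.wsum v (n + 1) k f + M.wsum v n k (v f) +
      (lam : ℂ) • M.wsum v (n + 1) (k + 1) f := by
  refine Subtype.ext (sub_eq_zero.1 (eq_zero_of_inner_rapid fun h hh => ?_))
  lift h to rapid using hh
  have h1 := M.eigen.posSA.symm (M.wsum_mem_graph v n k h) hfg
  rw [M.inner_wsum v hs, inner_add_left, inner_add_left, inner_smul_left, M.inner_wsum v hs,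
    M.inner_wsum v hs, hs, M.inner_wsum v hs, Complex.conj_ofReal] at h1
  rw [inner_sub_right, h1]
  simp only [Submodule.coe_add, Submodule.coe_smul, inner_add_right, inner_smul_right]
  ring

/-- $[H,Q_{j+1}]=-[V,Q_j]$: subtracting the left and right relations cancels both the common sum
with lower total exponent and the $\lambda$ terms, leaving $v$ times the words minus the words times
$v$. The sign is that of $(-1)^{j+2}$ against $(-1)^{j+1}$. -/
theorem coeffEnd_commutator (M : Confined W R lam χ) {v : Module.End ℂ rapid}
    (hs : ∀ f g : rapid, inner ℂ (v f : L2) (g : L2) = inner ℂ (f : L2) (v g : L2))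
    (j : ℕ) {f g : rapid} (hfg : ((f : L2), (g : L2)) ∈ (schrodinger W).graph) :
    ((M.coeffEnd v (j + 1) f : L2), (M.coeffEnd v (j + 1) g -
      (v (M.coeffEnd v j f) - M.coeffEnd v j (v f)) : rapid).1) ∈ (schrodinger W).graph := by
  have h1 := (schrodinger W).graph.smul_mem ((-1 : ℂ) ^ (j + 1 + 1)) (M.wsum_mem_graph v j j f)
  have h2 := M.wsum_apply_sub hs j j hfg
  convert h1 using 1
  refine Prod.ext rfl ?_
  simp only [coeffEnd, LinearMap.smul_apply, h2, map_smul, Prod.smul_snd]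
  push_cast
  rw [pow_succ (-1 : ℂ) (j + 1)]
  module

theorem coeffEnd_zero_commutator (M : Confined W R lam χ) (v : Module.End ℂ rapid)
    {f g : rapid} (hfg : ((f : L2), (g : L2)) ∈ (schrodinger W).graph) :
    ((M.coeffEnd v 0 f : L2), (M.coeffEnd v 0 g : L2)) ∈ (schrodinger W).graph := by
  have h0 : ∀ f : rapid, (M.coeffEnd v 0 f : L2) = (inner ℂ χ (f : L2) : ℂ) • χ := fun f => by
    rw [coeffEnd, wsum_zero, LinearMap.smul_apply, Submodule.coe_smul, coe_red, redPow, neg_apply,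
      M.eigen.proj]
    simp
  have h1 := M.eigen.posSA.symm M.eigen.mem hfg
  rw [h0, h0, h1, inner_smul_left, Complex.conj_ofReal, mul_comm, mul_smul]
  exact (schrodinger W).graph.smul_mem _ M.eigen.mem

end Confined

/-! ### Extension to `L²` -/

theorem dense_rapid : Dense (rapid : Set L2) := by
  have : rapid.topologicalClosure = ⊤ := by
    rw [Submodule.topologicalClosure_eq_top_iff, Submodule.eq_bot_iff]
    intro f hf
    exact eq_zero_of_inner_rapid fun g hg => (Submodule.mem_orthogonal _ _).1 hf g hg
  exact Submodule.dense_iff_topologicalClosure_eq_top.2 this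

theorem exists_extension {T : Module.End ℂ rapid} {C : NNReal}
    (hT : ∀ f, ‖(T f : L2)‖ₑ ≤ C * ‖(f : L2)‖ₑ) :
    ∃ Q : L2 →L[ℂ] L2, ∀ f : rapid, Q f = T f := by
  let T' : rapid →L[ℂ] L2 := (rapid.subtype ∘ₗ T).mkContinuous C fun f => by
    have h : ‖(T f : L2)‖₊ ≤ C * ‖(f : L2)‖₊ := by
      have := hT f
      simp only [enorm] at this
      exact_mod_cast this
    exact h
  refine ⟨T'.extend rapid.subtypeL, fun f => ?_⟩
  exact ContinuousLinearMap.extend_eq T' (by simpa [DenseRange] using dense_rapid)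
    rapid.subtypeₗᵢ.isometry.isUniformInducing f

/-- Density of test functions, expressed through the adjoint of the difference. It gives uniqueness
of the continuous extension. -/
theorem eq_of_forall_test {Q Q' : L2 →L[ℂ] L2}
    (h : ∀ (f : L2) (φ : Plane → ℂ), IsTest φ → f =ᵐ[volume] φ → Q f = Q' f) : Q = Q' := by
  have h1 : ContinuousLinearMap.adjoint (Q - Q') = 0 := by
    ext1 g
    refine eq_zero_of_inner_test fun f φ hφ hf => ?_
    rw [ContinuousLinearMap.adjoint_inner_right, sub_apply, h f φ hφ hf, sub_self, inner_zero_left]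
  rw [← sub_eq_zero]
  exact (map_eq_zero_iff _ ContinuousLinearMap.adjoint.injective).1 h1

/-- An $L^2$ bound on `rapid` makes an extension exist and uniqueness identifies it with the chosen
one, so the choice operator in `coeff` carries no ambiguity. -/
theorem coeff_eq {H : L2 →ₗ.[ℂ] L2} {V : Plane → ℝ} {j : ℕ} {T : Module.End ℂ rapid} {C : NNReal}
    (hT : ∀ f, ‖(T f : L2)‖ₑ ≤ C * ‖(f : L2)‖ₑ)
    (hg : ∀ f : rapid, ((f : L2), (T f : L2)) ∈ (preCoeff H lam V j).graph) (f : rapid) :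
    coeff H lam V j f = T f := by
  obtain ⟨Q, hQ⟩ := exists_extension hT
  have h1 : IsContinuousExtension (preCoeff H lam V j) Q := fun f φ h1 h2 h3 => by
    have hf : f ∈ rapid := mem_rapid_of_test ⟨h1, h2⟩ h3
    have := hg ⟨f, hf⟩
    rwa [← hQ] at this
  have h2 : IsContinuousExtension (preCoeff H lam V j) (coeff H lam V j) :=
    Classical.epsilon_spec (p := IsContinuousExtension (preCoeff H lam V j)) ⟨Q, h1⟩
  have h3 : coeff H lam V j = Q := eq_of_forall_test fun f φ hφ hf =>
    LinearPMap.mem_graph_snd_inj _ (h2 f φ hφ.smooth hφ.compact hf)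
      (h1 f φ hφ.smooth hφ.compact hf) rfl
  rw [h3, hQ]

theorem wnorm_le_of_dense {Q : L2 →L[ℂ] L2} {n : ℕ} {C : NNReal}
    (h : ∀ f ∈ rapid, wnorm n (Q f) ≤ C * ‖f‖ₑ) (f : L2) : wnorm n (Q f) ≤ C * ‖f‖ₑ := by
  refine wnorm_le_of_forall fun s hs => ?_
  have hcl : IsClosed {f : L2 | ‖mulL2 (cutWt s n) (Q f)‖ₑ ≤ C * ‖f‖ₑ} :=
    isClosed_le (by fun_prop) (ENNReal.continuous_const_mul ENNReal.coe_ne_top |>.comp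
      continuous_enorm)
  exact hcl.closure_subset_iff.2 (fun g hg => (enorm_mulL2_le hs n _).trans (h g hg))
    (dense_rapid f)

end Words

/-! ### Perturbations of a rank one projection -/

open InnerProductSpace in
/-- A self-adjoint compact operator close to a rank one projection has a dominant eigenvector. -/
theorem exists_dominant_eigenvector {T P : L2 →L[ℂ] L2} {χ : L2}
    (hT : ∀ f g, inner ℂ (T f) g = inner ℂ f (T g)) (hK : IsCompactOperator T) (hχ : ‖χ‖ = 1)
    (hP : ∀ f, P f = (inner ℂ χ f : ℂ) • χ) (hd : ‖T - P‖ ≤ 1 / 16) :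
    ∃ (ψ : L2) (m : ℝ), ‖ψ‖ = 1 ∧ T ψ = (m : ℂ) • ψ ∧ 15 / 16 ≤ m ∧ m ≤ 17 / 16 ∧
      ∀ f, inner ℂ ψ f = 0 → ‖T f‖ ≤ 7 / 16 * ‖f‖ := by
  have hdf : ∀ f, ‖T f - P f‖ ≤ 1 / 16 * ‖f‖ := fun f =>
    ((T - P).le_opNorm f).trans (by gcongr)
  have hχ0 : χ ≠ 0 := fun h => by simp [h] at hχ
  have : Nontrivial L2 := ⟨χ, 0, hχ0⟩
  have hχχ : inner ℂ χ χ = (1 : ℂ) := by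
    rw [inner_self_eq_norm_sq_to_K, hχ]
    simp
  have hTn : 15 / 16 ≤ ‖T‖ := by
    have h1 := hdf χ
    rw [hP, hχχ, one_smul, hχ] at h1
    have h2 := norm_sub_norm_le χ (T χ)
    rw [norm_sub_rev] at h2
    have h3 := T.le_opNorm χ
    rw [hχ] at h2 h3
    linarith
  -- For a self-adjoint operator the spectral radius is the norm, and it is attained. The norm is
  -- positive, so compactness turns this spectral value into an eigenvalue.
  obtain ⟨μ, hμ, hμn⟩ := spectrum.exists_nnnorm_eq_spectralRadius T
  rw [ContinuousLinearMap.spectralRadius_eq_nnnorm (T := T)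
    (ContinuousLinearMap.isSelfAdjoint_iff_isSymmetric.2 hT)] at hμn
  have hμT : ‖μ‖ = ‖T‖ := congrArg NNReal.toReal (ENNReal.coe_inj.1 hμn)
  have hμ0 : μ ≠ 0 := fun h => by
    rw [h, norm_zero] at hμT
    linarith
  obtain ⟨u, hu⟩ := ((hK.hasEigenvalue_iff_mem_spectrum hμ0).2 hμ).exists_hasEigenvector
  have hun : ‖u‖ ≠ 0 := norm_ne_zero_iff.2 hu.2
  obtain ⟨ψ, hψ, hTψ⟩ : ∃ ψ : L2, ‖ψ‖ = 1 ∧ T ψ = μ • ψ := by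
    refine ⟨((‖u‖⁻¹ : ℝ) : ℂ) • u, ?_, ?_⟩
    · rw [norm_smul, Complex.norm_real, norm_inv, norm_norm, inv_mul_cancel₀ hun]
    · have : T u = μ • u := hu.apply_eq_smul
      rw [map_smul, this, smul_comm]
  have hψψ : inner ℂ ψ ψ = (1 : ℂ) := by
    rw [inner_self_eq_norm_sq_to_K, hψ]
    simp
  have hreal : starRingEnd ℂ μ = μ := by
    have := hT ψ ψ
    rwa [hTψ, inner_smul_left, inner_smul_right, hψψ, mul_one, mul_one] at this
  obtain ⟨m, rfl⟩ := Complex.conj_eq_iff_real.1 hreal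
  -- The error term is at most $1/16$, so $m\ge-1/16$, which excludes the negative choice
  -- $m\le-15/16$. It also gives $m\le17/16$ and $|\langle\psi,\chi\rangle|^2\ge7/8$.
  have hm : m = ‖(inner ℂ ψ χ : ℂ)‖ ^ 2 + (inner ℂ ψ (T ψ - P ψ) : ℂ).re := by
    rw [inner_sub_right, hTψ, hP, inner_smul_right, inner_smul_right, hψψ, mul_one,
      ← inner_conj_symm χ ψ, Complex.conj_mul']
    rw [Complex.sub_re, Complex.ofReal_re, ← Complex.ofReal_pow, Complex.ofReal_re]
    ring
  have hb : |(inner ℂ ψ (T ψ - P ψ) : ℂ).re| ≤ 1 / 16 := by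
    refine (Complex.abs_re_le_norm _).trans ((norm_inner_le_norm _ _).trans ?_)
    have := hdf ψ
    rw [hψ] at this ⊢
    linarith
  have hc1 : ‖(inner ℂ ψ χ : ℂ)‖ ≤ 1 := by
    have := norm_inner_le_norm (𝕜 := ℂ) ψ χ
    rwa [hψ, hχ, one_mul] at this
  rw [Complex.norm_real, Real.norm_eq_abs] at hμT
  rw [abs_le] at hb
  have hm0 : 15 / 16 ≤ m := by
    rcases abs_cases m with ⟨h1, h2⟩ | ⟨h1, h2⟩
    · linarith
    · nlinarith [sq_nonneg ‖(inner ℂ ψ χ : ℂ)‖]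
  refine ⟨ψ, m, hψ, hTψ, hm0, ?_, fun f hf => ?_⟩
  · nlinarith [norm_nonneg (inner ℂ ψ χ : ℂ)]
  · have h1 : (inner ℂ χ f : ℂ) = inner ℂ (χ - (inner ℂ ψ χ : ℂ) • ψ) f := by
      rw [inner_sub_left, inner_smul_left, hf, mul_zero, sub_zero]
    have h2 : ‖χ - (inner ℂ ψ χ : ℂ) • ψ‖ ^ 2 = 1 - ‖(inner ℂ ψ χ : ℂ)‖ ^ 2 := by
      rw [@norm_sub_sq ℂ, inner_smul_right, ← inner_conj_symm χ ψ, Complex.mul_conj', norm_smul,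
        hψ, hχ, mul_one, ← Complex.ofReal_pow]
      simp only [RCLike.re_to_complex, Complex.ofReal_re]
      ring
    -- The squared norm is at most $1/8\le9/64$. Hence $\|Pf\|\le\frac38\|f\|$ for $f\perp\psi$, and
    -- adding $1/16$ gives $7/16$.
    have h3 : ‖χ - (inner ℂ ψ χ : ℂ) • ψ‖ ≤ 3 / 8 := by
      refine le_of_sq_le_sq ?_ (by norm_num)
      rw [h2]
      linarith
    have h4 : ‖P f‖ ≤ 3 / 8 * ‖f‖ := by
      rw [hP, norm_smul, hχ, mul_one, h1]
      refine (norm_inner_le_norm _ _).trans ?_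
      gcongr
    have h5 := hdf f
    have h6 := norm_add_le (T f - P f) (P f)
    rw [sub_add_cancel] at h6
    linarith

/-- The Riesz projection onto the dominant eigenvector. -/
theorem riesz_eq {T : L2 →L[ℂ] L2} {ψ : L2} {m : ℝ}
    (hT : ∀ f g, inner ℂ (T f) g = inner ℂ f (T g)) (hψ : ‖ψ‖ = 1) (hTψ : T ψ = (m : ℂ) • ψ)
    (hm1 : 15 / 16 ≤ m) (hm2 : m ≤ 17 / 16)
    (hrest : ∀ f, inner ℂ ψ f = 0 → ‖T f‖ ≤ 7 / 16 * ‖f‖) :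
    (Complex.I / (2 * Real.pi)) •
      (∮ z in C((1 : ℂ), 1 / 2), Ring.inverse (T - z • (1 : L2 →L[ℂ] L2))) =
        InnerProductSpace.rankOne ℂ ψ ψ := by
  have hψψ : inner ℂ ψ ψ = (1 : ℂ) := by
    rw [inner_self_eq_norm_sq_to_K, hψ]
    simp
  set p : L2 →L[ℂ] L2 := InnerProductSpace.rankOne ℂ ψ ψ with hp
  have pa : ∀ f, p f = (inner ℂ ψ f : ℂ) • ψ := fun f => rfl
  have hpp : p * p = p := by
    ext1 f
    rw [mul_apply_eq_comp, pa, pa, inner_smul_right, hψψ, mul_one]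
  have hTp : T * p = (m : ℂ) • p := by
    ext1 f
    rw [mul_apply_eq_comp, pa, map_smul, hTψ, smul_apply, pa, smul_comm]
  have hpT : p * T = (m : ℂ) • p := by
    ext1 f
    rw [mul_apply_eq_comp, pa, ← hT, hTψ, inner_smul_left, Complex.conj_ofReal, smul_apply, pa,
      mul_smul]
  -- Removing the dominant eigenvalue leaves norm at most $7/16$, below $1/2\le|z|$ on the closed
  -- disc. So $T'-z$ is invertible throughout, and the only pole of $(T-z)^{-1}$ there is at $m$.
  set T' : L2 →L[ℂ] L2 := T - (m : ℂ) • p with hT'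
  have hT'p : T' * p = 0 := by rw [hT', sub_mul, hTp, smul_mul_assoc, hpp, sub_self]
  have hpT' : p * T' = 0 := by rw [hT', mul_sub, hpT, mul_smul_comm, hpp, sub_self]
  have hT'n : ‖T'‖ ≤ 7 / 16 := by
    refine ContinuousLinearMap.opNorm_le_bound _ (by norm_num) fun f => ?_
    have h1 : T' f = T (f - p f) := by
      rw [map_sub, hT', sub_apply, ← hTp, mul_apply_eq_comp]
    have h2 : inner ℂ ψ (f - p f) = (0 : ℂ) := by
      rw [pa, inner_sub_right, inner_smul_right, hψψ, mul_one, sub_self]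
    have h3 : ‖f - p f‖ ^ 2 = ‖f‖ ^ 2 - ‖(inner ℂ ψ f : ℂ)‖ ^ 2 := by
      rw [pa, @norm_sub_sq ℂ, inner_smul_right, ← inner_conj_symm f ψ, Complex.mul_conj',
        norm_smul, hψ, mul_one, ← Complex.ofReal_pow]
      simp only [RCLike.re_to_complex, Complex.ofReal_re]
      ring
    have h4 : ‖f - p f‖ ≤ ‖f‖ := by
      refine le_of_sq_le_sq ?_ (norm_nonneg _)
      rw [h3]
      linarith [sq_nonneg ‖(inner ℂ ψ f : ℂ)‖]
    rw [h1]
    exact (hrest _ h2).trans (by gcongr)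
  have hunit : ∀ z ∈ Metric.closedBall (1 : ℂ) (1 / 2), IsUnit (T' - z • (1 : L2 →L[ℂ] L2)) := by
    intro z hz
    have hz1 : 1 / 2 ≤ ‖z‖ := by
      rw [mem_closedBall_iff_norm, norm_sub_rev] at hz
      have := norm_sub_norm_le (1 : ℂ) z
      rw [norm_one] at this
      linarith
    have : Nontrivial L2 := ⟨ψ, 0, fun h => by simp [h] at hψ⟩
    have := spectrum.mem_resolventSet_of_norm_lt (a := T') (k := z) (by linarith)
    rw [spectrum.mem_resolventSet_iff, Algebra.algebraMap_eq_smul_one, ← IsUnit.neg_iff,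
      neg_sub] at this
    exact this
  have hinv : ∀ z ∈ Metric.closedBall (1 : ℂ) (1 / 2), z ≠ m →
      Ring.inverse (T - z • (1 : L2 →L[ℂ] L2)) = (1 - p) *
        Ring.inverse (T' - z • (1 : L2 →L[ℂ] L2)) - (z - (m : ℂ))⁻¹ • p := by
    intro z hz hne
    have hu := hunit z hz
    have hK1 := Ring.mul_inverse_cancel _ hu
    have hcomm : Commute (1 - p) (Ring.inverse (T' - z • (1 : L2 →L[ℂ] L2))) := by
      have h1 : Commute (1 - p) (T' - z • (1 : L2 →L[ℂ] L2)) := by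
        refine Commute.sub_right ?_ ((Commute.one_right _).smul_right z)
        change (1 - p) * T' = T' * (1 - p)
        rw [sub_mul 1 p T', mul_sub T' 1 p, hT'p, hpT', one_mul, mul_one]
      obtain ⟨u, hu⟩ := hu
      rw [← hu] at h1 ⊢
      rw [Ring.inverse_unit]
      exact h1.units_inv_right
    have hK2 := Ring.inverse_mul_cancel _ hu
    generalize Ring.inverse (T' - z • (1 : L2 →L[ℂ] L2)) = K at hK1 hK2 hcomm ⊢
    have hsub : z - (m : ℂ) ≠ 0 := sub_ne_zero.2 hne
    have hq : (1 - p) * (1 - p) = 1 - p := by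
      rw [sub_mul, one_mul, mul_sub, hpp, mul_one, sub_self, sub_zero]
    have hqp : (1 - p) * p = 0 := by rw [sub_mul, one_mul, hpp, sub_self]
    have hpq : p * (1 - p) = 0 := by rw [mul_sub, mul_one, hpp, sub_self]
    have hTe : T = T' + (m : ℂ) • p := by rw [hT', sub_add_cancel]
    have h1 : (T - z • (1 : L2 →L[ℂ] L2)) * ((1 - p) * K - (z - (m : ℂ))⁻¹ • p) = 1 := by
      have a1 : (T - z • (1 : L2 →L[ℂ] L2)) * (1 - p) =
          (1 - p) * (T' - z • (1 : L2 →L[ℂ] L2)) := by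
        rw [hTe, sub_mul, add_mul, smul_mul_assoc, hpq, smul_zero, add_zero, mul_sub (1 - p),
          mul_sub T', hT'p, mul_one, sub_zero, sub_mul 1 p T', hpT', one_mul, sub_zero,
          smul_mul_assoc, one_mul, mul_smul_comm, mul_one]
      have a2 : (T - z • (1 : L2 →L[ℂ] L2)) * p = -(z - (m : ℂ)) • p := by
        rw [sub_mul, hTp, smul_mul_assoc, one_mul, ← sub_smul, neg_sub]
      rw [mul_sub, ← mul_assoc, a1, mul_assoc, hK1, mul_one, mul_smul_comm, a2, smul_smul,
        mul_neg, inv_mul_cancel₀ hsub, neg_one_smul, sub_neg_eq_add, sub_add_cancel]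
    have h2 : ((1 - p) * K - (z - (m : ℂ))⁻¹ • p) * (T - z • (1 : L2 →L[ℂ] L2)) = 1 := by
      have a1 : (1 - p) * (T - z • (1 : L2 →L[ℂ] L2)) =
          (T' - z • (1 : L2 →L[ℂ] L2)) * (1 - p) := by
        rw [hTe, mul_sub, mul_add, mul_smul_comm, hqp, smul_zero, add_zero, sub_mul T',
          mul_sub T', hT'p, mul_one, sub_zero, sub_mul 1 p T', hpT', one_mul, sub_zero,
          smul_mul_assoc, one_mul, mul_smul_comm, mul_one]
      have a2 : p * (T - z • (1 : L2 →L[ℂ] L2)) = -(z - (m : ℂ)) • p := by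
        rw [mul_sub, hpT, mul_smul_comm, mul_one, ← sub_smul, neg_sub]
      have hc : (1 - p) * K = K * (1 - p) := hcomm
      rw [sub_mul, hc, mul_assoc, a1, ← mul_assoc, hK2, one_mul, smul_mul_assoc, a2, smul_smul,
        mul_neg, inv_mul_cancel₀ hsub, neg_one_smul, sub_neg_eq_add, sub_add_cancel]
    exact Ring.inverse_unit ⟨_, _, h1, h2⟩
  have hmball : (m : ℂ) ∈ Metric.ball (1 : ℂ) (1 / 2) := by
    rw [mem_ball_iff_norm, ← Complex.ofReal_one, ← Complex.ofReal_sub, Complex.norm_real,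
      Real.norm_eq_abs, abs_lt]
    constructor <;> linarith
  have hdiff : ∀ z ∈ Metric.closedBall (1 : ℂ) (1 / 2), DifferentiableAt ℂ
      (fun z : ℂ => (1 - p) * Ring.inverse (T' - z • (1 : L2 →L[ℂ] L2))) z := by
    intro z hz
    have h1 : DifferentiableAt ℂ (fun z : ℂ => T' - z • (1 : L2 →L[ℂ] L2)) z := by fun_prop
    have h2 : DifferentiableAt ℂ Ring.inverse (T' - z • (1 : L2 →L[ℂ] L2)) :=
      differentiableAt_inverse (hunit z hz)
    exact (h2.comp z h1).const_mul _
  have hzero : ∮ z in C((1 : ℂ), 1 / 2), (1 - p) * Ring.inverse (T' - z • (1 : L2 →L[ℂ] L2)) =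
      0 := by
    refine DiffContOnCl.circleIntegral_eq_zero (by norm_num) (DifferentiableOn.diffContOnCl ?_)
    rw [closure_ball _ (by norm_num)]
    exact fun z hz => (hdiff z hz).differentiableWithinAt
  have hone := circleIntegral.integral_sub_inv_of_mem_ball hmball
  have hne : ∀ z ∈ Metric.sphere (1 : ℂ) (1 / 2), z - (m : ℂ) ≠ 0 := by
    intro z hz h0
    rw [sub_eq_zero.1 h0] at hz
    exact (Metric.mem_ball.1 hmball).ne (Metric.mem_sphere.1 hz)
  have hi1 : CircleIntegrable (fun z : ℂ => (1 - p) * Ring.inverse (T' - z • (1 : L2 →L[ℂ] L2)))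
      1 (1 / 2) := by
    refine ContinuousOn.circleIntegrable (by norm_num) fun z hz => ?_
    exact (hdiff z (Metric.sphere_subset_closedBall hz)).continuousAt.continuousWithinAt
  have hi2 : CircleIntegrable (fun z : ℂ => (z - (m : ℂ))⁻¹ • p) 1 (1 / 2) := by
    refine ContinuousOn.circleIntegrable (by norm_num) ?_
    exact (ContinuousOn.inv₀ (by fun_prop) hne).smul continuousOn_const
  have hcongr : EqOn (fun z : ℂ => Ring.inverse (T - z • (1 : L2 →L[ℂ] L2))) (fun z : ℂ => (1 - p) *
        Ring.inverse (T' - z • (1 : L2 →L[ℂ] L2)) - (z - (m : ℂ))⁻¹ • p)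
        (Metric.sphere (1 : ℂ) (1 / 2)) := fun z hz =>
    hinv z (Metric.sphere_subset_closedBall hz) (sub_ne_zero.1 (hne z hz))
  rw [circleIntegral.integral_congr (by norm_num) hcongr, circleIntegral.integral_sub hi1 hi2,
    hzero, circleIntegral.integral_smul_const, hone, zero_sub, smul_neg, smul_smul, ← neg_smul]
  have hpi : (Real.pi : ℂ) ≠ 0 := by exact_mod_cast Real.pi_ne_zero
  have : -(Complex.I / (2 * Real.pi) * (2 * Real.pi * Complex.I)) = 1 := by
    field_simp
    rw [Complex.I_sq, neg_neg]
  rw [this, one_smul]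

/-! ### Approximately invariant lines -/

section Invariant

variable {A : L2 →ₗ.[ℂ] L2} {U : ℝ → L2 →L[ℂ] L2} {ψ g : L2}

/-- Stone's theorem supplies the existence that gives the choice in `expGroup` its meaning. -/
theorem expGroup_spec (hA : PosSA A) : IsUnitaryGroupOf A (expGroup A) :=
  Classical.epsilon_spec (p := IsUnitaryGroupOf A) hA.exists_unitaryGroup

theorem IsUnitaryGroupOf.hasDerivAt (hU : IsUnitaryGroupOf A U) (h : (ψ, g) ∈ A.graph) (t : ℝ) :
    HasDerivAt (fun t => U t ψ) (U t (-(Complex.I • g))) t := by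
  have h1 := (hU.generator _ _).1 h
  have h2 : HasDerivAt (fun s => U t (U (s - t) ψ)) (U t (-(Complex.I • g))) t := by
    have h4 : HasDerivAt (fun t => U t ψ) (-(Complex.I • g)) (t - t) := by rwa [sub_self]
    exact ((U t).restrictScalars ℝ).hasFDerivAt.comp_hasDerivAt t (h4.comp_sub_const t t)
  convert h2 using 2 with s
  rw [← mul_apply_eq_comp, ← hU.map_add]
  congr 2
  ring

/-- The curve $e^{it\mu}U_t\psi$ has derivative $-ie^{it\mu}U_t(g-\mu\psi)$, of constant norm
$\|g-\mu\psi\|$. -/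
theorem IsUnitaryGroupOf.norm_sub_le (hU : IsUnitaryGroupOf A U) (h : (ψ, g) ∈ A.graph) {μ b : ℝ}
    (hb : ‖g - (μ : ℂ) • ψ‖ ≤ b) (t : ℝ) :
    ‖U t ψ - Complex.exp (-Complex.I * t * μ) • ψ‖ ≤ b * |t| := by
  have hd : ∀ t : ℝ, HasDerivAt (fun t : ℝ => Complex.exp (Complex.I * t * μ) • U t ψ)
      (-Complex.I • Complex.exp (Complex.I * t * μ) • U t (g - (μ : ℂ) • ψ)) t := by
    intro t
    have h1 : HasDerivAt (fun t : ℝ => Complex.exp (Complex.I * t * μ))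
        (Complex.exp (Complex.I * t * μ) * (Complex.I * μ)) t := by
      have h2 : HasDerivAt (fun t : ℝ => Complex.I * (t : ℂ) * μ) (Complex.I * μ) t := by
        have := ((hasDerivAt_id (t : ℂ)).comp_ofReal.const_mul Complex.I).mul_const (μ : ℂ)
        simpa using this
      exact h2.cexp
    refine (h1.smul (hU.hasDerivAt h t)).congr_deriv ?_
    simp only [map_neg, map_sub, map_smul]
    module
  have hexp : ∀ t : ℝ, ‖Complex.exp (Complex.I * t * μ)‖ = 1 := fun t => by
    rw [Complex.norm_exp]
    simp
  have hmain := Convex.norm_image_sub_le_of_norm_hasDerivWithin_le (s := univ) (x := 0) (y := t)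
    (fun x _ => (hd x).hasDerivWithinAt) (fun x _ => by
      rw [norm_smul, norm_smul, norm_neg, Complex.norm_I, hexp, one_mul, one_mul,
        norm_apply_of_mem_unitary (hU.mem_unitary x)]) convex_univ (mem_univ _) (mem_univ _)
  simp only [Complex.ofReal_zero, mul_zero, zero_mul, Complex.exp_zero, one_smul, hU.map_zero,
    sub_zero, Real.norm_eq_abs, one_apply_eq_self] at hmain
  have e : U t ψ - Complex.exp (-Complex.I * t * μ) • ψ =
      Complex.exp (-Complex.I * t * μ) • (Complex.exp (Complex.I * t * μ) • U t ψ - ψ) := by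
    rw [smul_sub, smul_smul, ← Complex.exp_add]
    have : -Complex.I * t * μ + Complex.I * t * μ = 0 := by ring
    rw [this, Complex.exp_zero, one_smul]
  have hexp' : ‖Complex.exp (-Complex.I * t * μ)‖ = 1 := by
    rw [Complex.norm_exp]
    simp
  rw [e, norm_smul, hexp', one_mul]
  exact hmain.trans (by gcongr)

open InnerProductSpace (rankOne)

theorem rankOne_range (ψ : L2) : (rankOne ℂ ψ ψ : L2 →L[ℂ] L2).range ≤ ℂ ∙ ψ := by
  rintro _ ⟨f, rfl⟩
  exact Submodule.mem_span_singleton.2 ⟨_, rfl⟩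

theorem rankOne_range_eq (hψ : ‖ψ‖ = 1) : (rankOne ℂ ψ ψ : L2 →L[ℂ] L2).range = ℂ ∙ ψ := by
  refine le_antisymm (rankOne_range ψ) ?_
  rw [Submodule.span_singleton_le_iff_mem]
  refine ⟨ψ, ?_⟩
  change (inner ℂ ψ ψ : ℂ) • ψ = ψ
  rw [inner_self_eq_norm_sq_to_K, hψ]
  simp

/-- An almost eigenvector spans an almost invariant line. -/
theorem almost_invariant (hA : PosSA A) (hψ : ‖ψ‖ = 1) (h : (ψ, g) ∈ A.graph) {b : ℝ}
    (hb : ‖g - (inner ℂ ψ g : ℂ) • ψ‖ ≤ b) :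
    (∃ μ : ℝ, (rankOne ℂ ψ ψ : L2 →L[ℂ] L2).range ≤ eigenspace (compress (rankOne ℂ ψ ψ) A) μ) ∧
    (∀ t : ℝ, ‖(1 - (rankOne ℂ ψ ψ : L2 →L[ℂ] L2)) * expGroup A t * rankOne ℂ ψ ψ‖ ≤ b * |t|) ∧
    ∀ (μ : ℝ) (χ : L2), ‖χ‖ = 1 → χ ∈ (rankOne ℂ ψ ψ : L2 →L[ℂ] L2).range →
      χ ∈ eigenspace (compress (rankOne ℂ ψ ψ) A) μ → ∀ t : ℝ,
        ‖expGroup A t χ - Complex.exp (-Complex.I * t * μ) • χ‖ ≤ b * |t| := by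
  have hU := expGroup_spec hA
  have hψψ : inner ℂ ψ ψ = (1 : ℂ) := by
    rw [inner_self_eq_norm_sq_to_K, hψ]
    simp
  have pa : ∀ f, (rankOne ℂ ψ ψ : L2 →L[ℂ] L2) f = (inner ℂ ψ f : ℂ) • ψ := fun f => rfl
  obtain ⟨μ, hμ⟩ : ∃ μ : ℝ, (inner ℂ ψ g : ℂ) = μ := by
    have := hA.symm h h
    rw [← inner_conj_symm g ψ] at this
    obtain ⟨μ, hμ⟩ := Complex.conj_eq_iff_real.1 this.symm
    exact ⟨μ, hμ⟩
  rw [hμ] at hb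
  have hcomp : ∀ c : ℂ, (c • ψ, (μ : ℂ) • c • ψ) ∈ (compress (rankOne ℂ ψ ψ) A).graph := by
    intro c
    rw [mem_graph_compress]
    refine ⟨c • g, ?_, ?_⟩
    · rw [pa, inner_smul_right, hψψ, mul_one]
      exact A.graph.smul_mem c h
    · rw [pa, inner_smul_right, hμ, smul_smul, mul_comm]
  have hest := hU.norm_sub_le h hb
  refine ⟨⟨μ, ?_⟩, fun t => ?_, fun μ' χ hχ hr he t => ?_⟩
  · rw [rankOne_range_eq hψ, Submodule.span_singleton_le_iff_mem, mem_eigenspace]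
    have := hcomp 1
    rwa [one_smul] at this
  · have hb0 : 0 ≤ b := (norm_nonneg _).trans hb
    refine ContinuousLinearMap.opNorm_le_bound _ (by positivity) fun f => ?_
    have e : ((1 - (rankOne ℂ ψ ψ : L2 →L[ℂ] L2)) * expGroup A t * rankOne ℂ ψ ψ) f =
        (inner ℂ ψ f : ℂ) • (1 - (rankOne ℂ ψ ψ : L2 →L[ℂ] L2))
          (expGroup A t ψ - Complex.exp (-Complex.I * t * μ) • ψ) := by
      rw [mul_apply_eq_comp, mul_apply_eq_comp, pa, map_smul, map_smul, map_sub]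
      congr 1
      have : (1 - (rankOne ℂ ψ ψ : L2 →L[ℂ] L2)) (Complex.exp (-Complex.I * t * μ) • ψ) = 0 := by
        rw [map_smul, sub_apply, one_apply_eq_self, pa, hψψ, one_smul, sub_self, smul_zero]
      rw [this, sub_zero]
    have hn : ‖(1 - (rankOne ℂ ψ ψ : L2 →L[ℂ] L2))‖ ≤ 1 :=
      (InnerProductSpace.isStarProjection_rankOne_self hψ).one_sub.norm_le
    have hi := norm_inner_le_norm (𝕜 := ℂ) ψ f
    rw [hψ, one_mul] at hi
    rw [e, norm_smul, mul_comm]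
    gcongr
    refine ((1 - (rankOne ℂ ψ ψ : L2 →L[ℂ] L2)).le_opNorm _).trans ?_
    refine (mul_le_of_le_one_left (norm_nonneg _) hn).trans (hest t)
  · obtain ⟨c, rfl⟩ := Submodule.mem_span_singleton.1 (rankOne_range ψ hr)
    have hc : ‖c‖ = 1 := by rwa [norm_smul, hψ, mul_one] at hχ
    have h1 := LinearPMap.mem_graph_snd_inj _ (hcomp c) (mem_eigenspace.1 he) rfl
    -- A unit vector of the line is a phase times $\psi$, and single-valuedness of the compression
    -- forces its eigenvalue to be $\langle\psi,g\rangle$.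
    have h2 : (μ : ℂ) = μ' := by
      have h3 : ((μ : ℂ) - μ') • c • ψ = 0 := by rw [sub_smul, h1, sub_self]
      rw [smul_eq_zero] at h3
      exact sub_eq_zero.1 (h3.resolve_right fun h0 => by simp [h0] at hχ)
    have := hest t
    rw [← h2, map_smul, smul_comm, ← smul_sub, norm_smul, hc, one_mul]
    exact this

end Invariant

/-! ### The truncated series -/

theorem isCompactOperator_of_range_le {T : L2 →L[ℂ] L2} {F : Submodule ℂ L2}
    [FiniteDimensional ℂ F] (h : ∀ f, T f ∈ F) : IsCompactOperator T := by
  have h1 : FiniteDimensional ℂ F := inferInstance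
  have h2 := FiniteDimensional.proper ℂ F
  have h3 : LocallyCompactSpace F := inferInstance
  have h4 : IsCompactOperator (T.codRestrict F h) := isCompactOperator_of_locallyCompactSpace_dom _
  exact h4.clm_comp F.subtypeL

section Series

variable {W : Plane → ℝ} {R : L2 →L[ℂ] L2} {lam : ℝ} {χ : L2} {ι : Type*}

theorem Smoothing.isCompactOperator {T : ι → Module.End ℂ rapid} (hT : Smoothing T) (i : ι)
    {Q : L2 →L[ℂ] L2} (hQ : ∀ f : rapid, Q f = T i f) : IsCompactOperator Q := by
  have := hT.finite i
  have hF : FiniteDimensional ℂ ((LinearMap.range (T i)).map rapid.subtype) := inferInstance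
  refine isCompactOperator_of_range_le (F := (LinearMap.range (T i)).map rapid.subtype) fun f => ?_
  have hcl : IsClosed {f : L2 | Q f ∈ (LinearMap.range (T i)).map rapid.subtype} :=
    (Submodule.closed_of_finiteDimensional
      ((LinearMap.range (T i)).map rapid.subtype)).preimage Q.continuous
  refine hcl.closure_subset_iff.2 (fun g hg => ?_) (dense_rapid f)
  exact ⟨T i ⟨g, hg⟩, ⟨_, rfl⟩, (hQ ⟨g, hg⟩).symm⟩

theorem inner_eq_of_dense {Q : L2 →L[ℂ] L2} {T : Module.End ℂ rapid}
    (hQ : ∀ f : rapid, Q f = T f)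
    (hT : ∀ f g : rapid, inner ℂ (T f : L2) (g : L2) = inner ℂ (f : L2) (T g : L2)) (f g : L2) :
    inner ℂ (Q f) g = inner ℂ f (Q g) := by
  have h1 : ∀ f ∈ rapid, ∀ g : L2, inner ℂ (Q f) g = inner ℂ f (Q g) := by
    intro f hf g
    refine dense_rapid.induction (P := fun g => inner ℂ (Q f) g = inner ℂ f (Q g)) ?_ ?_ g
    · intro g hg
      have := hT ⟨f, hf⟩ ⟨g, hg⟩
      rwa [← hQ, ← hQ] at this
    · exact isClosed_eq (Continuous.inner (by fun_prop) (by fun_prop))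
        (Continuous.inner (by fun_prop) (by fun_prop))
  refine dense_rapid.induction (P := fun f => inner ℂ (Q f) g = inner ℂ f (Q g)) ?_ ?_ f
  · exact fun f hf => h1 f hf g
  · exact isClosed_eq (Continuous.inner (by fun_prop) (by fun_prop))
      (Continuous.inner (by fun_prop) (by fun_prop))

namespace Confined

/-- A family of perturbations with a uniform polynomial bound. -/
structure Family (V : ι → Plane → ℝ) : Prop where
  polyBdd : ∀ i, PolyBdd (V i)
  bound : ∃ (C : NNReal) (m : ℕ), ∀ i, ∀ᵐ x, |V i x| ≤ C * wt x ^ m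

variable {V : ι → Plane → ℝ}

theorem smoothing_coeff (M : Confined W R lam χ) (F : Family V) (j : ℕ) :
    Smoothing fun i => M.coeffEnd (mulRapid (F.polyBdd i)) j :=
  M.smoothing_coeffEnd (tame_mulRapid F.polyBdd F.bound) (fun i => inner_mulRapid (F.polyBdd i)) j

theorem coeff_apply (M : Confined W R lam χ) (F : Family V) (j : ℕ) (i : ι) (f : rapid) :
    coeff (schrodinger W) lam (V i) j f = M.coeffEnd (mulRapid (F.polyBdd i)) j f := by
  obtain ⟨C, hC⟩ := (M.smoothing_coeff F j).bound 0
  refine coeff_eq (C := C) (fun f => ?_) (M.coeffEnd_mem_graph (F.polyBdd i) j) f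
  have := hC i f
  rwa [wnorm_zero_left] at this

theorem wnorm_coeff_le (M : Confined W R lam χ) (F : Family V) (j n : ℕ) :
    ∃ C : NNReal, ∀ i f, wnorm n (coeff (schrodinger W) lam (V i) j f) ≤ C * ‖f‖ₑ := by
  obtain ⟨C, hC⟩ := (M.smoothing_coeff F j).bound n
  refine ⟨C, fun i => wnorm_le_of_dense fun f hf => ?_⟩
  have := hC i ⟨f, hf⟩
  rwa [← M.coeff_apply F] at this

theorem norm_coeff_le (M : Confined W R lam χ) (F : Family V) (j : ℕ) :
    ∃ C : NNReal, ∀ i, ‖coeff (schrodinger W) lam (V i) j‖ ≤ C := by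
  obtain ⟨C, hC⟩ := M.wnorm_coeff_le F j 0
  refine ⟨C, fun i => ContinuousLinearMap.opNorm_le_bound _ C.2 fun f => ?_⟩
  have h1 := hC i f
  rw [wnorm_zero_left] at h1
  have h2 : ‖coeff (schrodinger W) lam (V i) j f‖₊ ≤ C * ‖f‖₊ := by
    simp only [enorm] at h1
    exact_mod_cast h1
  exact h2

theorem coeff_zero (M : Confined W R lam χ) (F : Family V) (i : ι) :
    coeff (schrodinger W) lam (V i) 0 = eigenProj (schrodinger W) lam := by
  refine eq_of_forall_test fun f φ hφ hf => ?_
  have := M.coeff_apply F 0 i ⟨f, mem_rapid_of_test hφ hf⟩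
  rw [this, coeffEnd, wsum_zero, LinearMap.smul_apply, Submodule.coe_smul, coe_red, redPow,
    neg_apply]
  simp

theorem inner_truncSeries (M : Confined W R lam χ) (F : Family V) (N : ℕ) (i : ι) (η : ℝ)
    (f g : L2) : inner ℂ (truncSeries (schrodinger W) lam (V i) η N f) g =
      inner ℂ f (truncSeries (schrodinger W) lam (V i) η N g) := by
  rw [truncSeries, sum_apply, sum_apply, sum_inner, inner_sum]
  refine Finset.sum_congr rfl fun j _ => ?_
  rw [smul_apply, smul_apply, inner_smul_left, inner_smul_right,
    inner_eq_of_dense (M.coeff_apply F j i) (M.inner_coeffEnd (inner_mulRapid (F.polyBdd i)) j),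
    map_pow, Complex.conj_ofReal]

theorem isCompactOperator_truncSeries (M : Confined W R lam χ) (F : Family V) (N : ℕ) (i : ι)
    (η : ℝ) : IsCompactOperator (truncSeries (schrodinger W) lam (V i) η N) := by
  have h1 : ∀ j, coeff (schrodinger W) lam (V i) j ∈ compactOperator (RingHom.id ℂ) L2 L2 :=
    fun j => (M.smoothing_coeff F j).isCompactOperator i (M.coeff_apply F j i)
  have h2 : truncSeries (schrodinger W) lam (V i) η N ∈ compactOperator (RingHom.id ℂ) L2 L2 :=
    Submodule.sum_mem _ fun j _ => Submodule.smul_mem _ _ (h1 j)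
  exact h2

theorem norm_truncSeries_sub_le (M : Confined W R lam χ) (F : Family V) (N : ℕ) :
    ∃ C : ℝ, 0 ≤ C ∧ ∀ i (η : ℝ), 0 < η → η ≤ 1 →
      ‖truncSeries (schrodinger W) lam (V i) η N - eigenProj (schrodinger W) lam‖ ≤ C * η := by
  choose C hC using M.norm_coeff_le F
  refine ⟨∑ j ∈ Finset.range N, (C (j + 1) : ℝ), by positivity, fun i η h0 h1 => ?_⟩
  rw [truncSeries, Finset.sum_range_succ', pow_zero, one_smul, M.coeff_zero F, add_sub_cancel_right,
    Finset.sum_mul]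
  refine norm_sum_le_of_le _ fun j _ => ?_
  rw [norm_smul, norm_pow, Complex.norm_real, Real.norm_eq_abs, abs_of_pos h0, mul_comm]
  have h2 : η ^ (j + 1) ≤ η := by
    rw [pow_succ]
    exact mul_le_of_le_one_left h0.le (pow_le_one₀ h0.le h1)
  gcongr
  exact hC _ i

theorem wnorm_truncSeries_le (M : Confined W R lam χ) (F : Family V) (N n : ℕ) :
    ∃ C : NNReal, ∀ i (η : ℝ), 0 < η → η ≤ 1 → ∀ f,
      wnorm n (truncSeries (schrodinger W) lam (V i) η N f) ≤ C * ‖f‖ₑ := by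
  choose C hC using fun j => M.wnorm_coeff_le F j n
  refine ⟨∑ j ∈ Finset.range (N + 1), C j, fun i η h0 h1 f => ?_⟩
  rw [truncSeries, sum_apply]
  have hterm : ∀ j, wnorm n (((η : ℂ) ^ j • coeff (schrodinger W) lam (V i) j) f) ≤
      C j * ‖f‖ₑ := by
    intro j
    rw [smul_apply]
    refine (wnorm_smul_le _ _ _).trans ?_
    refine (mul_le_of_le_one_left zero_le ?_).trans (hC j i f)
    rw [← enorm_one (G := ℂ), enorm_le_iff_norm_le, norm_pow, Complex.norm_real, Real.norm_eq_abs,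
      abs_of_pos h0, norm_one]
    exact pow_le_one₀ h0.le h1
  generalize N + 1 = m
  induction m with
  | zero => simp [wnorm_zero]
  | succ m ih =>
    rw [Finset.sum_range_succ, Finset.sum_range_succ, ENNReal.coe_add, add_mul]
    exact (wnorm_add_le _ _ _).trans (add_le_add ih (hterm m))

/-- $Q_j$ maps into the domain of $H$ with rapidly decreasing image. Thus an eigenvector of the
truncated series lies in that domain, and $V$ and $Q_j$ can be applied to its image. -/
theorem exists_coeffEnd_mem_graph (M : Confined W R lam χ) (v : Module.End ℂ rapid) (j : ℕ)
    (f : rapid) : ∃ z : rapid, ((M.coeffEnd v j f : L2), (z : L2)) ∈ (schrodinger W).graph := by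
  rcases j with _ | j
  · refine ⟨(lam : ℂ) • M.coeffEnd v 0 f, ?_⟩
    have := (schrodinger W).graph.smul_mem ((-1 : ℂ) ^ (0 + 1)) (M.redPow_zero_mem_graph f)
    convert this using 1
    refine Prod.ext ?_ ?_
    · rw [coeffEnd, wsum_zero]
      rfl
    · rw [coeffEnd, wsum_zero, Prod.smul_snd, smul_comm]
      rfl
  · exact ⟨(-1 : ℂ) ^ (j + 1 + 1) • (M.wsum v (j + 1) j f + v (M.wsum v j j f) +
      (lam : ℂ) • M.wsum v (j + 1) (j + 1) f), (schrodinger W).graph.smul_mem _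
        (M.wsum_mem_graph v j j f)⟩

/-- The truncated series on rapidly decreasing functions. -/
def truncEnd (M : Confined W R lam χ) (v : Module.End ℂ rapid) (η : ℝ) (N : ℕ) :
    Module.End ℂ rapid :=
  ∑ j ∈ Finset.range (N + 1), (η : ℂ) ^ j • M.coeffEnd v j

theorem truncSeries_apply (M : Confined W R lam χ) (F : Family V) (N : ℕ) (i : ι) (η : ℝ)
    (f : rapid) : truncSeries (schrodinger W) lam (V i) η N f =
      M.truncEnd (mulRapid (F.polyBdd i)) η N f := by
  rw [truncSeries, truncEnd, sum_apply, LinearMap.sum_apply, Submodule.coe_sum]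
  refine Finset.sum_congr rfl fun j _ => ?_
  rw [smul_apply, M.coeff_apply F]
  rfl

theorem exists_truncEnd_mem_graph (M : Confined W R lam χ) (v : Module.End ℂ rapid) (η : ℝ) (N : ℕ)
    (f : rapid) : ∃ z : rapid, ((M.truncEnd v η N f : L2), (z : L2)) ∈ (schrodinger W).graph := by
  choose z hz using fun j => M.exists_coeffEnd_mem_graph v j f
  refine ⟨∑ j ∈ Finset.range (N + 1), (η : ℂ) ^ j • z j, ?_⟩
  have := (schrodinger W).graph.sum_mem (t := Finset.range (N + 1))
    fun j _ => (schrodinger W).graph.smul_mem ((η : ℂ) ^ j) (hz j)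
  convert this using 1
  refine Prod.ext ?_ ?_
  · rw [truncEnd, LinearMap.sum_apply, Submodule.coe_sum, Prod.fst_sum]
    rfl
  · rw [Submodule.coe_sum, Prod.snd_sum]
    rfl

/-- The commutator of the truncated series with the unperturbed operator. -/
theorem truncEnd_commutator (M : Confined W R lam χ) {v : Module.End ℂ rapid}
    (hs : ∀ f g : rapid, inner ℂ (v f : L2) (g : L2) = inner ℂ (f : L2) (v g : L2))
    (η : ℝ) (N : ℕ) {f g : rapid} (hfg : ((f : L2), (g : L2)) ∈ (schrodinger W).graph) :
    ((M.truncEnd v η N f : L2), (M.truncEnd v η N g - (η : ℂ) • (v (M.truncEnd v η N f) -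
      M.truncEnd v η N (v f)) + (η : ℂ) ^ (N + 1) • (v (M.coeffEnd v N f) -
        M.coeffEnd v N (v f)) : rapid).1) ∈ (schrodinger W).graph := by
  induction N with
  | zero =>
    have h := M.coeffEnd_zero_commutator v hfg
    have e : ∀ u, M.truncEnd v η 0 u = M.coeffEnd v 0 u := fun u => by simp [truncEnd]
    rw [e, e, e, zero_add, pow_one, sub_add_cancel]
    exact h
  | succ N ih =>
    -- Telescoping: the term $-\eta^{N+1}[V,Q_N]$ from the new coefficient cancels the old
    -- remainder.
    have h := (schrodinger W).graph.add_mem ih ((schrodinger W).graph.smul_mem ((η : ℂ) ^ (N + 1))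
      (M.coeffEnd_commutator hs N hfg))
    have e : ∀ u, M.truncEnd v η (N + 1) u =
        M.truncEnd v η N u + (η : ℂ) ^ (N + 1) • M.coeffEnd v (N + 1) u := fun u => by
      rw [truncEnd, Finset.sum_range_succ]
      rfl
    rw [e, e, e, map_add, map_smul]
    convert h using 1
    refine Prod.ext rfl ?_
    simp only [Prod.snd_add, Prod.smul_snd]
    rw [← Submodule.coe_smul, ← Submodule.coe_add]
    congr 1
    rw [pow_succ _ (N + 1)]
    module

/-- The dominant eigenvector of the truncated series is an almost eigenvector of the perturbed
operator. -/
theorem exists_almost_eigenvector (M : Confined W R lam χ) (F : Family V) (N : ℕ) :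
    ∃ C : ℝ, 0 < C ∧ ∃ η₀ : ℝ, 0 < η₀ ∧ ∀ i (η : ℝ), 0 < η → η < η₀ →
      ∃ ψ h : rapid, ‖(ψ : L2)‖ = 1 ∧ ((ψ : L2), (h : L2)) ∈ (schrodinger W).graph ∧
        almostProj (schrodinger W) lam (V i) η N = InnerProductSpace.rankOne ℂ (ψ : L2) (ψ : L2) ∧
        ‖((h + (η : ℂ) • mulRapid (F.polyBdd i) ψ : rapid) : L2) - (inner ℂ (ψ : L2)
          ((h + (η : ℂ) • mulRapid (F.polyBdd i) ψ : rapid) : L2) : ℂ) • (ψ : L2)‖ ≤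
            C * η ^ (N + 1) := by
  obtain ⟨C₁, hC₁, hT⟩ := M.norm_truncSeries_sub_le F N
  have hv := tame_mulRapid F.polyBdd F.bound
  have hq : Tame fun i => M.coeffEnd (mulRapid (F.polyBdd i)) N := fun n =>
    ((M.smoothing_coeff F N).bound n).imp' (fun C => 0) fun C hC =>
      ⟨C, fun i f => by
        rw [wnorm_zero_left]
        exact hC i f⟩
  obtain ⟨m₁, D₁, hD₁⟩ := (hv.mul hq) 0
  obtain ⟨m₂, D₂, hD₂⟩ := (hq.mul hv) 0
  obtain ⟨E₁, hE₁⟩ := M.wnorm_truncSeries_le F N m₁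
  obtain ⟨E₂, hE₂⟩ := M.wnorm_truncSeries_le F N m₂
  -- The $D$ bound $VQ_N$ and $Q_NV$, and twice the $E$ bound the weighted norms of $\psi$. A
  -- further factor $2$ inverts the lower bound $1/2$, and $+1$ gives positivity. The bound on
  -- $\eta$ ensures $\|T_N-P\|\le1/16$.
  refine ⟨4 * (D₁ * E₁ + D₂ * E₂ : NNReal) + 1, by positivity, min 1 (1 / (16 * (C₁ + 1))),
    by positivity, fun i η h0 hη => ?_⟩
  have hη1 : η ≤ 1 := (hη.trans_le (min_le_left _ _)).le
  have hη2 : C₁ * η ≤ 1 / 16 := by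
    have h1 := (hη.trans_le (min_le_right _ _)).le
    rw [le_div_iff₀ (by positivity)] at h1
    nlinarith
  have hTs := M.inner_truncSeries F N i η
  obtain ⟨ψ, m, hψ, hTψ, hm1, hm2, hrest⟩ := exists_dominant_eigenvector hTs
    (M.isCompactOperator_truncSeries F N i η) M.eigen.norm_eq M.eigen.proj ((hT i η h0 hη1).trans hη2)
  have hm0 : (m : ℂ) ≠ 0 := by
    have : m ≠ 0 := by linarith
    exact_mod_cast this
  -- The eigenvalue equation transfers the smoothing property of $T_N$ to $\psi$. Since
  -- $m^{-1}\le2$, its weighted norms are bounded uniformly in the family and in $\eta$.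
  have hψT : ψ = (m : ℂ)⁻¹ • truncSeries (schrodinger W) lam (V i) η N ψ := by
    rw [hTψ, inv_smul_smul₀ hm0]
  have hψn : ∀ n (E : NNReal), (∀ f, wnorm n (truncSeries (schrodinger W) lam (V i) η N f) ≤
      E * ‖f‖ₑ) → wnorm n ψ ≤ 2 * E := by
    intro n E hE
    rw [hψT]
    refine (wnorm_smul_le _ _ _).trans ?_
    have h1 : ‖(m : ℂ)⁻¹‖ₑ ≤ 2 := by
      have h2 : ‖(m : ℂ)⁻¹‖ₑ ≤ ‖(2 : ℝ)‖ₑ := by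
        rw [enorm_le_iff_norm_le, norm_inv, Complex.norm_real, Real.norm_eq_abs, Real.norm_eq_abs,
          abs_of_pos (by linarith), abs_two]
        exact inv_le_of_inv_le₀ (by norm_num) (by linarith)
      refine h2.trans_eq ?_
      rw [Real.enorm_eq_ofReal zero_le_two, ENNReal.ofReal_ofNat]
    have h3 := hE ψ
    have h4 : ‖ψ‖ₑ = 1 := by rw [← ofReal_norm, hψ, ENNReal.ofReal_one]
    rw [h4, mul_one] at h3
    gcongr
  have hψr : ψ ∈ rapid := fun n => by
    obtain ⟨E, hE⟩ := M.wnorm_truncSeries_le F N n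
    exact (hψn n E (hE i η h0 hη1)).trans_lt
      (ENNReal.mul_lt_top ENNReal.ofNat_lt_top ENNReal.coe_lt_top)
  have hw₁ := hψn m₁ E₁ (hE₁ i η h0 hη1)
  have hw₂ := hψn m₂ E₂ (hE₂ i η h0 hη1)
  have hriesz := riesz_eq hTs hψ hTψ hm1 hm2 hrest
  lift ψ to rapid using hψr
  have hvs := inner_mulRapid (F.polyBdd i)
  generalize hvdef : mulRapid (F.polyBdd i) = v at hvs ⊢
  have hTv := fun f => M.truncSeries_apply F N i η f
  have hd₁ := hD₁ i ψ
  have hd₂ := hD₂ i ψ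
  simp only [hvdef, wnorm_zero_left, Module.End.mul_apply] at hTv hd₁ hd₂
  have hTe : M.truncEnd v η N ψ = (m : ℂ) • ψ := Subtype.ext (by
    rw [← hTv, hTψ]
    rfl)
  obtain ⟨z, hz⟩ := M.exists_truncEnd_mem_graph v η N ψ
  have hψz : ((ψ : L2), (((m : ℂ)⁻¹ • z : rapid) : L2)) ∈ (schrodinger W).graph := by
    have := (schrodinger W).graph.smul_mem (m : ℂ)⁻¹ hz
    rw [hTe] at this
    convert this using 1
    refine Prod.ext ?_ rfl
    change (ψ : L2) = (m : ℂ)⁻¹ • (m : ℂ) • (ψ : L2)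
    rw [inv_smul_smul₀ hm0]
  generalize (m : ℂ)⁻¹ • z = h at hψz
  refine ⟨ψ, h, hψ, hψz, hriesz, ?_⟩
  have hcomm := M.truncEnd_commutator hvs η N hψz
  have hmh : ((((m : ℂ) • ψ : rapid) : L2), (((m : ℂ) • h : rapid) : L2)) ∈
      (schrodinger W).graph := (schrodinger W).graph.smul_mem (m : ℂ) hψz
  -- Two expressions for $H(m\psi)=HT_N\psi$, one by linearity and one by the commutator formula.
  have heq := Subtype.ext (LinearPMap.mem_graph_snd_inj _ hcomm hmh (congrArg Subtype.val hTe))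
  set K := v (M.coeffEnd v N ψ) - M.coeffEnd v N (v ψ) with hK
  have hKn : ‖(K : L2)‖ ≤ 2 * (D₁ * E₁ + D₂ * E₂ : NNReal) := by
    have h1 : ‖(v (M.coeffEnd v N ψ) : L2)‖ₑ ≤ ((D₁ * (2 * E₁) : NNReal) : ENNReal) := by
      push_cast
      exact hd₁.trans (mul_le_mul_right hw₁ _)
    have h2 : ‖(M.coeffEnd v N (v ψ) : L2)‖ₑ ≤ ((D₂ * (2 * E₂) : NNReal) : ENNReal) := by
      push_cast
      exact hd₂.trans (mul_le_mul_right hw₂ _)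
    have h1' : ‖(v (M.coeffEnd v N ψ) : L2)‖ ≤ ((D₁ * (2 * E₁) : NNReal) : ℝ) :=
      NNReal.coe_le_coe.2 (ENNReal.coe_le_coe.1 h1)
    have h2' : ‖(M.coeffEnd v N (v ψ) : L2)‖ ≤ ((D₂ * (2 * E₂) : NNReal) : ℝ) :=
      NNReal.coe_le_coe.2 (ENNReal.coe_le_coe.1 h2)
    refine (norm_sub_le _ _).trans ((add_le_add h1' h2').trans_eq ?_)
    push_cast
    ring
  set g := h + (η : ℂ) • v ψ with hg
  have hmg : (m : ℂ) • g - M.truncEnd v η N g = (η : ℂ) ^ (N + 1) • K := by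
    rw [hTe] at heq
    rw [hg, smul_add, ← heq, map_add, map_smul, map_smul]
    module
  have hψψ : inner ℂ (ψ : L2) (ψ : L2) = (1 : ℂ) := by
    rw [inner_self_eq_norm_sq_to_K, hψ]
    simp
  set k : L2 := (g : L2) - (inner ℂ (ψ : L2) (g : L2) : ℂ) • (ψ : L2) with hk
  have hkorth : inner ℂ (ψ : L2) k = (0 : ℂ) := by
    rw [hk, inner_sub_right, inner_smul_right, hψψ, mul_one, sub_self]
  have hTk := hrest k hkorth
  have hmk : (m : ℂ) • k - truncSeries (schrodinger W) lam (V i) η N k =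
      (η : ℂ) ^ (N + 1) • (K : L2) := by
    have h1 : ((m : ℂ) • (g : L2) - truncSeries (schrodinger W) lam (V i) η N g) =
        (η : ℂ) ^ (N + 1) • (K : L2) := by
      rw [hTv]
      exact congrArg Subtype.val hmg
    rw [hk, map_sub, map_smul, hTψ, ← h1, smul_sub, smul_comm (m : ℂ)]
    abel
  -- On the complement of $\psi$ this gives $\|(m-T_N)k\|\ge(15/16-7/16)\|k\|$.
  have h1 := norm_sub_norm_le ((m : ℂ) • k) (truncSeries (schrodinger W) lam (V i) η N k)
  rw [hmk, norm_smul, norm_smul, norm_pow, Complex.norm_real, Complex.norm_real, Real.norm_eq_abs,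
    Real.norm_eq_abs, abs_of_pos h0, abs_of_pos (by linarith)] at h1
  have h2 : η ^ (N + 1) * ‖(K : L2)‖ ≤ η ^ (N + 1) * (2 * (D₁ * E₁ + D₂ * E₂ : NNReal)) := by
    gcongr
  have h3 := mul_le_mul_of_nonneg_right hm1 (norm_nonneg k)
  have h4 : 0 < η ^ (N + 1) := by positivity
  linarith

end Confined

end Series

/-! ### Self-adjointness and perturbations -/

/-- A self-adjoint Schrödinger operator contains all weak solutions. -/
theorem mem_graph_of_weak {W : Plane → ℝ} (hW : PolyBdd W) (hA : PosSA (schrodinger W)) {ψ g : L2}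
    (h : ∀ q ∈ coreGraph W, inner ℂ q.2 ψ = inner ℂ q.1 g) : (ψ, g) ∈ (schrodinger W).graph := by
  obtain ⟨R, hR⟩ := hA.resolvent 1 one_pos
  have hu := hR.mem_graph (g + ψ)
  rw [Complex.ofReal_one, one_smul] at hu
  have hcl : IsClosed {q : L2 × L2 | inner ℂ (q.2 + q.1) (ψ - R (g + ψ)) = (0 : ℂ)} :=
    isClosed_eq (Continuous.inner (by fun_prop) (by fun_prop)) continuous_const
  -- The difference between $\psi$ and $(A+1)^{-1}(g+\psi)$ is orthogonal to the range of $A+1$,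
  -- which is the whole space.
  have hq : ∀ q ∈ (schrodinger W).graph, inner ℂ (q.2 + q.1) (ψ - R (g + ψ)) = (0 : ℂ) := by
    intro q hq
    refine schrodinger_graph_induction hW hcl (fun q hq => ?_) hq
    have h1 := hA.symm (coreGraph_le hW hq) hu
    rw [inner_sub_right, inner_add_left, inner_add_left, h q hq, ← h1, inner_sub_right,
      inner_add_right]
    ring
  have h2 := hq _ (hR.mem_graph (ψ - R (g + ψ)))
  simp only [Complex.ofReal_one, one_smul, sub_add_cancel] at h2
  have h3 : ψ = R (g + ψ) := sub_eq_zero.1 (inner_self_eq_zero.1 h2)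
  rw [← h3, add_sub_cancel_right] at hu
  exact hu

/-- By self-adjointness of the perturbed operator it suffices to verify the equation weakly against
test functions, where $V$ can be moved freely. No relative bound of $V$ with respect to $H$ is
needed. -/
theorem mem_graph_perturbed {W V : Plane → ℝ} {η : ℝ} (hW : PolyBdd W) (hV : PolyBdd V)
    (hWV : PolyBdd fun x => W x + η * V x) (hH : PosSA (schrodinger W))
    (hA : PosSA (schrodinger fun x => W x + η * V x)) {ψ h : rapid}
    (hψ : ((ψ : L2), (h : L2)) ∈ (schrodinger W).graph) :
    ((ψ : L2), ((h + (η : ℂ) • mulRapid hV ψ : rapid) : L2)) ∈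
      (schrodinger fun x => W x + η * V x).graph := by
  refine mem_graph_of_weak hWV hA ?_
  rintro ⟨f, k⟩ ⟨φ, hs, hc, hf, hk⟩
  simp only at hf hk ⊢
  have hφ : IsTest φ := ⟨hs, hc⟩
  have hfr := mem_rapid_of_test hφ hf
  lift f to rapid using hfr
  have hcore : ((f : L2), k - (η : ℂ) • (mulRapid hV f : L2)) ∈ coreGraph W := by
    refine ⟨φ, hs, hc, hf, ?_⟩
    simp only
    filter_upwards [Lp.coeFn_sub k ((η : ℂ) • (mulRapid hV f : L2)),
      Lp.coeFn_smul (η : ℂ) (mulRapid hV f : L2), coeFn_mulRapid hV f, hf, hk] with x h1 h2 h3 h4 h5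
    rw [h1, Pi.sub_apply, h2, Pi.smul_apply, h3, h4, h5, smul_eq_mul]
    push_cast
    ring
  have h1 := hH.symm (coreGraph_le hW hcore) hψ
  rw [inner_sub_left, inner_smul_left, Complex.conj_ofReal, inner_mulRapid] at h1
  rw [Submodule.coe_add, Submodule.coe_smul, inner_add_right, inner_smul_right, h1]
  ring

/-! ### The magnetic model -/

section Model

variable {α : ℝ} {Θ : ℝ → ℝ} {c₁ c₂ : ℝ}

theorem polarAngle_mem (x : Plane) : polarAngle x ∈ Ico 0 (2 * Real.pi) := by
  have := toIcoMod_mem_Ico Real.two_pi_pos 0 (Complex.arg ⟨x 0, x 1⟩)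
  rwa [zero_add] at this

theorem measurable_polarAngle : Measurable polarAngle := by
  have h1 : Measurable fun x : Plane => Complex.arg ⟨x 0, x 1⟩ := by
    refine Complex.measurable_arg.comp ?_
    have h2 : Measurable fun x : Plane => ((x 0 : ℝ) : ℂ) + ((x 1 : ℝ) : ℂ) * Complex.I := by
      fun_prop
    have h3 : (fun x : Plane => (⟨x 0, x 1⟩ : ℂ)) =
        fun x : Plane => ((x 0 : ℝ) : ℂ) + ((x 1 : ℝ) : ℂ) * Complex.I :=
      funext fun x => Complex.mk_eq_add_mul_I _ _
    rw [h3]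
    exact h2
  have h2 : polarAngle = fun x : Plane => if 0 ≤ Complex.arg ⟨x 0, x 1⟩ then
      Complex.arg ⟨x 0, x 1⟩ else Complex.arg ⟨x 0, x 1⟩ + 2 * Real.pi := by
    funext x
    have h3 := Complex.neg_pi_lt_arg ⟨x 0, x 1⟩
    have h4 := Complex.arg_le_pi ⟨x 0, x 1⟩
    have h5 := Real.pi_pos
    unfold polarAngle
    split_ifs with h
    · exact (toIcoMod_eq_self _).2 ⟨h, by linarith⟩
    · rw [← toIcoMod_add_right]
      exact (toIcoMod_eq_self _).2 ⟨by linarith, by linarith⟩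
  rw [h2]
  exact Measurable.ite (measurableSet_le measurable_const h1) h1 (h1.add_const _)

theorem measurable_angular (hΘ : ContinuousOn Θ (Ico 0 (2 * Real.pi))) :
    Measurable fun x => Θ (polarAngle x) := by
  classical
  have h1 : Measurable ((Ico 0 (2 * Real.pi)).piecewise Θ 0) :=
    hΘ.measurable_piecewise continuousOn_const measurableSet_Ico
  have h2 : (fun x => Θ (polarAngle x)) =
      fun x => (Ico 0 (2 * Real.pi)).piecewise Θ 0 (polarAngle x) := by
    funext x
    rw [piecewise_eq_of_mem _ _ _ (polarAngle_mem x)]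
  rw [h2]
  exact h1.comp measurable_polarAngle

theorem norm_rpow_le {s : ℝ} (hs : 0 ≤ s) {m : ℕ} (hm : s ≤ m) (x : Plane) :
    ‖x‖ ^ s ≤ wt x ^ m := by
  have h1 : ‖x‖ ≤ wt x := by
    unfold wt
    nlinarith [sq_nonneg (‖x‖ - 1)]
  calc ‖x‖ ^ s ≤ wt x ^ s := Real.rpow_le_rpow (norm_nonneg x) h1 hs
    _ ≤ wt x ^ (m : ℝ) := Real.rpow_le_rpow_of_exponent_le (one_le_wt x) hm
    _ = wt x ^ m := Real.rpow_natCast _ _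

theorem measurable_homPot (hΘ : ContinuousOn Θ (Ico 0 (2 * Real.pi))) :
    Measurable (homPot α Θ) :=
  (measurable_norm.pow_const α).mul (measurable_angular hΘ)

theorem confPot_eq (x : Plane) : confPot α Θ x = homPot α Θ x ^ 2 := by
  unfold confPot homPot
  rw [mul_pow, mul_comm 2 α, Real.rpow_mul (norm_nonneg x)]
  norm_cast

theorem confPot_nonneg (x : Plane) : 0 ≤ confPot α Θ x := by
  rw [confPot_eq]
  positivity

theorem abs_homPot_le (hα : 0 < α) (hc₁ : 0 < c₁)
    (hb : ∀ θ ∈ Ico 0 (2 * Real.pi), c₁ ≤ Θ θ ∧ Θ θ ≤ c₂) {m : ℕ} (hm : α ≤ m) (x : Plane) :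
    |homPot α Θ x| ≤ c₂ * wt x ^ m := by
  obtain ⟨h1, h2⟩ := hb _ (polarAngle_mem x)
  have h3 := norm_rpow_le hα.le hm x
  have h4 : 0 ≤ ‖x‖ ^ α := Real.rpow_nonneg (norm_nonneg x) α
  unfold homPot
  rw [abs_of_nonneg (mul_nonneg h4 (hc₁.le.trans h1)), mul_comm]
  exact mul_le_mul h2 h3 h4 (hc₁.le.trans (h1.trans h2))

theorem polyBdd_confPot (hα : 0 < α) (hΘ : ContinuousOn Θ (Ico 0 (2 * Real.pi))) (hc₁ : 0 < c₁)
    (hb : ∀ θ ∈ Ico 0 (2 * Real.pi), c₁ ≤ Θ θ ∧ Θ θ ≤ c₂) : PolyBdd (confPot α Θ) := by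
  refine ⟨?_, c₂ ^ 2, ⌈α⌉₊ * 2, by positivity, Eventually.of_forall fun x => ?_⟩
  · have : confPot α Θ = fun x => homPot α Θ x ^ 2 := funext confPot_eq
    rw [this]
    exact ((measurable_homPot hΘ).pow_const 2).aestronglyMeasurable
  · rw [confPot_eq, abs_pow, pow_mul, ← mul_pow]
    exact pow_le_pow_left₀ (abs_nonneg _) (abs_homPot_le hα hc₁ hb (Nat.le_ceil α) x) 2

theorem confPot_grow (hα : 0 < α) (hc₁ : 0 < c₁)
    (hb : ∀ θ ∈ Ico 0 (2 * Real.pi), c₁ ≤ Θ θ ∧ Θ θ ≤ c₂) (L : ℝ) :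
    ∃ r : ℝ, ∀ x, r ≤ ‖x‖ → L ≤ confPot α Θ x := by
  have h1 : Tendsto (fun r : ℝ => r ^ (2 * α) * c₁ ^ 2) atTop atTop :=
    (tendsto_rpow_atTop (by positivity)).atTop_mul_const (by positivity)
  obtain ⟨r, hr⟩ := eventually_atTop.1 (h1.eventually_ge_atTop L)
  refine ⟨r, fun x hx => (hr _ hx).trans ?_⟩
  unfold confPot
  have := (hb _ (polarAngle_mem x)).1
  gcongr

variable {γ δ K : ℝ} {𝔞 : Plane → ℝ} {ε p p₀ : ℝ}

theorem beta_pos (hα : 0 < α) : 0 < beta α := by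
  unfold beta
  positivity

theorem beta_mul (hα : 0 < α) : beta α * (α + 1) = 1 := by
  unfold beta
  field_simp

/-- The perturbation in terms of the rescaled potential `ε⁻¹ 𝔞(ε^β x)`. -/
theorem Va_eq (hα : 0 < α) (hε : 0 < ε) (x : Plane) : Va α γ Θ 𝔞 ε p x =
    p * (ε ^ beta α * p + 2 * homPot α Θ x) + 2 * homPot α Θ x * (ε⁻¹ * 𝔞 (ε ^ beta α • x)) +
      2 * p * ε ^ beta α * (ε⁻¹ * 𝔞 (ε ^ beta α • x)) +
        ε ^ beta α * (ε⁻¹ * 𝔞 (ε ^ beta α • x)) ^ 2 := by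
  have h1 : (ε ^ beta α) ^ (γ - α - 1) * ε ^ (beta α * (α - γ + 2)) = ε ^ beta α := by
    rw [← Real.rpow_mul hε.le, ← Real.rpow_add hε]
    congr 1
    ring
  have h2 : ε ^ beta α * ε ^ (-2 + beta α * α) = ε⁻¹ := by
    rw [← Real.rpow_add hε, ← Real.rpow_neg_one]
    congr 1
    linarith [beta_mul hα]
  have h3 : ε ^ (-1 : ℝ) = ε⁻¹ := Real.rpow_neg_one ε
  have h4 : ε ^ (-2 : ℝ) = ε⁻¹ ^ 2 := by
    rw [Real.rpow_neg hε.le, inv_pow]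
    norm_cast
  unfold Va What Vhat
  rw [← mul_assoc, h1, h3, h4, ← h2]
  ring

/-- The perturbed potential is a perfect square, hence nonnegative, although the perturbation itself
need not be. This gives self-adjointness of the perturbed operator. -/
theorem confPot_add_Va (hα : 0 < α) (hε : 0 < ε) (x : Plane) :
    confPot α Θ x + ε ^ beta α * Va α γ Θ 𝔞 ε p x =
      (ε ^ beta α * p + homPot α Θ x + ε ^ beta α * (ε⁻¹ * 𝔞 (ε ^ beta α • x))) ^ 2 := by
  rw [Va_eq hα hε, confPot_eq]
  ring

/-- A bound by $|y|^s$ at $y=\varepsilon^\beta x$ yields $\varepsilon^{\beta s-1}|x|^s$, and $\beta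
s\ge\beta(\alpha+1)=1$ for both $s=\gamma$ and $s=\delta$. So the factor $\varepsilon^{-1}$ is
absorbed uniformly in $\varepsilon<1$. -/
theorem abs_rescaled_le (hα : 0 < α) (hγ : 3 + α ≤ γ) (hδ : γ ≤ δ)
    (h_in : ∀ᵐ x : Plane, ‖x‖ < 1 → |𝔞 x| ≤ K * ‖x‖ ^ γ)
    (h_out : ∀ᵐ x : Plane, 1 ≤ ‖x‖ → |𝔞 x| ≤ K * ‖x‖ ^ δ) (hε : 0 < ε) (hε1 : ε < 1) {m : ℕ}
    (hm : δ ≤ m) : ∀ᵐ x : Plane, |ε⁻¹ * 𝔞 (ε ^ beta α • x)| ≤ |K| * wt x ^ m := by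
  have he : 0 < ε ^ beta α := Real.rpow_pos_of_pos hε _
  have hq : Measure.QuasiMeasurePreserving (fun x : Plane => ε ^ beta α • x) volume volume :=
    Measure.quasiMeasurePreserving_smul volume he.ne'
  filter_upwards [hq.ae h_in, hq.ae h_out] with x h1 h2
  have hpow : ∀ s, γ ≤ s → s ≤ m → |𝔞 (ε ^ beta α • x)| ≤ K * ‖ε ^ beta α • x‖ ^ s →
      |ε⁻¹ * 𝔞 (ε ^ beta α • x)| ≤ |K| * wt x ^ m := by
    intro s hs hsm h
    have hs0 : 0 ≤ s := by linarith
    rw [abs_mul, abs_of_pos (inv_pos.2 hε)]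
    have h3 : ‖ε ^ beta α • x‖ ^ s ≤ ε * wt x ^ m := by
      rw [norm_smul, Real.norm_eq_abs, abs_of_pos he, Real.mul_rpow he.le (norm_nonneg x),
        ← Real.rpow_mul hε.le]
      refine mul_le_mul ?_ (norm_rpow_le hs0 hsm x) (Real.rpow_nonneg (norm_nonneg x) s) hε.le
      nth_rw 2 [← Real.rpow_one ε]
      refine Real.rpow_le_rpow_of_exponent_ge hε hε1.le ?_
      rw [← beta_mul hα]
      have := beta_pos hα
      gcongr
      linarith
    calc ε⁻¹ * |𝔞 (ε ^ beta α • x)| ≤ ε⁻¹ * (|K| * (ε * wt x ^ m)) := by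
          gcongr
          refine h.trans ?_
          have h4 : 0 ≤ ‖ε ^ beta α • x‖ ^ s := Real.rpow_nonneg (norm_nonneg _) s
          exact mul_le_mul (le_abs_self K) h3 h4 (abs_nonneg K)
      _ = |K| * wt x ^ m := by
          field_simp
  rcases lt_or_ge ‖ε ^ beta α • x‖ 1 with hx | hx
  · exact hpow γ le_rfl (hδ.trans hm) (h1 hx)
  · exact hpow δ hδ hm (h2 hx)

theorem aestronglyMeasurable_rescaled (h𝔞 : AEStronglyMeasurable 𝔞 volume) (hε : 0 < ε) :
    AEStronglyMeasurable (fun x : Plane => ε⁻¹ * 𝔞 (ε ^ beta α • x)) volume :=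
  (h𝔞.comp_quasiMeasurePreserving
    (Measure.quasiMeasurePreserving_smul volume (Real.rpow_pos_of_pos hε _).ne')).const_mul _

theorem abs_Va_le (hα : 0 < α) (hγ : 3 + α ≤ γ) (hδ : γ ≤ δ) (hc₁ : 0 < c₁)
    (hb : ∀ θ ∈ Ico 0 (2 * Real.pi), c₁ ≤ Θ θ ∧ Θ θ ≤ c₂)
    (h_in : ∀ᵐ x : Plane, ‖x‖ < 1 → |𝔞 x| ≤ K * ‖x‖ ^ γ)
    (h_out : ∀ᵐ x : Plane, 1 ≤ ‖x‖ → |𝔞 x| ≤ K * ‖x‖ ^ δ) (hε : 0 < ε) (hε1 : ε < 1)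
    (hp : |p| ≤ p₀) {m : ℕ} (hm : δ ≤ m) : ∀ᵐ x : Plane, |Va α γ Θ 𝔞 ε p x| ≤
      (p₀ * (p₀ + 2 * c₂) + 2 * c₂ * |K| + 2 * p₀ * |K| + |K| ^ 2) * wt x ^ (m * 2) := by
  have he : 0 < ε ^ beta α := Real.rpow_pos_of_pos hε _
  have he1 : ε ^ beta α ≤ 1 := Real.rpow_le_one hε.le hε1.le (beta_pos hα).le
  have hp₀ : 0 ≤ p₀ := (abs_nonneg p).trans hp
  have hc₂ : 0 ≤ c₂ := by
    have := hb 0 ⟨le_rfl, by positivity⟩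
    linarith
  filter_upwards [abs_rescaled_le hα hγ hδ h_in h_out hε hε1 hm] with x hx
  rw [Va_eq hα hε]
  have hh := abs_homPot_le hα hc₁ hb (show α ≤ m by linarith) x
  have hw : 1 ≤ wt x ^ m := one_le_pow₀ (one_le_wt x)
  set w := wt x ^ m
  set a := ε⁻¹ * 𝔞 (ε ^ beta α • x)
  set h := homPot α Θ x
  set e := ε ^ beta α
  have hw0 : 0 ≤ w := zero_le_one.trans hw
  have hww : w ≤ w ^ 2 := by nlinarith
  have h1 : |p * (e * p + 2 * h)| ≤ p₀ * (p₀ + 2 * c₂) * w ^ 2 := by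
    have h2 : |e * p + 2 * h| ≤ (p₀ + 2 * c₂) * w ^ 2 := by
      calc |e * p + 2 * h| ≤ |e * p| + |2 * h| := abs_add_le _ _
        _ = e * |p| + 2 * |h| := by rw [abs_mul, abs_mul, abs_of_pos he, abs_two]
        _ ≤ 1 * p₀ + 2 * (c₂ * w) := by gcongr
        _ ≤ (p₀ + 2 * c₂) * w ^ 2 := by nlinarith
    rw [abs_mul, mul_assoc]
    gcongr
  have h2 : |2 * h * a| ≤ 2 * c₂ * |K| * w ^ 2 := by
    calc |2 * h * a| = 2 * |h| * |a| := by rw [abs_mul, abs_mul, abs_two]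
      _ ≤ 2 * (c₂ * w) * (|K| * w) := by gcongr
      _ = _ := by ring
  have h3 : |2 * p * e * a| ≤ 2 * p₀ * |K| * w ^ 2 := by
    calc |2 * p * e * a| = 2 * |p| * e * |a| := by
          rw [abs_mul, abs_mul, abs_mul, abs_two, abs_of_pos he]
      _ ≤ 2 * p₀ * 1 * (|K| * w) := by gcongr
      _ = 2 * p₀ * |K| * w := by ring
      _ ≤ _ := by gcongr
  have h4 : |e * a ^ 2| ≤ |K| ^ 2 * w ^ 2 := by
    calc |e * a ^ 2| = e * |a| ^ 2 := by rw [abs_mul, abs_pow, abs_of_pos he]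
      _ ≤ 1 * (|K| * w) ^ 2 := by gcongr
      _ = _ := by ring
  rw [pow_mul]
  calc _ ≤ |p * (e * p + 2 * h)| + |2 * h * a| + |2 * p * e * a| + |e * a ^ 2| :=
        (abs_add_le _ _).trans (add_le_add (abs_add_three _ _ _) le_rfl)
    _ ≤ p₀ * (p₀ + 2 * c₂) * w ^ 2 + 2 * c₂ * |K| * w ^ 2 + 2 * p₀ * |K| * w ^ 2 +
        |K| ^ 2 * w ^ 2 := by gcongr
    _ = _ := by ring

theorem aestronglyMeasurable_Va (hα : 0 < α) (hΘ : ContinuousOn Θ (Ico 0 (2 * Real.pi)))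
    (h𝔞 : AEStronglyMeasurable 𝔞 volume) (hε : 0 < ε) :
    AEStronglyMeasurable (Va α γ Θ 𝔞 ε p) volume := by
  have h1 : Va α γ Θ 𝔞 ε p = _ := funext (Va_eq hα hε)
  have h2 := (measurable_homPot (α := α) hΘ).aestronglyMeasurable (μ := (volume : Measure Plane))
  have h3 := aestronglyMeasurable_rescaled (α := α) h𝔞 hε
  rw [h1]
  exact ((((h2.const_mul 2).const_add _).const_mul p).add ((h2.const_mul 2).mul h3)).add
    (h3.const_mul _) |>.add ((h3.pow 2).const_mul _)

theorem polyBdd_perturbed {W V : Plane → ℝ} (hW : PolyBdd W) (hV : PolyBdd V) (η : ℝ) :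
    PolyBdd fun x => W x + η * V x := by
  obtain ⟨h1, C, m, hC, h2⟩ := hW
  obtain ⟨h3, D, n, hD, h4⟩ := hV
  refine ⟨h1.add (h3.const_mul η), C + |η| * D, m + n, by positivity, ?_⟩
  filter_upwards [h2, h4] with x h5 h6
  have hw := one_le_wt x
  have hw0 : 0 ≤ wt x := zero_le_one.trans hw
  calc |W x + η * V x| ≤ |W x| + |η| * |V x| := (abs_add_le _ _).trans_eq (by rw [abs_mul])
    _ ≤ C * wt x ^ m + |η| * (D * wt x ^ n) := by gcongr
    _ ≤ C * wt x ^ (m + n) + |η| * (D * wt x ^ (m + n)) := by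
      gcongr <;> first | exact hw | omega
    _ = _ := by ring

end Model

/-- The index set consists of all admissible $(\varepsilon,p)$. A common polynomial bound is what
makes the final constants independent of both. -/
theorem magnetic_family {α γ δ K c₁ c₂ p₀ : ℝ} {Θ : ℝ → ℝ} {𝔞 : Plane → ℝ} (hα : 0 < α)
    (hγ : 3 + α ≤ γ) (hδ : γ ≤ δ) (hΘ : ContinuousOn Θ (Ico 0 (2 * Real.pi))) (hc₁ : 0 < c₁)
    (hb : ∀ θ ∈ Ico 0 (2 * Real.pi), c₁ ≤ Θ θ ∧ Θ θ ≤ c₂)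
    (h𝔞 : AEStronglyMeasurable 𝔞 volume)
    (h_in : ∀ᵐ x : Plane, ‖x‖ < 1 → |𝔞 x| ≤ K * ‖x‖ ^ γ)
    (h_out : ∀ᵐ x : Plane, 1 ≤ ‖x‖ → |𝔞 x| ≤ K * ‖x‖ ^ δ) :
    Confined.Family fun i : {q : ℝ × ℝ // (0 < q.1 ∧ q.1 < 1) ∧ |q.2| ≤ p₀} =>
      Va α γ Θ 𝔞 i.1.1 i.1.2 := by
  -- The constant is truncated to be nonnegative because $p_0$ may be negative; the index set is
  -- then empty.
  have key : ∀ i : {q : ℝ × ℝ // (0 < q.1 ∧ q.1 < 1) ∧ |q.2| ≤ p₀}, ∀ᵐ x,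
      |Va α γ Θ 𝔞 i.1.1 i.1.2 x| ≤
        (Real.toNNReal (p₀ * (p₀ + 2 * c₂) + 2 * c₂ * |K| + 2 * p₀ * |K| + |K| ^ 2) : ℝ) *
          wt x ^ (⌈δ⌉₊ * 2) := by
    rintro ⟨⟨ε, p⟩, ⟨hε, hε1⟩, hp⟩
    filter_upwards [abs_Va_le hα hγ hδ hc₁ hb h_in h_out hε hε1 hp (Nat.le_ceil δ)] with x hx
    refine hx.trans ?_
    have := one_le_wt x
    gcongr
    exact Real.le_coe_toNNReal _
  exact ⟨fun i => ⟨aestronglyMeasurable_Va hα hΘ h𝔞 i.2.1.1, _, _, NNReal.coe_nonneg _, key i⟩,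
    _, _, key⟩

end AlmostInvariant

end

/-! ### The proposition -/

theorem proposition3p5
    (α γ δ : ℝ) (hα : 0 < α) (hγ : 3 + α ≤ γ) (hδ : γ ≤ δ)
    (Θ : ℝ → ℝ) (hΘ : ContinuousOn Θ (Set.Ico 0 (2 * Real.pi)))
    (c₁ c₂ : ℝ) (hc₁ : 0 < c₁) (hΘ_bound : ∀ θ ∈ Set.Ico 0 (2 * Real.pi), c₁ ≤ Θ θ ∧ Θ θ ≤ c₂)
    (𝔞 : Plane → ℝ) (h𝔞 : AEStronglyMeasurable 𝔞 volume) (K : ℝ)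
    (h𝔞_in : ∀ᵐ x : Plane, ‖x‖ < 1 → |𝔞 x| ≤ K * ‖x‖ ^ γ)
    (h𝔞_out : ∀ᵐ x : Plane, 1 ≤ ‖x‖ → |𝔞 x| ≤ K * ‖x‖ ^ δ)
    (lam : ℝ) (hlam : Module.finrank ℂ (eigenspace (H0 α Θ) lam) = 1)
    (N : ℕ) (p₀ : ℝ) :
    ∃ C > 0, ∃ ε₀ > 0, ∀ ε : ℝ, 0 < ε → ε < ε₀ → ∀ p : ℝ, |p| ≤ p₀ →
      -- `P_N` is an orthogonal projection of rank one, and `P_N 𝓗_𝔞 P_N` acts on its range as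
      -- multiplication by a real number
      (IsStarProjection (PN α γ Θ 𝔞 lam N ε p) ∧
        Module.finrank ℂ (PN α γ Θ 𝔞 lam N ε p).range = 1 ∧
        ∃ μ : ℝ, (PN α γ Θ 𝔞 lam N ε p).range ≤ eigenspace (effHam α γ Θ 𝔞 lam N ε p) μ) ∧
      -- the subspace is almost invariant under the dynamics
      (∀ t : ℝ, 0 < t →
        ‖(1 - PN α γ Θ 𝔞 lam N ε p) * propagator α γ Θ 𝔞 ε p t * PN α γ Θ 𝔞 lam N ε p‖
          ≤ C * |t| * ε ^ (beta α * ((N : ℝ) - 1))) ∧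
      -- the effective dynamics of the normalized almost-eigenvector
      ∀ (μ : ℝ) (χ : L2), ‖χ‖ = 1 → χ ∈ (PN α γ Θ 𝔞 lam N ε p).range →
        χ ∈ eigenspace (effHam α γ Θ 𝔞 lam N ε p) μ → ∀ t : ℝ, 0 < t →
          ‖propagator α γ Θ 𝔞 ε p t χ
              - Complex.exp (-Complex.I * t * (ε ^ (-2 * beta α) : ℝ) * μ) • χ‖
            ≤ C * |t| * ε ^ (beta α * ((N : ℝ) - 1)) := by
  have hW : PolyBdd (confPot α Θ) := polyBdd_confPot hα hΘ hc₁ hΘ_bound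
  have hg := confPot_grow hα hc₁ hΘ_bound
  have hH : PosSA (schrodinger (confPot α Θ)) := posSA_schrodinger hW confPot_nonneg
  obtain ⟨R, hR⟩ := hH.resolvent 1 one_pos
  obtain ⟨χ₀, hχ₀⟩ := exists_simpleEigen hH hR
    (isCompactOperator_resolvent hW confPot_nonneg hg hR) hlam
  have M : Confined (confPot α Θ) R lam χ₀ := ⟨hW, confPot_nonneg, hg, hχ₀⟩
  have F := magnetic_family (p₀ := p₀) hα hγ hδ hΘ hc₁ hΘ_bound h𝔞 h𝔞_in h𝔞_out
  obtain ⟨C, hC, η₀, hη₀, hM⟩ := Confined.exists_almost_eigenvector M F N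
  -- Since $\beta(\alpha+1)=1$, the condition $\varepsilon<\eta_0^{\alpha+1}$ is exactly
  -- $\eta=\varepsilon^\beta<\eta_0$.
  refine ⟨C, hC, min 1 (η₀ ^ (α + 1)), lt_min one_pos (Real.rpow_pos_of_pos hη₀ _), ?_⟩
  intro ε hε hε₀ p hp
  have hε1 : ε < 1 := hε₀.trans_le (min_le_left _ _)
  have he : 0 < ε ^ beta α := Real.rpow_pos_of_pos hε _
  have heη : ε ^ beta α < η₀ := by
    have h1 := Real.rpow_lt_rpow hε.le (hε₀.trans_le (min_le_right _ _)) (beta_pos hα)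
    rwa [← Real.rpow_mul hη₀.le, mul_comm (α + 1), beta_mul hα, Real.rpow_one] at h1
  obtain ⟨ψ, h, hψ, hgr, hP, hest⟩ := hM ⟨(ε, p), ⟨hε, hε1⟩, hp⟩ (ε ^ beta α) he heη
  have hV : PolyBdd (Va α γ Θ 𝔞 ε p) := F.polyBdd ⟨(ε, p), ⟨hε, hε1⟩, hp⟩
  have hWV := polyBdd_perturbed hW hV (ε ^ beta α)
  have hA : PosSA (schrodinger fun x => confPot α Θ x + ε ^ beta α * Va α γ Θ 𝔞 ε p x) :=
    posSA_schrodinger hWV fun x => by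
      rw [confPot_add_Va hα hε]
      positivity
  have hP' : PN α γ Θ 𝔞 lam N ε p = InnerProductSpace.rankOne ℂ (ψ : L2) (ψ : L2) := hP
  obtain ⟨hr, hinv, hdyn⟩ := almost_invariant hA hψ (mem_graph_perturbed hW hV hWV hH hA hgr) hest
  -- The residual $\eta^{N+1}$ loses two powers of $\eta$ to the time scale $\varepsilon^{-2\beta}$.
  have htime : ∀ t : ℝ, C * (ε ^ beta α) ^ (N + 1) * |t * ε ^ (-2 * beta α)| =
      C * |t| * ε ^ (beta α * ((N : ℝ) - 1)) := by
    intro t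
    have h1 : (ε ^ beta α) ^ (N + 1) * ε ^ (-2 * beta α) = ε ^ (beta α * ((N : ℝ) - 1)) := by
      rw [← Real.rpow_natCast, ← Real.rpow_mul hε.le, ← Real.rpow_add hε]
      congr 1
      push_cast
      ring
    rw [abs_mul, abs_of_pos (Real.rpow_pos_of_pos hε _), ← h1]
    ring
  unfold effHam
  rw [hP']
  refine ⟨⟨InnerProductSpace.isStarProjection_rankOne_self hψ, ?_, hr⟩, fun t _ => ?_, ?_⟩
  · rw [rankOne_range_eq hψ]
    exact finrank_span_singleton (norm_ne_zero_iff.1 (by rw [hψ]; exact one_ne_zero))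
  · rw [← htime]
    exact hinv _
  · intro μ χ hχ hχr hχe t _
    rw [← htime]
    have h1 := hdyn μ χ hχ hχr hχe (t * ε ^ (-2 * beta α))
    rw [Complex.ofReal_mul, ← mul_assoc] at h1
    exact h1
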